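/- Let $\Lambda=\varprojlim_n \mathbb{C}[x_1,\dots,x_n]^{S_n}$ be the ring of symmetric functions (inverse limit in the category of graded rings), with its five classical families indexed by integer partitions $\lambda$: Schur functions $s_\lambda$, monomial symmetric functions $m_\lambda$, power sums $p_\lambda$, elementary symmetric functions $e_\lambda$ and complete homogeneous symmetric functions $h_\lambda$. For $f,g\in\Lambda$ the plethysm $f[g]\in\Lambda$ is defined as follows: $f\mapsto f[g]$ is the $\mathbb{C}$-algebra endomorphism of $\Lambda$ with $p_k\mapsto g(x_1^k,x_2^k,\dots)$ for all $k\ge 1$. A function $F:\{0,1\}^*\to\mathbb{N}$ is in $\#\mathsf{P}$ if there are a polynomial $q$ and a set $B\subseteq\{0,1\}^*\times\{0,1\}^*$, with membership decidable by a Turing machine in polynomial time, such that $F(w)=\#\{u : |u|\le q(|w|),\ (w,u)\in B\}$ for all $w$; and $\mathsf{GapP}=\{F-H : F,H\in\#\mathsf{P}\}$. **Theorem.** Let $\{f_\lambda\}$ and $\{g_\lambda\}$ be two (possibly equal) families from the list $\{s_\lambda\},\{m_\lambda\},\{p_\lambda\},\{e_\lambda\},\{h_\lambda\}$. Then there are unique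 integers $a^{\nu}_{\lambda\mu}$, indexed by triples of integer partitions and, for each $\lambda,\mu$, nonzero for only finitely many $\nu$, such that $$ f_\lambda[g_\mu] \;=\; \sum_{\nu} a^{\nu}_{\lambda\mu}\, s_\nu \qquad\text{for all partitions } \lambda,\mu, $$ and the function $(\lambda,\mu,\nu)\mapsto a^{\nu}_{\lambda\mu}$ is in $\mathsf{GapP}$, where triples of partitions are encoded as binary words with parts written in unary, and the function is extended by $0$ to the words that do not encode a triple of partitions. -/

import Mathlib

/-! ## Polynomial-time decidability, counting functions, gap functions -/

namespace Complexity

/-- `B ⊆ W × W` (`W = {0,1}*`, given by its characteristic function) is decided by a multi-stack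
Turing machine in time polynomial in the total length `|w| + |u|` of the pair `(w, u)`.
The two words are written on the input stack one after the other, with their letters tagged. -/
def PolyTimeDecidable (B : List Bool × List Bool → Bool) : Prop :=
  Nonempty (Turing.TM2ComputableInPolyTime
    (Computability.encodingProd (Computability.encodingList Bool)
      (Computability.encodingList Bool)).encode
    Computability.encodeBool B)

/-- The class `#P`: `f w` is the number of witnesses `u`, of length at most polynomial in `|w|`,
with `(w, u) ∈ B`, for a polynomial-time decidable `B`. -/
def SharpP : Set (List Bool → ℕ) :=
  {f | ∃ (B : List Bool × List Bool → Bool) (p : Polynomial ℕ), PolyTimeDecidable B ∧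
    ∀ w, f w = Set.ncard {u : List Bool | u.length ≤ p.eval w.length ∧ B (w, u) = true}}

/-- The class `GapP = #P - #P`. -/
def GapP : Set (List Bool → ℤ) :=
  {f | ∃ g ∈ SharpP, ∃ h ∈ SharpP, ∀ w, f w = (g w : ℤ) - (h w : ℤ)}

end Complexity

/-! ## Integer partitions and their unary encoding -/

/-- Integer partitions of all sizes. -/
abbrev IntPartition : Type := Σ n : ℕ, n.Partition

namespace IntPartition

/-- The parts in weakly decreasing order. -/
def rows (lam : IntPartition) : List ℕ := lam.2.parts.sort (· ≥ ·)

theorem rows_pos (lam : IntPartition) : ∀ k ∈ lam.rows, 0 < k := by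
  intro k hk
  exact lam.2.parts_pos ((Multiset.mem_sort _).1 hk)

theorem rows_injective : Function.Injective rows := by
  rintro ⟨n, a⟩ ⟨m, b⟩ h
  have hp : a.parts = b.parts := by
    have := congrArg (fun l : List ℕ => (l : Multiset ℕ)) h
    simpa [rows, Multiset.sort_eq] using this
  have hn : n = m := by rw [← a.parts_sum, ← b.parts_sum, hp]
  subst hn
  congr
  exact Nat.Partition.ext hp

/-- The Young diagram of a partition. -/
def diagram (lam : IntPartition) : YoungDiagram :=
  YoungDiagram.ofRowLens lam.rows (by
    have := Multiset.pairwise_sort lam.2.parts (· ≥ ·)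
    exact List.Pairwise.sortedGE this)

/-- Unary encoding of a list of numbers: each entry `k` becomes `1ᵏ0`; a final `0` closes the list
(no ambiguity arises for lists of positive numbers). -/
def encodeList (l : List ℕ) : List Bool :=
  l.flatMap (fun k => List.replicate k true ++ [false]) ++ [false]

/-- Unary encoding of a partition. -/
def encode (lam : IntPartition) : List Bool := encodeList lam.rows

/-- Unary encoding of a triple of partitions. -/
def encodeTriple (t : IntPartition × IntPartition × IntPartition) : List Bool :=
  encode t.1 ++ (encode t.2.1 ++ encode t.2.2)

theorem replicate_append_cancel : ∀ (j k : ℕ) (r s : List Bool),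
    List.replicate j true ++ false :: r = List.replicate k true ++ false :: s → j = k ∧ r = s
  | 0, 0, r, s, h => by simpa using h
  | 0, k + 1, r, s, h => by simp [List.replicate_succ] at h
  | j + 1, 0, r, s, h => by simp [List.replicate_succ] at h
  | j + 1, k + 1, r, s, h => by
      simp only [List.replicate_succ, List.cons_append, List.cons.injEq, true_and] at h
      have := replicate_append_cancel j k r s h
      exact ⟨by rw [this.1], this.2⟩

theorem encodeList_append_cancel : ∀ (l m : List ℕ), (∀ k ∈ l, 0 < k) → (∀ k ∈ m, 0 < k) →
    ∀ r s : List Bool, encodeList l ++ r = encodeList m ++ s → l = m ∧ r = s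
  | [], [], _, _, r, s, h => by simpa [encodeList] using h
  | [], b :: m, _, hm, r, s, h => by
      obtain ⟨b, rfl⟩ := Nat.exists_eq_succ_of_ne_zero (hm b (by simp)).ne'
      simp [encodeList, List.replicate_succ] at h
  | a :: l, [], hl, _, r, s, h => by
      obtain ⟨a, rfl⟩ := Nat.exists_eq_succ_of_ne_zero (hl a (by simp)).ne'
      simp [encodeList, List.replicate_succ] at h
  | a :: l, b :: m, hl, hm, r, s, h => by
      have e : ∀ (c : ℕ) (n : List ℕ) (t : List Bool), encodeList (c :: n) ++ t
          = List.replicate c true ++ false :: (encodeList n ++ t) := by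
        intro c n t; simp [encodeList]
      rw [e, e] at h
      obtain ⟨hab, h1⟩ := replicate_append_cancel _ _ _ _ h
      obtain ⟨hlm, h2⟩ := encodeList_append_cancel l m (fun k hk => hl k (by simp [hk]))
        (fun k hk => hm k (by simp [hk])) r s h1
      exact ⟨by rw [hab, hlm], h2⟩

theorem encodeTriple_injective : Function.Injective encodeTriple := by
  rintro ⟨a, b, c⟩ ⟨a', b', c'⟩ h
  simp only [encodeTriple, encode] at h
  obtain ⟨h1, h⟩ := encodeList_append_cancel _ _ a.rows_pos a'.rows_pos _ _ h
  obtain ⟨h2, h⟩ := encodeList_append_cancel _ _ b.rows_pos b'.rows_pos _ _ h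
  have h3 := (encodeList_append_cancel _ _ c.rows_pos c'.rows_pos [] [] (by simpa using h)).1
  rw [rows_injective h1, rows_injective h2, rows_injective h3]

/-- The Kostka number: the number of semistandard Young tableaux of shape `lam` and content `mu`
(entries are numbered from `0`, so that the entry `i` occurs `mu_{i+1}` times). -/
noncomputable def kostka (lam mu : IntPartition) : ℕ :=
  Nat.card {T : SemistandardYoungTableau lam.diagram //
    ∀ i : ℕ, (lam.diagram.cells.filter fun c => T c.1 c.2 = i).card = mu.rows.getD i 0}

end IntPartition

/-! ## The ring of symmetric functions, as an inverse limit of graded rings -/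

open MvPolynomial in
/-- The restriction `ℂ[x₁, …, xₙ₊₁] → ℂ[x₁, …, xₙ]`, setting the last variable to `0`. -/
noncomputable def dropLast (n : ℕ) : MvPolynomial (Fin (n + 1)) ℂ →ₐ[ℂ] MvPolynomial (Fin n) ℂ :=
  aeval (Fin.snoc (α := fun _ => MvPolynomial (Fin n) ℂ) X 0)

/-- The ring `Λ` of symmetric functions over `ℂ`: sequences of symmetric polynomials, the `n`-th
one in `n` variables, compatible under setting the last variable to `0`, of bounded degree. -/
noncomputable def SymFunc : Subalgebra ℂ (∀ n : ℕ, MvPolynomial (Fin n) ℂ) where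
  carrier := {F | (∀ n, (F n).IsSymmetric) ∧ (∀ n, dropLast n (F (n + 1)) = F n) ∧
    ∃ D, ∀ n, (F n).totalDegree ≤ D}
  mul_mem' := by
    rintro F G ⟨h1, h2, D, h3⟩ ⟨k1, k2, E, k3⟩
    refine ⟨fun n => (h1 n).mul (k1 n), fun n => by simp [h2, k2], D + E, fun n => ?_⟩
    exact (MvPolynomial.totalDegree_mul _ _).trans (add_le_add (h3 n) (k3 n))
  add_mem' := by
    rintro F G ⟨h1, h2, D, h3⟩ ⟨k1, k2, E, k3⟩
    refine ⟨fun n => (h1 n).add (k1 n), fun n => by simp [h2, k2], max D E, fun n => ?_⟩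
    exact (MvPolynomial.totalDegree_add _ _).trans (max_le_max (h3 n) (k3 n))
  algebraMap_mem' := by
    intro c
    refine ⟨fun n => MvPolynomial.IsSymmetric.C c, fun n => ?_, 0, fun n => ?_⟩
    · exact (dropLast n).commutes c
    · simp [MvPolynomial.algebraMap_eq]

namespace SymFunc

open MvPolynomial

theorem dropLast_X_castSucc (n : ℕ) (i : Fin n) : dropLast n (X i.castSucc) = X i := by
  simp [dropLast]

theorem dropLast_X_last (n : ℕ) : dropLast n (X (Fin.last n)) = 0 := by
  simp [dropLast]

theorem dropLast_sym_map {n m : ℕ} (s : Sym (Fin n) m) :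
    dropLast n (((s.map Fin.castSucc).1.map X).prod) = (s.1.map X).prod := by
  rw [map_multiset_prod]
  simp [dropLast_X_castSucc]

theorem exists_sym_map {n m : ℕ} (s : Sym (Fin (n + 1)) m) (h : Fin.last n ∉ s) :
    ∃ t : Sym (Fin n) m, t.map Fin.castSucc = s := by
  have h' : Fin.last n ∉ s.1 := h
  have : ∃ t : Multiset (Fin n), t.map Fin.castSucc = s.1 := by
    have : CanLift (Fin (n + 1)) (Fin n) Fin.castSucc fun i => i ≠ Fin.last n :=
      ⟨fun i hi => ⟨i.castPred hi, by simp⟩⟩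
    exact (Multiset.canLift (Fin.castSucc (n := n)) (fun i => i ≠ Fin.last n)).prf s.1
      (fun i hi he => h' (he ▸ hi))
  obtain ⟨t, ht⟩ := this
  exact ⟨⟨t, by rw [← Multiset.card_map Fin.castSucc, ht]; exact s.2⟩, Subtype.ext ht⟩

theorem dropLast_of_mem {n m : ℕ} (s : Sym (Fin (n + 1)) m) (h : Fin.last n ∈ s) :
    dropLast n ((s.1.map X).prod) = 0 := by
  rw [map_multiset_prod, Multiset.map_map]
  apply Multiset.prod_eq_zero
  exact Multiset.mem_map.2 ⟨_, h, dropLast_X_last n⟩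

theorem ofSym_map_castSucc {n m : ℕ} (s : Sym (Fin n) m) :
    Nat.Partition.ofSym (s.map Fin.castSucc) = Nat.Partition.ofSym s := by
  ext1
  simp only [Nat.Partition.ofSym, Sym.val_eq_coe, Sym.coe_map]
  rw [Multiset.dedup_map_of_injective (Fin.castSucc_injective n), Multiset.map_map]
  apply Multiset.map_congr rfl
  intro x _
  simp [Multiset.count_map_eq_count' _ _ (Fin.castSucc_injective n)]

theorem totalDegree_sym_prod {n m : ℕ} (s : Sym (Fin n) m) :
    ((s.1.map X).prod : MvPolynomial (Fin n) ℂ).totalDegree ≤ m := by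
  refine (totalDegree_multiset_prod _).trans ?_
  rw [Multiset.map_map]
  simp [Function.comp_def]

theorem msymm_mem {m : ℕ} (mu : m.Partition) :
    (fun n => MvPolynomial.msymm (Fin n) ℂ mu) ∈ SymFunc := by
  refine ⟨fun n => msymm_isSymmetric _ _ _, fun n => ?_, m, fun n => ?_⟩
  · change dropLast n (msymm _ _ _) = msymm _ _ _
    rw [msymm, map_sum, msymm]
    symm
    refine Fintype.sum_of_injective
      (fun s : {a : Sym (Fin n) m // Nat.Partition.ofSym a = mu} =>
        (⟨s.1.map Fin.castSucc, by rw [ofSym_map_castSucc, s.2]⟩ :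
          {a : Sym (Fin (n + 1)) m // Nat.Partition.ofSym a = mu})) ?_ _ _ ?_ ?_
    · intro s t h
      exact Subtype.ext (Sym.map_injective (Fin.castSucc_injective n) m (congrArg Subtype.val h))
    · rintro ⟨s, hs⟩ h
      apply dropLast_of_mem
      by_contra hl
      obtain ⟨t, rfl⟩ := exists_sym_map s hl
      exact h ⟨⟨t, by rw [← ofSym_map_castSucc, hs]⟩, rfl⟩
    · intro s
      exact (dropLast_sym_map s.1).symm
  · exact totalDegree_finsetSum_le fun s _ => totalDegree_sym_prod s.1

theorem hsymm_mem (k : ℕ) : (fun n => MvPolynomial.hsymm (Fin n) ℂ k) ∈ SymFunc := by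
  refine ⟨fun n => hsymm_isSymmetric _ _ _, fun n => ?_, k, fun n => ?_⟩
  · change dropLast n (hsymm _ _ _) = hsymm _ _ _
    rw [hsymm, map_sum, hsymm]
    symm
    refine Fintype.sum_of_injective (Sym.map Fin.castSucc)
      (Sym.map_injective (Fin.castSucc_injective n) k) _ _ ?_ ?_
    · intro s h
      apply dropLast_of_mem
      by_contra hl
      exact h (exists_sym_map s hl)
    · intro s
      exact (dropLast_sym_map s).symm
  · exact totalDegree_finsetSum_le fun s _ => totalDegree_sym_prod s

theorem esymm_mem (k : ℕ) : (fun n => MvPolynomial.esymm (Fin n) ℂ k) ∈ SymFunc := by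
  refine ⟨fun n => esymm_isSymmetric _ _ _, fun n => ?_, k, fun n => ?_⟩
  · change dropLast n (esymm _ _ _) = esymm _ _ _
    rw [esymm, map_sum, esymm]
    symm
    refine Finset.sum_of_injOn (Finset.map Fin.castSuccEmb)
      (Finset.map_injective _).injOn ?_ ?_ ?_
    · intro t ht
      simpa [Finset.mem_powersetCard] using ht
    · intro t ht h
      rw [map_prod]
      have hl : Fin.last n ∈ t := by
        by_contra hl
        apply h
        have hsub : t ⊆ Finset.univ.map (Fin.castSuccEmb (n := n)) := by
          intro i hi
          have hne : i ≠ Fin.last n := fun e => hl (e ▸ hi)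
          simpa using ⟨i.castPred hne, by simp⟩
        obtain ⟨u, _, hu⟩ := Finset.subset_map_iff.1 hsub
        refine ⟨u, ?_, hu.symm⟩
        subst hu
        simpa [Finset.mem_powersetCard] using ht
      exact Finset.prod_eq_zero hl (dropLast_X_last n)
    · intro t _
      rw [map_prod, Finset.prod_map]
      exact Finset.prod_congr rfl fun i _ => (dropLast_X_castSucc n i).symm
  · refine totalDegree_finsetSum_le fun t ht => (totalDegree_finsetProd _ _).trans ?_
    simpa using (Finset.mem_powersetCard.1 ht).2.le

theorem psum_mem (k : ℕ+) : (fun n => MvPolynomial.psum (Fin n) ℂ k) ∈ SymFunc := by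
  refine ⟨fun n => psum_isSymmetric _ _ _, fun n => ?_, k, fun n => ?_⟩
  · simp [psum, Fin.sum_univ_castSucc, dropLast_X_castSucc, dropLast_X_last]
  · refine totalDegree_finsetSum_le fun i _ => ?_
    simp

theorem expand_mem (k : ℕ+) (F : SymFunc) :
    (fun n => MvPolynomial.expand (k : ℕ) (F.1 n)) ∈ SymFunc := by
  obtain ⟨F, h1, h2, D, h3⟩ := F
  refine ⟨fun n e => ?_, fun n => ?_, D * k, fun n => ?_⟩
  · change rename e (expand (k : ℕ) (F n)) = _
    rw [rename_expand, h1 n e]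
  · have key : (dropLast n).comp (expand (k : ℕ)) = (expand (k : ℕ)).comp (dropLast n) := by
      apply MvPolynomial.algHom_ext
      intro i
      refine Fin.lastCases ?_ (fun i => ?_) i
      · simp [dropLast_X_last]
      · simp [dropLast_X_castSucc]
    change dropLast n (expand (k : ℕ) (F (n + 1))) = _
    rw [← AlgHom.comp_apply, key, AlgHom.comp_apply, h2]
  · change (expand (k : ℕ) (F n)).totalDegree ≤ _
    rw [totalDegree_expand]
    exact Nat.mul_le_mul_right _ (h3 n)

/-- The monomial symmetric function `m_lam`. -/
noncomputable def monomialSymm (lam : IntPartition) : SymFunc := ⟨_, msymm_mem lam.2⟩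

/-- The power sum `p_k = x₁ᵏ + x₂ᵏ + ⋯`, for `k ≥ 1`. -/
noncomputable def powerSum (k : ℕ+) : SymFunc := ⟨_, psum_mem k⟩

/-- The power sum symmetric function `p_lam = p_{lam_1} p_{lam_2} ⋯`. -/
noncomputable def powerSumSymm (lam : IntPartition) : SymFunc :=
  (lam.2.parts.attach.map fun k => powerSum ⟨k.1, lam.2.parts_pos k.2⟩).prod

/-- The elementary symmetric function `e_lam = e_{lam_1} e_{lam_2} ⋯`. -/
noncomputable def elementarySymm (lam : IntPartition) : SymFunc :=
  (lam.2.parts.map fun k => (⟨_, esymm_mem k⟩ : SymFunc)).prod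

/-- The complete homogeneous symmetric function `h_lam = h_{lam_1} h_{lam_2} ⋯`. -/
noncomputable def completeSymm (lam : IntPartition) : SymFunc :=
  (lam.2.parts.map fun k => (⟨_, hsymm_mem k⟩ : SymFunc)).prod

/-- The Schur function `s_lam = ∑_{mu ⊢ |lam|} K_{lam, mu} m_mu`. -/
noncomputable def schur (lam : IntPartition) : SymFunc :=
  ∑ mu : lam.1.Partition, (lam.kostka ⟨lam.1, mu⟩ : ℂ) • monomialSymm ⟨lam.1, mu⟩

/-- The substitution `g(x₁, x₂, …) ↦ g(x₁ᵏ, x₂ᵏ, …)`, that is `g ↦ p_k[g]`. -/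
noncomputable def adams (k : ℕ+) (g : SymFunc) : SymFunc := ⟨_, expand_mem k g⟩

open Classical in
/-- The plethysm `f[g]`: if `f = P(p₁, p₂, p₃, …)` for a polynomial `P` with complex coefficients,
then `f[g] = P(p₁[g], p₂[g], p₃[g], …)`, where `p_k[g] = g(x₁ᵏ, x₂ᵏ, …)`. In other words,
`f ↦ f[g]` is the `ℂ`-algebra endomorphism of `Λ` which maps `p_k` to `g(x₁ᵏ, x₂ᵏ, …)`.
The power sums are algebraically independent generators of `Λ`, so `P` exists and is unique
(the value in the `else` branch is never used). -/
noncomputable def plethysm (f g : SymFunc) : SymFunc :=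
  if h : ∃ P : MvPolynomial ℕ+ ℂ, aeval powerSum P = f then
    aeval (fun k => adams k g) h.choose
  else 0

end SymFunc

/-- The five classical bases of the ring of symmetric functions. -/
inductive ClassicalBasis
  | schur
  | monomial
  | powerSum
  | elementary
  | complete

/-- The member of a classical basis with index `lam`. -/
noncomputable def ClassicalBasis.elem : ClassicalBasis → IntPartition → SymFunc
  | .schur => SymFunc.schur
  | .monomial => SymFunc.monomialSymm
  | .powerSum => SymFunc.powerSumSymm
  | .elementary => SymFunc.elementarySymm
  | .complete => SymFunc.completeSymm

/-- `a lam mu` is the (finitely supported, integral) family of coefficients of an expansion of the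
plethysm `f_lam[g_mu]` in Schur functions, for all `lam` and `mu`. -/
def IsPlethysmCoeff (f g : ClassicalBasis)
    (a : IntPartition → IntPartition → IntPartition →₀ ℤ) : Prop :=
  ∀ lam mu, SymFunc.plethysm (f.elem lam) (g.elem mu) =
    (a lam mu).sum fun nu c => c • SymFunc.schur nu

/-!
The proof expresses the Schur coefficients of `f_λ[g_μ]` as a difference of two numbers of
combinatorial objects of polynomial size, and shows that objects of this kind are recognized by a
Turing machine in polynomial time.

*Plethysm.* Every classical basis element has nonnegative integral coefficients, so
`g_μ = y₁ + y₂ + ⋯` with monomials `y_s`, repeated according to their multiplicity. Since the power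
sums generate the ring of symmetric functions (`SymFunc.exists_aeval_powerSum_eq`),
`f[g] = f(y₁, y₂, …)` (`SymFunc.plethysm_val`). There may be exponentially many monomials `y_s`, but
a monomial of `f` of degree `d` involves at most `d` of them. So a coefficient of `f_λ[g_μ]` counts
sequences of positive exponents `β` and increasing sequences of monomials of `g_μ`, weighted by the
coefficient of `x^β` in `f_λ` (`SymFunc.coeff_plethysm`). The coefficients of the classical bases
count matrices with given row and column sums, or tableaux (`ClassicalBasis.exists_isCoeff`).

*Expansion in Schur functions.* Let `K` be the Kostka matrix, `s_ν = ∑_κ K_{νκ} m_κ`. The entries in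
row `i` (counted from `0`) of a semistandard tableau with entries from `0` on are at least `i`. So
`K_{νκ} ≠ 0` implies `n(ν) ≤ n(κ)` for the statistic `n(λ) = ∑ i λ_{i+1}`, with equality only for
`ν = κ`, and `K_{νν} = 1`. Thus `K = 1 + A` with `A` nonnegative and nilpotent
(`IntPartition.offKostka_pow_eq_zero`), and `K⁻¹ = ∑ⱼ (-A)ʲ` is integral. This gives existence and
uniqueness of the expansion (`SymFunc.exists_schur_expansion`), and
`a^ν_{λμ} = ∑ⱼ (-1)ʲ ∑_κ M_κ (Aʲ)_{κν}`, where `M_κ` is the coefficient of `x^κ` in `f_λ[g_μ]`. The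
terms with even `j` minus those with odd `j` are the difference sought, as the entries of `Aʲ` count
paths (`IntPartition.exists_sharp_vecMul_pow`).

*Complexity.* The counted objects are stored in tables `ℕ → ℕ` with polynomially many entries of
polynomial size. A function is a counting function (`Sharp`) if its values are the cardinalities of
sets of such tables whose members are singled out by a formula of bounded arithmetic: numbers, sums,
truncated differences, sums over initial segments, table look-up (`Expressible`). Such functions are
closed under substitution, sums and products over initial segments, and sums over definable families
of tables; membership in the class is then a matter of writing down a formula, and `fun_prop` checks
that a function or predicate is given by one (`PT`, `PTP`). Formulas are evaluated in polynomial
time by programs with finitely many unary counters and a head on the input, which are simulated by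
machines with several stacks (`CounterProgram.polyTimeDecidable_of_expressible`). Writing the tables
in unary as witnesses gives `Sharp.mem_sharpP`. Finally, a function of three partitions becomes a
function of words by summing over all triples of partitions that the word encodes, of which there is
at most one (`exists_sharpP_of_sharp`).
-/

/-! ### Counter programs on multi-stack machines -/

namespace CounterProgram

/-- The input letters: the two words of a pair carry different tags. -/
abbrev Letter : Type := Bool ⊕ Bool

/-- Programs for a machine with counters (registers), numbered by `ℕ`, and a two-way read-only head
on an input word. -/
inductive Prog : Type
  /-- increment a counter -/
  | inc (r : ℕ)
  /-- decrement a counter, if it is positive -/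
  | dec (r : ℕ)
  | seq (p q : Prog)
  /-- while the counter `r` is positive, decrement it and run `p` -/
  | loop (r : ℕ) (p : Prog)
  /-- move the head one letter to the right, if there is a letter under it -/
  | right
  /-- increment `r` if the letter under the head is `a` -/
  | test (a : Letter) (r : ℕ)
  /-- move the head to the end of the input, incrementing `r` at each step -/
  | scan (r : ℕ)
  /-- move the head to the beginning of the input -/
  | rewind
  /-- erase the input from the head on -/
  | drain

/-- States of a counter machine: the letters before the head (nearest first), the letters from the
head on, and the contents of the counters. -/
structure State : Type where
  pre : List Letter
  post : List Letter
  reg : ℕ → ℕ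

namespace Prog

/-- `Exec p S S' t`: started in the state `S`, the program `p` ends in `S'` after at most `t`
machine steps. -/
inductive Exec : Prog → State → State → ℕ → Prop
  | mono {p S S' t t'} : Exec p S S' t → t ≤ t' → Exec p S S' t'
  | inc (r a b R) : Exec (inc r) ⟨a, b, R⟩ ⟨a, b, Function.update R r (R r + 1)⟩ 1
  | dec (r a b R) : Exec (dec r) ⟨a, b, R⟩ ⟨a, b, Function.update R r (R r - 1)⟩ 1
  | seq {p q S S' S'' t t'} : Exec p S S' t → Exec q S' S'' t' → Exec (seq p q) S S'' (t + t')
  | loop_zero {r p a b R} : R r = 0 → Exec (loop r p) ⟨a, b, R⟩ ⟨a, b, R⟩ 1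
  | loop_succ {r p a b R n S S' t t'} : R r = n + 1 →
      Exec p ⟨a, b, Function.update R r n⟩ S t → Exec (loop r p) S S' t' →
      Exec (loop r p) ⟨a, b, R⟩ S' (t + t' + 1)
  | right_nil (a R) : Exec right ⟨a, [], R⟩ ⟨a, [], R⟩ 1
  | right_cons (a x b R) : Exec right ⟨a, x :: b, R⟩ ⟨x :: a, b, R⟩ 1
  | test_pos {x r a b R} : b.head? = some x →
      Exec (test x r) ⟨a, b, R⟩ ⟨a, b, Function.update R r (R r + 1)⟩ 1
  | test_neg {x r a b R} : b.head? ≠ some x → Exec (test x r) ⟨a, b, R⟩ ⟨a, b, R⟩ 1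
  | scan_nil (r a R) : Exec (scan r) ⟨a, [], R⟩ ⟨a, [], R⟩ 1
  | scan_cons {r a x b R S t} :
      Exec (scan r) ⟨x :: a, b, Function.update R r (R r + 1)⟩ S t →
      Exec (scan r) ⟨a, x :: b, R⟩ S (t + 1)
  | rewind_nil (b R) : Exec rewind ⟨[], b, R⟩ ⟨[], b, R⟩ 1
  | rewind_cons {a x b R S t} :
      Exec rewind ⟨a, x :: b, R⟩ S t → Exec rewind ⟨x :: a, b, R⟩ S (t + 1)
  | drain_nil (a R) : Exec drain ⟨a, [], R⟩ ⟨a, [], R⟩ 1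
  | drain_cons {a x b R S t} :
      Exec drain ⟨a, b, R⟩ S t → Exec drain ⟨a, x :: b, R⟩ S (t + 1)

/-- All counters used by the program are numbered below `M`. -/
def UsesBelow (M : ℕ) : Prog → Prop
  | inc r | dec r | test _ r | scan r => r < M
  | seq p q => p.UsesBelow M ∧ q.UsesBelow M
  | loop r p => r < M ∧ p.UsesBelow M
  | right | rewind | drain => True

theorem UsesBelow.mono {M M' : ℕ} (h : M ≤ M') : ∀ {p : Prog}, p.UsesBelow M → p.UsesBelow M'
  | inc _, hp | dec _, hp | test _ _, hp | scan _, hp => lt_of_lt_of_le hp h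
  | seq _ _, hp => ⟨hp.1.mono h, hp.2.mono h⟩
  | loop _ _, hp => ⟨hp.1.trans_le h, hp.2.mono h⟩
  | right, _ | rewind, _ | drain, _ => trivial

theorem exists_usesBelow : ∀ p : Prog, ∃ M, p.UsesBelow M
  | inc r | dec r | test _ r | scan r => ⟨r + 1, Nat.lt_succ_self r⟩
  | seq p q => by
    obtain ⟨M, hM⟩ := exists_usesBelow p
    obtain ⟨M', hM'⟩ := exists_usesBelow q
    exact ⟨max M M', hM.mono (le_max_left _ _), hM'.mono (le_max_right _ _)⟩
  | loop r p => by
    obtain ⟨M, hM⟩ := exists_usesBelow p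
    exact ⟨max M (r + 1), lt_of_lt_of_le (Nat.lt_succ_self r) (le_max_right _ _),
      hM.mono (le_max_left _ _)⟩
  | right | rewind | drain => ⟨0, trivial⟩

/-- The program points of a program; they become the labels of a machine. -/
@[reducible] def Pts : Prog → Type
  | seq p q => p.Pts ⊕ q.Pts
  | loop _ p => Option p.Pts
  | _ => Unit

/-- The program point where execution begins. -/
def entry : (p : Prog) → p.Pts
  | seq p _ => .inl p.entry
  | loop _ _ => none
  | inc _ | dec _ | test _ _ | scan _ | right | rewind | drain => ()

theorem finite_pts : ∀ p : Prog, Finite p.Pts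
  | seq p q => by
    have := finite_pts p
    have := finite_pts q
    exact inferInstanceAs (Finite (p.Pts ⊕ q.Pts))
  | loop _ p => by
    have := finite_pts p
    exact inferInstanceAs (Finite (Option p.Pts))
  | inc _ | dec _ | test _ _ | scan _ | right | rewind | drain => inferInstanceAs (Finite Unit)

end Prog

/-- The stacks of the simulating machine: the input from the head on, the input before the head,
the output, and one stack for each counter. -/
inductive Stack (M : ℕ) : Type
  | inp
  | aux
  | out
  | reg (i : Fin M)
  deriving DecidableEq, Fintype

/-- The alphabets of the stacks; the counters are kept in unary. -/
abbrev Alphabet {M : ℕ} : Stack M → Type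
  | .inp | .aux => Letter
  | .out => Bool
  | .reg _ => Unit

/-- The stack contents that represent a state. -/
def stackOf {M : ℕ} (S : State) (o : List Bool) : ∀ k : Stack M, List (Alphabet k)
  | .inp => S.post
  | .aux => S.pre
  | .out => o
  | .reg i => List.replicate (S.reg i) ()

section Code

open Turing.TM2.Stmt

variable {M : ℕ} {Lab : Type}

/-- The statements of the machine for a program whose points are labelled by `e` and which
continues at the label `x` when it is done. The internal state of the machine is `none` at all
labels. -/
def Prog.code [NeZero M] : (p : Prog) → (p.Pts → Lab) → Lab → p.Pts →
    Turing.TM2.Stmt (Alphabet (M := M)) Lab (Option Letter)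
  | .inc r, _, x, _ => push (.reg (Fin.ofNat M r)) (fun _ => ()) (goto fun _ => x)
  | .dec r, _, x, _ => pop (.reg (Fin.ofNat M r)) (fun v _ => v) (goto fun _ => x)
  | .seq p q, e, _, .inl a => p.code (fun b => e (.inl b)) (e (.inr q.entry)) a
  | .seq _ q, e, x, .inr a => q.code (fun b => e (.inr b)) x a
  | .loop r p, e, x, none => pop (.reg (Fin.ofNat M r)) (fun _ o => o.map fun _ => .inl true)
      (branch Option.isSome (load (fun _ => none) (goto fun _ => e (some p.entry)))
        (goto fun _ => x))
  | .loop _ p, e, _, some a => p.code (fun b => e (some b)) (e none) a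
  | .right, _, x, _ => pop .inp (fun _ o => o)
      (branch Option.isSome
        (push .aux (fun v => v.getD (.inl true)) (load (fun _ => none) (goto fun _ => x)))
        (goto fun _ => x))
  | .test a r, _, x, _ => peek .inp (fun _ o => o)
      (branch (fun v => decide (v = some a))
        (push (.reg (Fin.ofNat M r)) (fun _ => ()) (load (fun _ => none) (goto fun _ => x)))
        (load (fun _ => none) (goto fun _ => x)))
  | .scan r, e, x, a => pop .inp (fun _ o => o)
      (branch Option.isSome
        (push .aux (fun v => v.getD (.inl true)) (push (.reg (Fin.ofNat M r)) (fun _ => ())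
          (load (fun _ => none) (goto fun _ => e a))))
        (goto fun _ => x))
  | .rewind, e, x, a => pop .aux (fun _ o => o)
      (branch Option.isSome
        (push .inp (fun v => v.getD (.inl true)) (load (fun _ => none) (goto fun _ => e a)))
        (goto fun _ => x))
  | .drain, e, x, a => pop .inp (fun _ o => o)
      (branch Option.isSome (load (fun _ => none) (goto fun _ => e a)) (goto fun _ => x))

variable (m : Lab → Turing.TM2.Stmt (Alphabet (M := M)) Lab (Option Letter))

/-- The machine `m` gets from one configuration to another in at most `t` steps. -/
def Reach (c c' : Turing.TM2.Cfg (Alphabet (M := M)) Lab (Option Letter)) (t : ℕ) : Prop :=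
  ∃ s ≤ t, (flip bind (Turing.TM2.step m))^[s] (some c) = some c'

variable {m}

theorem Reach.trans {c c' c'' : Turing.TM2.Cfg (Alphabet (M := M)) Lab (Option Letter)} {t t' : ℕ}
    (h : Reach m c c' t) (h' : Reach m c' c'' t') : Reach m c c'' (t + t') := by
  obtain ⟨s, hs, h⟩ := h
  obtain ⟨s', hs', h'⟩ := h'
  refine ⟨s' + s, by omega, ?_⟩
  rw [Function.iterate_add_apply, h, h']

theorem Reach.step {c c' : Turing.TM2.Cfg (Alphabet (M := M)) Lab (Option Letter)}
    (h : Turing.TM2.step m c = some c') : Reach m c c' 1 :=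
  ⟨1, le_rfl, h⟩

theorem Reach.mono {c c' : Turing.TM2.Cfg (Alphabet (M := M)) Lab (Option Letter)} {t t' : ℕ}
    (h : Reach m c c' t) (ht : t ≤ t') : Reach m c c' t' := by
  obtain ⟨s, hs, h⟩ := h
  exact ⟨s, hs.trans ht, h⟩

theorem update_reg [NeZero M] {r : ℕ} (hr : r < M) (a b R o n) (l : List Unit)
    (hl : l = List.replicate n ()) :
    Function.update (stackOf ⟨a, b, R⟩ o) (Stack.reg (Fin.ofNat M r)) l
      = stackOf ⟨a, b, Function.update R r n⟩ o := by
  subst hl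
  funext k
  cases k with
  | reg i =>
    by_cases h : i = Fin.ofNat M r
    · subst h
      have : (Fin.ofNat M r).val = r := by simp [Nat.mod_eq_of_lt hr]
      simp only [Function.update_self, stackOf, this]
    · have : i.val ≠ r := by
        rintro rfl
        exact h (by ext; simp)
      rw [Function.update_of_ne (by simpa using h)]
      simp [stackOf, Function.update_of_ne this]
  | _ => rfl

theorem stackOf_reg [NeZero M] {r : ℕ} (hr : r < M) (S : State) (o) :
    stackOf S o (Stack.reg (Fin.ofNat M r)) = List.replicate (S.reg r) () := by
  simp [stackOf, Nat.mod_eq_of_lt hr]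

theorem update_inp (a b R o) (b' : List Letter) :
    Function.update (stackOf ⟨a, b, R⟩ o) (Stack.inp (M := M)) b' = stackOf ⟨a, b', R⟩ o := by
  funext k; cases k <;> rfl

theorem update_aux (a b R o) (a' : List Letter) :
    Function.update (stackOf ⟨a, b, R⟩ o) (Stack.aux (M := M)) a' = stackOf ⟨a', b, R⟩ o := by
  funext k; cases k <;> rfl

/-- The machine simulates the program. -/
theorem Prog.Exec.reach [NeZero M] {p : Prog} {S S' : State} {t : ℕ} (h : p.Exec S S' t)
    (hp : p.UsesBelow M) (e : p.Pts → Lab) (x : Lab) (hm : ∀ a, m (e a) = p.code e x a)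
    (o : List Bool) :
    Reach m ⟨some (e p.entry), none, stackOf S o⟩ ⟨some x, none, stackOf S' o⟩ t := by
  induction h generalizing x with
  | mono _ ht ih => exact (ih hp e x hm).mono ht
  | inc r a b R =>
    apply Reach.step
    rw [Turing.TM2.step, hm]
    simp only [Prog.code, Turing.TM2.stepAux, stackOf_reg hp]
    rw [update_reg hp _ _ _ _ (R r + 1) _ (by simp [List.replicate_succ])]
  | dec r a b R =>
    apply Reach.step
    rw [Turing.TM2.step, hm]
    simp only [Prog.code, Turing.TM2.stepAux, stackOf_reg hp]
    rw [update_reg hp _ _ _ _ (R r - 1) _ (by simp)]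
  | seq _ _ ih ih' =>
    exact (ih hp.1 _ _ fun a => hm (.inl a)).trans (ih' hp.2 _ _ fun a => hm (.inr a))
  | @loop_zero r p a b R h =>
    apply Reach.step
    rw [Turing.TM2.step, hm]
    simp only [Prog.entry, Prog.code, Turing.TM2.stepAux, stackOf_reg hp.1, h]
    rw [update_reg hp.1 _ _ _ _ 0 _ (by simp)]
    rw [← h, Function.update_eq_self]
    simp [h]
  | @loop_succ r p a b R n S S' t t' h _ _ ih ih' =>
    have h1 : Reach m ⟨some (e none), none, stackOf ⟨a, b, R⟩ o⟩
        ⟨some (e (some p.entry)), none, stackOf ⟨a, b, Function.update R r n⟩ o⟩ 1 := by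
      apply Reach.step
      rw [Turing.TM2.step, hm]
      simp only [Prog.code, Turing.TM2.stepAux, stackOf_reg hp.1, h]
      rw [update_reg hp.1 _ _ _ _ n _ (by simp)]
      simp [List.replicate_succ]
    exact ((h1.trans (ih hp.2 _ _ fun a => hm (some a))).trans (ih' hp e x hm)).mono (by omega)
  | right_nil a R =>
    apply Reach.step
    rw [Turing.TM2.step, hm]
    simp only [Prog.code, Turing.TM2.stepAux]
    simp [stackOf, update_inp]
  | right_cons a y b R =>
    apply Reach.step
    rw [Turing.TM2.step, hm]
    simp only [Prog.code, Turing.TM2.stepAux]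
    simp only [stackOf, update_inp]
    simp [update_aux]
  | @test_pos y r a b R h =>
    apply Reach.step
    rw [Turing.TM2.step, hm]
    simp only [Prog.code, Turing.TM2.stepAux, stackOf_reg hp]
    rw [update_reg hp _ _ _ _ (R r + 1) _ (by simp [List.replicate_succ])]
    simp [stackOf, h]
  | @test_neg y r a b R h =>
    apply Reach.step
    rw [Turing.TM2.step, hm]
    simp only [Prog.code, Turing.TM2.stepAux]
    simp [stackOf, h]
  | scan_nil r a R =>
    apply Reach.step
    rw [Turing.TM2.step, hm]
    simp only [Prog.code, Turing.TM2.stepAux]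
    simp [stackOf, update_inp]
  | @scan_cons r a y b R S t _ ih =>
    have h1 : Reach m ⟨some (e ()), none, stackOf ⟨a, y :: b, R⟩ o⟩
        ⟨some (e ()), none, stackOf ⟨y :: a, b, Function.update R r (R r + 1)⟩ o⟩ 1 := by
      apply Reach.step
      rw [Turing.TM2.step, hm]
      simp only [Prog.code, Turing.TM2.stepAux]
      simp only [stackOf, update_inp]
      simp only [List.head?_cons, Option.isSome_some, cond_true, Option.getD_some, List.tail_cons]
      simp only [update_aux, stackOf_reg (show r < M from hp)]
      rw [update_reg (show r < M from hp) _ _ _ _ (R r + 1) _ (by simp [List.replicate_succ])]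
    exact (h1.trans (ih hp e x hm)).mono (by omega)
  | rewind_nil b R =>
    apply Reach.step
    rw [Turing.TM2.step, hm]
    simp only [Prog.code, Turing.TM2.stepAux]
    simp [stackOf, update_aux]
  | @rewind_cons a y b R S t _ ih =>
    have h1 : Reach m ⟨some (e ()), none, stackOf ⟨y :: a, b, R⟩ o⟩
        ⟨some (e ()), none, stackOf ⟨a, y :: b, R⟩ o⟩ 1 := by
      apply Reach.step
      rw [Turing.TM2.step, hm]
      simp only [Prog.code, Turing.TM2.stepAux]
      simp only [stackOf, update_aux]
      simp [update_inp]
    exact (h1.trans (ih hp e x hm)).mono (by omega)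
  | drain_nil a R =>
    apply Reach.step
    rw [Turing.TM2.step, hm]
    simp only [Prog.code, Turing.TM2.stepAux]
    simp [stackOf, update_inp]
  | @drain_cons a y b R S t _ ih =>
    have h1 : Reach m ⟨some (e ()), none, stackOf ⟨a, y :: b, R⟩ o⟩
        ⟨some (e ()), none, stackOf ⟨a, b, R⟩ o⟩ 1 := by
      apply Reach.step
      rw [Turing.TM2.step, hm]
      simp only [Prog.code, Turing.TM2.stepAux]
      simp [stackOf, update_inp]
    exact (h1.trans (ih hp e x hm)).mono (by omega)

end Code

end CounterProgram

/-! ### Bounded arithmetic, evaluated by counter programs -/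

/-- The functions of numbers (indexed by `N`) and tables `ℕ → ℕ` (indexed by `K`)
that are given by expressions in the variables, `1`, `+`, truncated subtraction, sums over an
initial segment of `ℕ`, and table look-up. With all numbers in unary they are computable in
polynomial time. -/
inductive Expressible {K : Type} : ∀ {N : Type}, ((K → ℕ → ℕ) → (N → ℕ) → ℕ) → Prop
  | var {N} (i : N) : Expressible fun _ v => v i
  | one {N} : Expressible (N := N) fun _ _ => 1
  | add {N} {F G : (K → ℕ → ℕ) → (N → ℕ) → ℕ} : Expressible F → Expressible G →
      Expressible fun X v => F X v + G X v
  | sub {N} {F G : (K → ℕ → ℕ) → (N → ℕ) → ℕ} : Expressible F → Expressible G →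
      Expressible fun X v => F X v - G X v
  | sum {N} {F : (K → ℕ → ℕ) → (N → ℕ) → ℕ} {G : (K → ℕ → ℕ) → (Option N → ℕ) → ℕ} :
      Expressible F → Expressible G →
      Expressible fun X v => ∑ i ∈ Finset.range (F X v), G X (fun o => o.elim i v)
  | read {N} (j : K) {F : (K → ℕ → ℕ) → (N → ℕ) → ℕ} : Expressible F →
      Expressible fun X v => X j (F X v)

/-- Expressible functions are polynomially bounded. -/
theorem Expressible.bounded {K N : Type} {F : (K → ℕ → ℕ) → (N → ℕ) → ℕ} (h : Expressible F) :
    ∃ V : Polynomial ℕ, ∀ X v m, (∀ j i, X j i ≤ m) → (∀ n, v n ≤ m) → F X v ≤ V.eval m := by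
  induction h with
  | var i => exact ⟨Polynomial.X, fun X v m _ hv => by simpa using hv i⟩
  | one => exact ⟨1, fun X v m _ hv => by simp⟩
  | add _ _ ih ih' =>
    obtain ⟨V, hV⟩ := ih
    obtain ⟨W, hW⟩ := ih'
    refine ⟨V + W, fun X v m hX hv => ?_⟩
    rw [Polynomial.eval_add]
    exact add_le_add (hV X v m hX hv) (hW X v m hX hv)
  | sub _ _ ih ih' =>
    obtain ⟨V, hV⟩ := ih
    exact ⟨V, fun X v m hX hv => (Nat.sub_le _ _).trans (hV X v m hX hv)⟩
  | sum _ _ ih ih' =>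
    obtain ⟨V, hV⟩ := ih
    obtain ⟨W, hW⟩ := ih'
    refine ⟨V * W.comp (Polynomial.X + V), fun X v m hX hv => ?_⟩
    rw [Polynomial.eval_mul, Polynomial.eval_comp, Polynomial.eval_add, Polynomial.eval_X]
    have hF := hV X v m hX hv
    refine (Finset.sum_le_card_nsmul _ _ (W.eval (m + V.eval m)) fun i hi => ?_).trans ?_
    · refine hW _ _ _ (fun j i => (hX j i).trans (Nat.le_add_right _ _)) ?_
      rintro (_ | n)
      · have := Finset.mem_range.1 hi
        simp only [Option.elim]
        omega
      · exact (hv n).trans (Nat.le_add_right _ _)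
    · simpa using Nat.mul_le_mul_right _ hF
  | read j _ ih =>
    exact ⟨Polynomial.X, fun X v m hX _ => by simpa using hX j _⟩

namespace CounterProgram

open Prog Function

/-- The table of a letter: the characteristic function of the positions where it occurs. -/
def letterTable (x : List Letter) (a : Letter) (i : ℕ) : ℕ := if x[i]? = some a then 1 else 0

theorem letterTable_le (x : List Letter) (a : Letter) (i : ℕ) : letterTable x a i ≤ 1 := by
  unfold letterTable
  split_ifs <;> omega

/-- A loop that starts with the counter `r` at `n` and whose body leaves `r` alone runs `n` times;
`S k` is the state before the `k`-th pass. -/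
theorem exec_loop {r : ℕ} {p : Prog} {t : ℕ} : ∀ (n : ℕ) (S : ℕ → State),
    (∀ k ≤ n, (S k).reg r = n - k) →
    (∀ k < n, p.Exec ⟨(S k).pre, (S k).post, update (S k).reg r (n - k - 1)⟩ (S (k + 1)) t) →
    (loop r p).Exec (S 0) (S n) (n * (t + 1) + 1)
  | 0, S, h, _ => (Exec.loop_zero (by simpa using h 0 le_rfl)).mono (by omega)
  | n + 1, S, h, hp => by
    have ih := exec_loop (r := r) (p := p) (t := t) n (fun k => S (k + 1))
      (fun k hk => by rw [h (k + 1) (by omega)]; omega)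
      (fun k hk => by
        have := hp (k + 1) (by omega)
        rwa [show n + 1 - (k + 1) - 1 = n - k - 1 by omega] at this)
    have h0 := hp 0 (by omega)
    refine (Exec.loop_succ (n := n) (by simpa using h 0 (by omega)) h0 ih).mono ?_
    rw [Nat.succ_mul]
    omega

/-- Empty the counter `r`, using the empty counter `s`. -/
theorem exec_clear {r s : ℕ} (hrs : s ≠ r) (a b R) (hs : R s = 0) :
    (loop r (dec s)).Exec ⟨a, b, R⟩ ⟨a, b, update R r 0⟩ (R r * 2 + 1) := by
  have := exec_loop (r := r) (p := dec s) (t := 1) (R r)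
    (fun k => ⟨a, b, update R r (R r - k)⟩) (fun k _ => by simp) (fun k hk => by
      have := Exec.dec s a b (update R r (R r - k - 1))
      convert this using 2
      · simp
      · funext x
        simp only [update_apply]
        (split_ifs <;> simp_all); omega)
  simpa using this

/-- Add the counter `r` to the counter `s`, emptying `r`. -/
theorem exec_move {r s : ℕ} (hrs : s ≠ r) (a b R) :
    (loop r (inc s)).Exec ⟨a, b, R⟩ ⟨a, b, update (update R s (R s + R r)) r 0⟩ (R r * 2 + 1) := by
  have := exec_loop (r := r) (p := inc s) (t := 1) (R r)
    (fun k => ⟨a, b, update (update R s (R s + k)) r (R r - k)⟩) (fun k _ => by simp)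
    (fun k hk => by
      have := Exec.inc s a b (update (update R s (R s + k)) r (R r - k - 1))
      convert this using 2
      · simp
      · funext x
        simp only [update_apply]
        split_ifs <;> omega)
  simpa using this

/-- Subtract the counter `r` from the counter `s`, emptying `r`. -/
theorem exec_sub {r s : ℕ} (hrs : s ≠ r) (a b R) :
    (loop r (dec s)).Exec ⟨a, b, R⟩ ⟨a, b, update (update R s (R s - R r)) r 0⟩ (R r * 2 + 1) := by
  have := exec_loop (r := r) (p := dec s) (t := 1) (R r)
    (fun k => ⟨a, b, update (update R s (R s - k)) r (R r - k)⟩) (fun k _ => by simp)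
    (fun k hk => by
      have := Exec.dec s a b (update (update R s (R s - k)) r (R r - k - 1))
      convert this using 2
      · simp
      · funext x
        simp only [update_apply]
        split_ifs <;> omega)
  simpa using this

/-- Add the counter `x` to the counter `d`, using the empty counter `s`. -/
theorem exec_copy {x d s : ℕ} (hxd : x ≠ d) (hxs : x ≠ s) (hds : d ≠ s) (a b R) (hs : R s = 0) :
    (seq (loop x (seq (inc d) (inc s))) (loop s (inc x))).Exec ⟨a, b, R⟩
      ⟨a, b, update R d (R d + R x)⟩ (R x * 5 + 2) := by
  have h1 := exec_loop (r := x) (p := seq (inc d) (inc s)) (t := 2) (R x)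
    (fun k => ⟨a, b, update (update (update R d (R d + k)) s k) x (R x - k)⟩) (fun k _ => by simp)
    (fun k hk => by
      have := Exec.seq (Exec.inc d a b (update (update (update R d (R d + k)) s k) x (R x - k - 1)))
        (Exec.inc s a b _)
      convert this using 2
      · simp
      · funext y
        simp only [update_apply]
        split_ifs <;> omega)
  have h2 := exec_move (r := s) (s := x) hxs a b
    (update (update (update R d (R d + R x)) s (R x)) x (R x - R x))
  have e0 : update (update (update R d (R d + 0)) s 0) x (R x - 0) = R := by
    funext y
    simp only [update_apply]
    split_ifs <;> simp_all
  simp only [e0] at h1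
  have := h1.seq h2
  convert this.mono (t' := R x * 5 + 2) ?_ using 2
  · funext y
    simp only [update_apply]
    split_ifs <;> simp_all
  · simp only [update_apply]
    split_ifs <;> omega

theorem exec_right (x : List Letter) (k : ℕ) (R) :
    right.Exec ⟨(x.take k).reverse, x.drop k, R⟩ ⟨(x.take (k + 1)).reverse, x.drop (k + 1), R⟩ 1 := by
  by_cases hk : k < x.length
  · have := Exec.right_cons (x.take k).reverse x[k] (x.drop (k + 1)) R
    rwa [List.cons_getElem_drop_succ, ← List.reverse_concat', List.take_concat_get'] at this
  · rw [List.drop_eq_nil_of_le (by omega), List.drop_eq_nil_of_le (by omega),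
      List.take_of_length_le (by omega), List.take_of_length_le (by omega)]
    exact Exec.right_nil _ _

theorem exec_rewind : ∀ (a b : List Letter) (R),
    rewind.Exec ⟨a, b, R⟩ ⟨[], a.reverse ++ b, R⟩ (a.length + 1)
  | [], b, R => by simpa using Exec.rewind_nil b R
  | x :: a, b, R => by
    have := exec_rewind a (x :: b) R
    simpa using Exec.rewind_cons this

theorem exec_scan (r : ℕ) : ∀ (b a : List Letter) (R),
    (scan r).Exec ⟨a, b, R⟩ ⟨b.reverse ++ a, [], update R r (R r + b.length)⟩ (b.length + 1)
  | [], a, R => by simpa using Exec.scan_nil r a R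
  | x :: b, a, R => by
    have := exec_scan r b (x :: a) (update R r (R r + 1))
    convert (Exec.scan_cons this).mono (t' := (x :: b).length + 1) (by simp) using 2
    · simp
    · simp [add_comm, add_left_comm]

theorem exec_drain : ∀ (b a : List Letter) (R), drain.Exec ⟨a, b, R⟩ ⟨a, [], R⟩ (b.length + 1)
  | [], a, R => by simpa using Exec.drain_nil a R
  | x :: b, a, R => Exec.drain_cons (exec_drain b a R)

/-- Look up the letter `c` at the position kept in the counter `r`, which is emptied. -/
theorem exec_lookup (x : List Letter) (c : Letter) {r d : ℕ} (hrd : d ≠ r) (R) (hd : R d = 0) :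
    (seq (loop r right) (seq (test c d) rewind)).Exec ⟨[], x, R⟩
      ⟨[], x, update (update R d (letterTable x c (R r))) r 0⟩ (R r * 2 + x.length + 3) := by
  have h1 := exec_loop (r := r) (p := right) (t := 1) (R r)
    (fun k => ⟨(x.take k).reverse, x.drop k, update R r (R r - k)⟩) (fun k _ => by simp)
    (fun k hk => by
      have := exec_right x k (update R r (R r - (k + 1)))
      simpa [← Nat.sub_sub] using this)
  have h2 : (test c d).Exec ⟨(x.take (R r)).reverse, x.drop (R r), update R r 0⟩
      ⟨(x.take (R r)).reverse, x.drop (R r),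
        update (update R d (letterTable x c (R r))) r 0⟩ 1 := by
    have hc : (x.drop (R r)).head? = x[R r]? := List.head?_drop ..
    by_cases h : x[R r]? = some c
    · convert Exec.test_pos (hc.trans h) using 2
      funext y
      simp only [update_apply, letterTable, if_pos h]
      split_ifs <;> simp_all
    · convert Exec.test_neg (R := update R r 0) (hc ▸ h) using 2
      funext y
      simp only [update_apply, letterTable, if_neg h]
      split_ifs <;> simp_all
  have h3 := exec_rewind (x.take (R r)).reverse (x.drop (R r))
    (update (update R d (letterTable x c (R r))) r 0)
  simp only [Nat.sub_self] at h1
  have := (h1.seq (h2.seq h3)).mono (t' := R r * 2 + x.length + 3) (by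
    simp only [List.length_reverse, List.length_take]; omega)
  simpa using this

theorem update_sum_step (R : ℕ → ℕ) (d s n k c : ℕ) (h : R (d + 3) = 0) :
    update (update (update (update (update (update (update R d s) (d + 1) n) (d + 2) k) (d + 3) c)
      d (s + c)) (d + 3) 0) (d + 2) (k + 1)
      = update (update (update R d (s + c)) (d + 1) n) (d + 2) (k + 1) := by
  funext r
  simp only [update_apply]
  split_ifs <;> first | rfl | omega | (subst_vars; simp [h])

/-- Sum up the values `g k`, `k < f`, computed by `q`. The bound `f` is in the counter `d + 1`, the
summation variable in `d + 2`, the summands appear in `d + 3`. -/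
theorem exec_sum {q : Prog} {t w d : ℕ} (x : List Letter) (R : ℕ → ℕ) (hR : ∀ r, d ≤ r → R r = 0)
    (f : ℕ) (g : ℕ → ℕ) (hg : ∀ k < f, g k ≤ w)
    (hq : ∀ k < f, ∀ s, q.Exec
      ⟨[], x, update (update (update R d s) (d + 1) (f - k - 1)) (d + 2) k⟩
      ⟨[], x, update (update (update (update R d s) (d + 1) (f - k - 1)) (d + 2) k) (d + 3) (g k)⟩
      t) :
    (seq (loop (d + 1) (seq q (seq (loop (d + 3) (inc d)) (inc (d + 2)))))
      (loop (d + 2) (dec (d + 3)))).Exec ⟨[], x, update R (d + 1) f⟩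
      ⟨[], x, update R d (∑ i ∈ Finset.range f, g i)⟩
      (f * (t + (w * 2 + 1 + 1) + 1) + 1 + (f * 2 + 1)) := by
  let Rk : ℕ → ℕ → ℕ := fun k => update (update (update R d (∑ i ∈ Finset.range k, g i))
    (d + 1) (f - k)) (d + 2) k
  have e2 := exec_loop (r := d + 1) (p := seq q (seq (loop (d + 3) (inc d)) (inc (d + 2))))
    (t := t + (w * 2 + 1 + 1)) f
    (fun k => ⟨[], x, Rk k⟩) (fun k _ => by simp [Rk]) (fun k hk => by
      have h0 : update (Rk k) (d + 1) (f - k - 1) = update (update (update R d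
          (∑ i ∈ Finset.range k, g i)) (d + 1) (f - k - 1)) (d + 2) k := by
        simp only [Rk]
        rw [update_comm (by omega), update_idem]
      have a1 := hq k hk (∑ i ∈ Finset.range k, g i)
      have a2 := exec_move (r := d + 3) (s := d) (by omega) [] x
        (update (update (update (update R d (∑ i ∈ Finset.range k, g i)) (d + 1) (f - k - 1))
          (d + 2) k) (d + 3) (g k))
      have a3 := a1.seq (a2.seq (Exec.inc (d + 2) [] x _))
      have := hg k hk
      convert a3.mono (t' := t + (w * 2 + 1 + 1)) ?_ using 2
      · simp only [Rk, Finset.sum_range_succ]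
        rw [← update_sum_step _ _ _ _ _ _ (hR (d + 3) (by omega))]
        simp [← Nat.sub_sub]
      · simp
        omega)
  have e3 := exec_clear (r := d + 2) (s := d + 3) (by omega) [] x (Rk f)
    (by simp only [Rk, update_apply]; split_ifs <;> first | omega | exact hR _ (by omega))
  have e0 : Rk 0 = update R (d + 1) f := by
    have h0 := hR d le_rfl
    have h2 := hR (d + 2) (by omega)
    clear e2 e3 hq
    funext r
    simp only [Rk, update_apply]
    split_ifs <;> simp_all
  have e1 : update (Rk f) (d + 2) 0 = update R d (∑ i ∈ Finset.range f, g i) := by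
    have h1 := hR (d + 1) (by omega)
    have h2 := hR (d + 2) (by omega)
    clear e2 e3 hq
    funext r
    simp only [Rk, update_apply]
    split_ifs <;> first | rfl | omega | (subst_vars; simp [h1, h2])
  rw [e1, show Rk f (d + 2) = f by simp [Rk]] at e3
  rw [e0] at e2
  exact e2.seq e3

theorem update_binop (R : ℕ → ℕ) (d a b c : ℕ) (h : R (d + 1) = 0) :
    update (update (update (update R d a) (d + 1) b) d c) (d + 1) 0 = update R d c := by
  funext r
  simp only [update_apply]
  split_ifs <;> first | rfl | omega | (subst_vars; simp [h])

theorem update_unop (R : ℕ → ℕ) (d a c : ℕ) (h : R (d + 1) = 0) :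
    update (update (update R (d + 1) a) d c) (d + 1) 0 = update R d c := by
  funext r
  simp only [update_apply]
  split_ifs <;> first | rfl | omega | (subst_vars; simp [h])

/-- Every expressible function of the letter tables of the input is computed by a program in
polynomial time. The variables are kept in counters below `d`, the result goes to the counter `d`,
and the counters from `d` on are used as work space. -/
theorem exists_prog {N : Type} {F : (Letter → ℕ → ℕ) → (N → ℕ) → ℕ} (h : Expressible F) :
    ∀ (ρ : N → ℕ) (d : ℕ), (∀ n, ρ n < d) → ∃ (p : Prog) (T : Polynomial ℕ), ∀ x R m,
      x.length ≤ m → 1 ≤ m → (∀ n, R (ρ n) ≤ m) → (∀ r, d ≤ r → R r = 0) →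
      p.Exec ⟨[], x, R⟩ ⟨[], x, update R d (F (letterTable x) (fun n => R (ρ n)))⟩ (T.eval m) := by
  induction h with
  | var i =>
    intro ρ d hρ
    refine ⟨seq (loop (ρ i) (seq (inc d) (inc (d + 1)))) (loop (d + 1) (inc (ρ i))),
      5 * Polynomial.X + 2, fun x R m _ _ hm hR => ?_⟩
    have hi := hρ i
    have := exec_copy (x := ρ i) (d := d) (s := d + 1) (by omega) (by omega) (by omega) [] x R
      (hR _ (by omega))
    rw [hR d le_rfl, zero_add] at this
    refine this.mono ?_
    have := hm i
    simp
    omega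
  | one =>
    intro ρ d hρ
    refine ⟨inc d, 1, fun x R m _ _ hm hR => ?_⟩
    simpa [hR d le_rfl] using Exec.inc d [] x R
  | @add N F G hF hG ih ih' =>
    intro ρ d hρ
    obtain ⟨p, T, hp⟩ := ih ρ d hρ
    obtain ⟨q, U, hq⟩ := ih' ρ (d + 1) fun n => (hρ n).trans (Nat.lt_succ_self d)
    obtain ⟨W, hW⟩ := hG.bounded
    refine ⟨seq p (seq q (loop (d + 1) (inc d))), T + (U + (2 * W + 1)),
      fun x R m hx h1 hm hR => ?_⟩
    have hne : ∀ n, ρ n ≠ d := fun n => (hρ n).ne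
    have e1 := hp x R m hx h1 hm hR
    have e2 := hq x (update R d (F (letterTable x) fun n => R (ρ n))) m hx h1
      (fun n => by simpa [hne] using hm n) (fun r hr => by
        rw [update_of_ne (by omega)]; exact hR r (by omega))
    have e3 := exec_move (r := d + 1) (s := d) (by omega) [] x
      (update (update R d (F (letterTable x) fun n => R (ρ n))) (d + 1)
        (G (letterTable x) fun n => R (ρ n)))
    have hGm := hW (letterTable x) (fun n => R (ρ n)) m
      (fun j i => (letterTable_le x j i).trans h1) hm
    simp only [ne_eq, hne, not_false_eq_true, update_of_ne] at e2
    convert (e1.seq (e2.seq e3)).mono (t' := (T + (U + (2 * W + 1))).eval m) ?_ using 2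
    · rw [update_binop _ _ _ _ _ (hR (d + 1) (by omega))]
      simp
    · simp
      omega
  | @sub N F G hF hG ih ih' =>
    intro ρ d hρ
    obtain ⟨p, T, hp⟩ := ih ρ d hρ
    obtain ⟨q, U, hq⟩ := ih' ρ (d + 1) fun n => (hρ n).trans (Nat.lt_succ_self d)
    obtain ⟨W, hW⟩ := hG.bounded
    refine ⟨seq p (seq q (loop (d + 1) (dec d))), T + (U + (2 * W + 1)),
      fun x R m hx h1 hm hR => ?_⟩
    have hne : ∀ n, ρ n ≠ d := fun n => (hρ n).ne
    have e1 := hp x R m hx h1 hm hR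
    have e2 := hq x (update R d (F (letterTable x) fun n => R (ρ n))) m hx h1
      (fun n => by simpa [hne] using hm n) (fun r hr => by
        rw [update_of_ne (by omega)]; exact hR r (by omega))
    have e3 := exec_sub (r := d + 1) (s := d) (by omega) [] x
      (update (update R d (F (letterTable x) fun n => R (ρ n))) (d + 1)
        (G (letterTable x) fun n => R (ρ n)))
    have hGm := hW (letterTable x) (fun n => R (ρ n)) m
      (fun j i => (letterTable_le x j i).trans h1) hm
    simp only [ne_eq, hne, not_false_eq_true, update_of_ne] at e2
    convert (e1.seq (e2.seq e3)).mono (t' := (T + (U + (2 * W + 1))).eval m) ?_ using 2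
    · rw [update_binop _ _ _ _ _ (hR (d + 1) (by omega))]
      simp
    · simp
      omega
  | @sum N F G hF hG ih ih' =>
    intro ρ d hρ
    obtain ⟨p, T, hp⟩ := ih ρ (d + 1) fun n => (hρ n).trans (Nat.lt_succ_self d)
    obtain ⟨q, U, hq⟩ := ih' (fun o => o.elim (d + 2) ρ) (d + 3) (by
      rintro (_ | n)
      · exact Nat.lt_succ_self _
      · exact (hρ n).trans (by omega))
    obtain ⟨V, hV⟩ := hF.bounded
    obtain ⟨W, hW⟩ := hG.bounded
    let m' : Polynomial ℕ := Polynomial.X + V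
    refine ⟨seq p (seq (loop (d + 1) (seq q (seq (loop (d + 3) (inc d)) (inc (d + 2)))))
      (loop (d + 2) (dec (d + 3)))),
      T + ((V * ((U.comp m' + (W.comp m' * 2 + 1 + 1)) + 1) + 1) + (2 * V + 1)),
      fun x R m hx h1 hm hR => ?_⟩
    have hne : ∀ n k, ρ n ≠ d + k := fun n k => by have := hρ n; omega
    set f := F (letterTable x) fun n => R (ρ n) with hf
    set g : ℕ → ℕ := fun i => G (letterTable x) fun o => o.elim i fun n => R (ρ n) with hg
    have hfV : f ≤ V.eval m := hV _ _ m (fun j i => (letterTable_le x j i).trans h1) hm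
    have e1 := hp x R m hx h1 hm fun r hr => hR r (by omega)
    rw [← hf] at e1
    have hkm : ∀ k < f, ∀ n : Option N, (n.elim k fun n => R (ρ n)) ≤ m + V.eval m := by
      rintro k hk (_ | n)
      · simp only [Option.elim]; omega
      · exact (hm n).trans (Nat.le_add_right _ _)
    have e2 := exec_sum (q := q) (t := U.eval (m + V.eval m)) (w := W.eval (m + V.eval m)) x R hR
      f g (fun k hk => hW _ _ _ (fun j i => (letterTable_le x j i).trans (by omega)) (hkm k hk))
      (fun k hk s => by
        have hval : ∀ n : Option N, update (update (update R d s) (d + 1) (f - k - 1)) (d + 2) k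
            (n.elim (d + 2) ρ) = n.elim k fun n => R (ρ n) := by
          rintro (_ | n)
          · simp
          · have h0 : ρ n ≠ d := hne n 0
            have h1 := hne n 1
            have h2 := hne n 2
            simp only [Option.elim]
            rw [update_of_ne h2, update_of_ne h1, update_of_ne h0]
        have a1 := hq x (update (update (update R d s) (d + 1) (f - k - 1)) (d + 2) k)
          (m + V.eval m) (by omega) (by omega)
          (fun n => by rw [hval n]; exact hkm k hk n)
          (fun r hr => by
            simp only [update_apply]
            split_ifs <;> first | omega | exact hR r (by omega))
        simpa only [hval] using a1)
    refine (e1.seq e2).mono ?_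
    have := Nat.mul_le_mul_right
      (U.eval (m + V.eval m) + (W.eval (m + V.eval m) * 2 + 1 + 1) + 1) hfV
    simp only [m', Polynomial.eval_add, Polynomial.eval_mul, Polynomial.eval_comp,
      Polynomial.eval_X, Polynomial.eval_one, Polynomial.eval_ofNat]
    omega
  | @read N j F hF ih =>
    intro ρ d hρ
    obtain ⟨p, T, hp⟩ := ih ρ (d + 1) fun n => (hρ n).trans (Nat.lt_succ_self d)
    obtain ⟨V, hV⟩ := hF.bounded
    refine ⟨seq p (seq (loop (d + 1) right) (seq (test j d) rewind)),
      T + (2 * V + Polynomial.X + 3), fun x R m hx h1 hm hR => ?_⟩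
    have e1 := hp x R m hx h1 hm fun r hr => hR r (by omega)
    have hfV := hV (letterTable x) (fun n => R (ρ n)) m
      (fun j i => (letterTable_le x j i).trans h1) hm
    have e2 := exec_lookup x j (r := d + 1) (d := d) (by omega)
      (update R (d + 1) (F (letterTable x) fun n => R (ρ n)))
      (by rw [update_of_ne (by omega)]; exact hR d le_rfl)
    convert (e1.seq e2).mono (t' := (T + (2 * V + Polynomial.X + 3)).eval m) ?_ using 2
    · rw [update_unop _ _ _ _ (hR (d + 1) (by omega))]
      simp
    · simp
      omega

/-- The program that measures the input, evaluates a function by `p`, and cleans up; the value is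
left in the counter `1`. -/
def decideProg (p : Prog) : Prog :=
  seq (scan 0) (seq rewind (seq p (seq drain (loop 0 (dec 2)))))

theorem exec_decideProg {p : Prog} {T : ℕ} (x : List Letter) (c : ℕ)
    (hp : p.Exec ⟨[], x, update 0 0 x.length⟩
      ⟨[], x, update (update 0 0 x.length) 1 c⟩ T) :
    (decideProg p).Exec ⟨[], x, 0⟩ ⟨[], [], update 0 1 c⟩ (T + 5 * x.length + 4) := by
  have h1 := exec_scan 0 x [] 0
  have h2 := exec_rewind (x.reverse ++ []) [] (update 0 0 x.length)
  have h3 := exec_drain x [] (update (update 0 0 x.length) 1 c)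
  have h4 := exec_clear (r := 0) (s := 2) (by omega) [] [] (update (update 0 0 x.length) 1 c)
    (by simp)
  have e : update (update (update (0 : ℕ → ℕ) 0 x.length) 1 c) 0 0 = update (0 : ℕ → ℕ) 1 c := by
    funext r
    simp only [update_apply]
    split_ifs <;> simp_all
  simp only [Pi.zero_apply, zero_add] at h1
  simp only [List.append_nil, List.reverse_reverse] at h1 h2
  rw [e] at h4
  refine (h1.seq (h2.seq (hp.seq (h3.seq h4)))).mono ?_
  simp
  omega

open Turing.TM2.Stmt in
/-- The machine for `decideProg p`; at the additional label `none` it reads off the result. -/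
noncomputable def decideMachine (p : Prog) (M : ℕ) [NeZero M] : Turing.FinTM2 :=
  haveI := (decideProg p).finite_pts
  haveI : Fintype (Option (decideProg p).Pts) := Fintype.ofFinite _
  { K := Stack M
    k₀ := .inp
    k₁ := .out
    Γ := Alphabet
    Λ := Option (decideProg p).Pts
    main := some (decideProg p).entry
    σ := Option Letter
    initialState := none
    Γk₀Fin := inferInstanceAs (Fintype Letter)
    m := fun l => match l with
      | some a => (decideProg p).code some none a
      | none => pop (.reg (Fin.ofNat M 1)) (fun _ o => o.map fun _ => .inl true)
          (branch Option.isSome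
            (push .out (fun _ => true) (load (fun _ => none) halt))
            (push .out (fun _ => false) (load (fun _ => none) halt))) }

theorem initList_decideMachine (p : Prog) (M : ℕ) [NeZero M] (x : List Letter) :
    Turing.initList (decideMachine p M) x
      = ⟨some (some (decideProg p).entry), none, stackOf ⟨[], x, 0⟩ []⟩ := by
  unfold Turing.initList
  congr 1
  funext k
  cases k with
  | inp => exact dif_pos rfl
  | _ =>
    refine (dif_neg ?_).trans ?_
    · intro h
      cases h
    · rfl

theorem haltList_decideMachine (p : Prog) (M : ℕ) [NeZero M] (b : List Bool) :
    Turing.haltList (decideMachine p M) b = ⟨none, none, stackOf ⟨[], [], 0⟩ b⟩ := by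
  unfold Turing.haltList
  congr 1
  funext k
  cases k with
  | out => exact dif_pos rfl
  | _ =>
    refine (dif_neg ?_).trans ?_
    · intro h
      cases h
    · rfl

/-- A predicate with expressible characteristic function is decidable in polynomial time. -/
theorem polyTimeDecidable_of_expressible {F : (Letter → ℕ → ℕ) → (Unit → ℕ) → ℕ}
    (hF : Expressible F) (B : List Bool × List Bool → Bool)
    (hB : ∀ w u, F (letterTable (w.map .inl ++ u.map .inr)) (fun _ => w.length + u.length)
      = (B (w, u)).toNat) :
    Complexity.PolyTimeDecidable B := by
  obtain ⟨p, T, hp⟩ := exists_prog hF (fun _ => 0) 1 (fun _ => one_pos)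
  obtain ⟨M₀, hM₀⟩ := (decideProg p).exists_usesBelow
  have hM : (decideProg p).UsesBelow (M₀ + 2) := hM₀.mono (by omega)
  refine ⟨⟨⟨decideMachine p (M₀ + 2), Equiv.refl _, Equiv.refl _⟩,
    T.comp (Polynomial.X + 1) + 5 * Polynomial.X + 5, ?_⟩⟩
  rintro ⟨w, u⟩
  set x : List Letter := w.map .inl ++ u.map .inr with hx
  have hlen : x.length = w.length + u.length := by simp [hx]
  have e1 := hp x (update 0 0 x.length) (x.length + 1) (by omega) (by omega)
    (fun _ => by simp) (fun r hr => by rw [update_of_ne (by omega)]; rfl)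
  have hval : F (letterTable x) (fun _ => update (0 : ℕ → ℕ) 0 x.length 0)
      = (B (w, u)).toNat := by
    rw [← hB]
    simp [hx]
  rw [hval] at e1
  have e2 := (exec_decideProg x _ e1).reach (m := (decideMachine p (M₀ + 2)).m) hM some none
    (fun _ => rfl) []
  have e3 : Reach (decideMachine p (M₀ + 2)).m
      ⟨some none, none, stackOf ⟨[], [], update 0 1 (B (w, u)).toNat⟩ []⟩
      ⟨none, none, stackOf ⟨[], [], 0⟩ [B (w, u)]⟩ 1 := by
    apply Reach.step
    have ho : ∀ (R : ℕ → ℕ) (b : Bool), update (stackOf (M := M₀ + 2) ⟨[], [], R⟩ []) Stack.out [b]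
        = stackOf ⟨[], [], R⟩ [b] := by
      intro R b
      funext k
      cases k <;> rfl
    have hu : ∀ c : ℕ, update (update (0 : ℕ → ℕ) 1 c) 1 0 = 0 := by
      intro c
      funext r
      simp only [update_apply]
      split_ifs <;> rfl
    have h1 : 1 < M₀ + 2 := by omega
    simp only [Turing.TM2.step, decideMachine, Turing.TM2.stepAux, stackOf_reg h1]
    rw [update_reg h1 _ _ _ _ 0 _ (by cases B (w, u) <;> simp), hu]
    cases B (w, u) <;> simp [stackOf, ho]
  have h := e2.trans e3
  refine ⟨⟨h.choose, ?_⟩, h.choose_spec.1.trans ?_⟩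
  · have key : ∀ y : List Letter, y = x →
        (flip bind (Turing.TM2.step (decideMachine p (M₀ + 2)).m))^[h.choose]
          (some (Turing.initList (decideMachine p (M₀ + 2)) y))
          = some (Turing.haltList (decideMachine p (M₀ + 2)) [B (w, u)]) := by
      intro y hy
      rw [hy]
      have hi := initList_decideMachine p (M₀ + 2) x
      have ho := haltList_decideMachine p (M₀ + 2) [B (w, u)]
      exact (congrArg (fun c => (flip bind (Turing.TM2.step (decideMachine p (M₀ + 2)).m))^[h.choose]
        (some c)) hi).trans (h.choose_spec.2.trans (congrArg some ho.symm))
    exact key _ (List.map_id x)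
  · have : ((Computability.encodingProd (Computability.encodingList Bool)
      (Computability.encodingList Bool)).encode (w, u)).length = x.length := rfl
    rw [this]
    simp

end CounterProgram

/-! ### A calculus of functions expressible by bounded arithmetic -/

namespace Expressible

variable {K K' N N' : Type}

theorem rename {F : (K → ℕ → ℕ) → (N → ℕ) → ℕ} (h : Expressible F) :
    ∀ {K' N' : Type} (κ : K → K') (ρ : N → N'),
      Expressible fun (X : K' → ℕ → ℕ) (v : N' → ℕ) => F (fun j => X (κ j)) fun n => v (ρ n) := by
  induction h with
  | var i => exact fun κ ρ => var (ρ i)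
  | one => exact fun κ ρ => one
  | add _ _ ih ih' => exact fun κ ρ => (ih κ ρ).add (ih' κ ρ)
  | sub _ _ ih ih' => exact fun κ ρ => (ih κ ρ).sub (ih' κ ρ)
  | sum _ _ ih ih' =>
    intro K' N' κ ρ
    convert (ih κ ρ).sum (ih' κ (Option.map ρ)) using 7 with X v i hi o
    cases o <;> rfl
  | read j _ ih => exact fun κ ρ => read (κ j) (ih κ ρ)

/-- Substitution for the number variables. -/
theorem substNum {F : (K → ℕ → ℕ) → (N → ℕ) → ℕ} (h : Expressible F) :
    ∀ {N' : Type} (σ : N → (K → ℕ → ℕ) → (N' → ℕ) → ℕ), (∀ n, Expressible (σ n)) →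
      Expressible fun X v => F X fun n => σ n X v := by
  induction h with
  | var i => exact fun σ hσ => hσ i
  | one => exact fun σ hσ => one
  | add _ _ ih ih' => exact fun σ hσ => (ih σ hσ).add (ih' σ hσ)
  | sub _ _ ih ih' => exact fun σ hσ => (ih σ hσ).sub (ih' σ hσ)
  | sum _ _ ih ih' =>
    intro N' σ hσ
    convert (ih σ hσ).sum (ih' (fun o => o.elim (fun X v => v none)
      fun n X v => σ n X fun m => v (some m)) ?_) using 7 with X v i hi o
    · cases o <;> rfl
    · rintro (_ | n)
      · exact var none
      · exact (hσ n).rename id some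
  | read j _ ih => exact fun σ hσ => read j (ih σ hσ)

/-- Substitution for the number variables and for the tables. -/
theorem subst {F : (K → ℕ → ℕ) → (N → ℕ) → ℕ} (h : Expressible F) :
    ∀ {N' : Type} (σ : N → (K' → ℕ → ℕ) → (N' → ℕ) → ℕ)
      (τ : K → (K' → ℕ → ℕ) → (Option N' → ℕ) → ℕ), (∀ n, Expressible (σ n)) →
      (∀ j, Expressible (τ j)) →
      Expressible fun X v => F (fun j i => τ j X fun o => o.elim i v) fun n => σ n X v := by
  induction h with
  | var i => exact fun σ τ hσ _ => hσ i
  | one => exact fun σ τ hσ _ => one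
  | add _ _ ih ih' => exact fun σ τ hσ hτ => (ih σ τ hσ hτ).add (ih' σ τ hσ hτ)
  | sub _ _ ih ih' => exact fun σ τ hσ hτ => (ih σ τ hσ hτ).sub (ih' σ τ hσ hτ)
  | @sum N F G _ _ ih ih' =>
    intro N' σ τ hσ hτ
    have h2 := ih' (fun o => o.elim (fun X v => v none) fun n X v => σ n X fun m => v (some m))
      (fun j X v => τ j X fun o => v (o.map some)) (by
        rintro (_ | n)
        · exact var none
        · exact (hσ n).rename id some) fun j => (hτ j).rename id _
    convert (ih σ τ hσ hτ).sum h2 using 4 with X v i hi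
    congr 1
    · funext j i'
      congr 1
      funext o
      cases o <;> rfl
    · funext o
      cases o <;> rfl
  | @read N j F _ ih =>
    intro N' σ τ hσ hτ
    exact (hτ j).substNum (fun o => o.elim
      (fun X v => F (fun j i => τ j X fun o => o.elim i v) fun n => σ n X v) fun m _ v => v m) (by
        rintro (_ | n)
        · exact ih σ τ hσ hτ
        · exact var n) |> fun h => by
      convert h using 4 with X v
      funext o
      cases o <;> rfl

end Expressible

/-- A type whose elements consist of numbers and of tables `ℕ → ℕ`. The tables are available by
look-up only; the numbers contribute to the size. -/
class Ctx (γ : Type) where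
  TabIdx : Type
  NumIdx : Type
  tab : γ → TabIdx → ℕ → ℕ
  num : γ → NumIdx → ℕ
  siz : γ → ℕ
  expressible_siz : ∃ F, Expressible F ∧ ∀ c, siz c = F (tab c) (num c)

section

open Ctx

instance : Ctx ℕ where
  TabIdx := Empty
  NumIdx := Unit
  tab _ j := j.elim
  num n _ := n
  siz n := n
  expressible_siz := ⟨_, .var (), fun _ => rfl⟩

instance : Ctx (ℕ → ℕ) where
  TabIdx := Unit
  NumIdx := Empty
  tab t _ := t
  num _ n := n.elim
  siz _ := 0
  expressible_siz := ⟨_, .sub .one .one, fun _ => rfl⟩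

instance {γ δ : Type} [Ctx γ] [Ctx δ] : Ctx (γ × δ) where
  TabIdx := TabIdx γ ⊕ TabIdx δ
  NumIdx := NumIdx γ ⊕ NumIdx δ
  tab c := Sum.elim (tab c.1) (tab c.2)
  num c := Sum.elim (num c.1) (num c.2)
  siz c := siz c.1 + siz c.2
  expressible_siz := by
    obtain ⟨F, hF, h⟩ := expressible_siz (γ := γ)
    obtain ⟨G, hG, h'⟩ := expressible_siz (γ := δ)
    exact ⟨_, (hF.rename Sum.inl Sum.inl).add (hG.rename Sum.inr Sum.inr), fun c => by
      rw [h, h']; rfl⟩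

@[simp] theorem siz_nat (n : ℕ) : siz n = n := rfl
@[simp] theorem siz_tab (t : ℕ → ℕ) : siz t = 0 := rfl
@[simp] theorem siz_prod {γ δ : Type} [Ctx γ] [Ctx δ] (c : γ × δ) : siz c = siz c.1 + siz c.2 := rfl

variable {γ δ ε : Type} [Ctx γ] [Ctx δ] [Ctx ε]

/-- The value of a table. It is function application under a name of its own, so that `fun_prop`
recognizes a table look-up. -/
def ev (t : ℕ → ℕ) (i : ℕ) : ℕ := t i

/-- An `ℕ`-valued function that is given by an expression. -/
def NumPT (f : γ → ℕ) : Prop := ∃ F, Expressible F ∧ ∀ c, f c = F (tab c) (num c)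

/-- A function all of whose component numbers and tables are given by expressions; an expression for
a table has the position in the table as an additional variable. -/
@[fun_prop] def PT (φ : δ → γ) : Prop :=
  (∀ n, NumPT fun d => num (φ d) n) ∧ ∀ j, NumPT fun p : δ × ℕ => tab (φ p.1) j p.2

theorem pt_nat_iff {f : δ → ℕ} : PT f ↔ NumPT f :=
  ⟨fun h => h.1 (), fun h => ⟨fun _ => h, fun j => j.elim⟩⟩

theorem pt_tab_iff {f : δ → ℕ → ℕ} : PT f ↔ PT fun p : δ × ℕ => f p.1 p.2 := by
  rw [pt_nat_iff]
  exact ⟨fun h => h.2 (), fun h => ⟨fun n => n.elim, fun _ => h⟩⟩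

theorem NumPT.exists_option {g : γ × ℕ → ℕ} (hg : NumPT g) :
    ∃ G : (TabIdx γ → ℕ → ℕ) → (Option (NumIdx γ) → ℕ) → ℕ, Expressible G ∧
      ∀ c i, g (c, i) = G (tab c) fun o => o.elim i (num c) := by
  obtain ⟨G, hG, h⟩ := hg
  refine ⟨_, hG.rename (Sum.elim id Empty.elim) (Sum.elim some fun _ => none), fun c i => ?_⟩
  rw [h]
  congr 1
  · funext j
    rcases j with j | j
    · rfl
    · exact j.elim
  · funext n
    cases n <;> rfl

theorem NumPT.comp {f : γ → ℕ} {φ : δ → γ} (hf : NumPT f) (hφ : PT φ) :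
    NumPT fun d => f (φ d) := by
  obtain ⟨F, hF, h⟩ := hf
  choose σ hσ h1 using hφ.1
  choose τ hτ h2 using fun j => (hφ.2 j).exists_option
  refine ⟨_, hF.subst σ τ hσ hτ, fun d => ?_⟩
  beta_reduce
  rw [h]
  congr 1
  · funext j i
    exact h2 j d i
  · funext n
    exact h1 n d

theorem numPT_num (n : NumIdx γ) : NumPT fun c : γ => num c n := ⟨_, .var n, fun _ => rfl⟩

theorem numPT_tab (j : TabIdx γ) : NumPT fun p : γ × ℕ => tab p.1 j p.2 :=
  ⟨_, .read (Sum.inl j) (.var (Sum.inr ())), fun _ => rfl⟩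

namespace PT

theorem prodMk {f : γ → δ} {g : γ → ε} (hf : PT f) (hg : PT g) : PT fun c => (f c, g c) := by
  constructor
  · rintro (n | n)
    · exact hf.1 n
    · exact hg.1 n
  · rintro (j | j)
    · exact hf.2 j
    · exact hg.2 j

theorem id : PT fun c : γ => c := ⟨numPT_num, numPT_tab⟩

theorem fst : PT fun c : γ × δ => c.1 :=
  ⟨fun n => numPT_num (γ := γ × δ) (Sum.inl n), fun j =>
    ⟨_, .read (Sum.inl (Sum.inl j)) (.var (Sum.inr ())), fun _ => rfl⟩⟩

theorem snd : PT fun c : γ × δ => c.2 :=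
  ⟨fun n => numPT_num (γ := γ × δ) (Sum.inr n), fun j =>
    ⟨_, .read (Sum.inl (Sum.inr j)) (.var (Sum.inr ())), fun _ => rfl⟩⟩

theorem fst_fst : PT fun c : (γ × δ) × ε => c.1.1 :=
  ⟨fun n => numPT_num (γ := (γ × δ) × ε) (Sum.inl (Sum.inl n)), fun j =>
    ⟨_, .read (Sum.inl (Sum.inl (Sum.inl j))) (.var (Sum.inr ())), fun _ => rfl⟩⟩

theorem comp_fst {f : γ → ε} (hf : PT f) : PT fun c : γ × δ => f c.1 :=
  ⟨fun n => (hf.1 n).comp fst, fun j => (hf.2 j).comp (prodMk fst_fst snd)⟩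

@[fun_prop] theorem comp {f : δ → ε} {g : γ → δ} (hf : PT f) (hg : PT g) : PT fun c => f (g c) :=
  ⟨fun n => (hf.1 n).comp hg, fun j => (hf.2 j).comp (prodMk (comp_fst hg) snd)⟩

attribute [fun_prop] prodMk id

@[fun_prop] theorem fst' {f : γ → δ × ε} (hf : PT f) : PT fun c => (f c).1 := comp fst hf

@[fun_prop] theorem snd' {f : γ → δ × ε} (hf : PT f) : PT fun c => (f c).2 := comp snd hf

@[fun_prop] theorem table {f : γ → ℕ → ℕ} (hf : PT fun p : γ × ℕ => f p.1 p.2) :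
    PT fun c i => f c i :=
  pt_tab_iff.2 hf

theorem app {f : γ → ℕ → ℕ} {g : γ → ℕ} (hf : PT f) (hg : PT g) :
    PT fun c => f c (g c) :=
  comp (pt_tab_iff.1 hf) (prodMk id hg)

@[fun_prop] theorem ev {f : γ → ℕ → ℕ} {g : γ → ℕ} (hf : PT f) (hg : PT g) :
    PT fun c => ev (f c) (g c) :=
  hf.app hg

theorem one : PT fun _ : γ => 1 := pt_nat_iff.2 ⟨_, .one, fun _ => rfl⟩

@[fun_prop] theorem add {f g : γ → ℕ} (hf : PT f) (hg : PT g) : PT fun c => f c + g c := by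
  obtain ⟨F, hF, h⟩ := pt_nat_iff.1 hf
  obtain ⟨G, hG, h'⟩ := pt_nat_iff.1 hg
  exact pt_nat_iff.2 ⟨_, hF.add hG, fun c => by beta_reduce; rw [h, h']⟩

@[fun_prop] theorem sub {f g : γ → ℕ} (hf : PT f) (hg : PT g) : PT fun c => f c - g c := by
  obtain ⟨F, hF, h⟩ := pt_nat_iff.1 hf
  obtain ⟨G, hG, h'⟩ := pt_nat_iff.1 hg
  exact pt_nat_iff.2 ⟨_, hF.sub hG, fun c => by beta_reduce; rw [h, h']⟩

@[fun_prop] theorem const : ∀ n : ℕ, PT fun _ : γ => n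
  | 0 => by simpa using one.sub (one (γ := γ))
  | n + 1 => (const n).add one

@[fun_prop] theorem sum {f : γ → ℕ} {g : γ → ℕ → ℕ} (hf : PT f)
    (hg : PT fun p : γ × ℕ => g p.1 p.2) : PT fun c => ∑ i ∈ Finset.range (f c), g c i := by
  obtain ⟨F, hF, h⟩ := pt_nat_iff.1 hf
  obtain ⟨G, hG, h'⟩ := (pt_nat_iff.1 hg).exists_option
  refine pt_nat_iff.2 ⟨_, hF.sum hG, fun c => ?_⟩
  beta_reduce
  rw [h]
  exact Finset.sum_congr rfl fun i _ => h' c i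

@[fun_prop] theorem mul {f g : γ → ℕ} (hf : PT f) (hg : PT g) : PT fun c => f c * g c := by
  have : PT fun c => ∑ _i ∈ Finset.range (f c), g c := by fun_prop
  simpa using this

@[fun_prop] theorem pow {f : γ → ℕ} (hf : PT f) : ∀ n : ℕ, PT fun c => f c ^ n
  | 0 => by simpa using const 1
  | n + 1 => by simpa [pow_succ] using (pow hf n).mul hf

@[fun_prop] theorem siz {f : δ → γ} (hf : PT f) : PT fun c => siz (f c) :=
  comp (pt_nat_iff.2 expressible_siz) hf

end PT

/-- A predicate whose characteristic function is given by an expression. -/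
@[fun_prop] def PTP (P : γ → Prop) : Prop := ∃ f : γ → ℕ, PT f ∧ ∀ c, P c ↔ f c ≠ 0

namespace PTP

@[fun_prop] theorem comp {P : δ → Prop} {g : γ → δ} (hP : PTP P) (hg : PT g) :
    PTP fun c => P (g c) := by
  obtain ⟨f, hf, h⟩ := hP
  exact ⟨fun c => f (g c), hf.comp hg, fun c => h _⟩

@[fun_prop] theorem not {P : γ → Prop} (hP : PTP P) : PTP fun c => ¬ P c := by
  obtain ⟨f, hf, h⟩ := hP
  exact ⟨fun c => 1 - f c, by fun_prop, fun c => by beta_reduce; rw [h]; omega⟩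

@[fun_prop] theorem and {P Q : γ → Prop} (hP : PTP P) (hQ : PTP Q) : PTP fun c => P c ∧ Q c := by
  obtain ⟨f, hf, h⟩ := hP
  obtain ⟨g, hg, h'⟩ := hQ
  exact ⟨fun c => f c * g c, by fun_prop, fun c => by beta_reduce; rw [h, h', Nat.mul_ne_zero_iff]⟩

@[fun_prop] theorem or {P Q : γ → Prop} (hP : PTP P) (hQ : PTP Q) : PTP fun c => P c ∨ Q c := by
  obtain ⟨f, hf, h⟩ := hP
  obtain ⟨g, hg, h'⟩ := hQ
  exact ⟨fun c => f c + g c, by fun_prop, fun c => by beta_reduce; rw [h, h']; omega⟩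

@[fun_prop] theorem imp {P Q : γ → Prop} (hP : PTP P) (hQ : PTP Q) : PTP fun c => P c → Q c := by
  simp only [imp_iff_not_or]
  exact hP.not.or hQ

@[fun_prop] theorem le {f g : γ → ℕ} (hf : PT f) (hg : PT g) : PTP fun c => f c ≤ g c :=
  ⟨fun c => 1 - (f c - g c), by fun_prop, fun c => by beta_reduce; omega⟩

@[fun_prop] theorem lt {f g : γ → ℕ} (hf : PT f) (hg : PT g) : PTP fun c => f c < g c :=
  ⟨fun c => g c - f c, by fun_prop, fun c => by beta_reduce; omega⟩

@[fun_prop] theorem eq {f g : γ → ℕ} (hf : PT f) (hg : PT g) : PTP fun c => f c = g c :=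
  ⟨fun c => 1 - ((f c - g c) + (g c - f c)), by fun_prop, fun c => by beta_reduce; omega⟩

@[fun_prop] theorem ex {f : γ → ℕ} {P : γ → ℕ → Prop} (hf : PT f)
    (hP : PTP fun p : γ × ℕ => P p.1 p.2) : PTP fun c => ∃ i < f c, P c i := by
  obtain ⟨g, hg, h⟩ := hP
  refine ⟨fun c => ∑ i ∈ Finset.range (f c), g (c, i), by fun_prop, fun c => ?_⟩
  simp only [ne_eq, Finset.sum_eq_zero_iff, Finset.mem_range, not_forall, exists_prop]
  exact exists_congr fun i => and_congr_right fun _ => h (c, i)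

@[fun_prop] theorem all {f : γ → ℕ} {P : γ → ℕ → Prop} (hf : PT f)
    (hP : PTP fun p : γ × ℕ => P p.1 p.2) : PTP fun c => ∀ i < f c, P c i := by
  have := (ex (P := fun c i => ¬ P c i) hf hP.not).not
  simpa using this

end PTP

@[fun_prop] theorem PT.ite {P : γ → Prop} [DecidablePred P] {f g : γ → ℕ} (hP : PTP P)
    (hf : PT f) (hg : PT g) :
    PT fun c => if P c then f c else g c := by
  obtain ⟨p, hp, h⟩ := hP
  have : PT fun c => (1 - (1 - p c)) * f c + (1 - p c) * g c := by fun_prop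
  convert this using 2 with c
  by_cases hc : P c
  · have : p c ≠ 0 := (h c).1 hc
    rw [if_pos hc, show 1 - p c = 0 by omega]
    simp
  · have : p c = 0 := by
      by_contra h0
      exact hc ((h c).2 h0)
    rw [if_neg hc, this]
    simp

@[fun_prop] theorem PT.pair {f g : γ → ℕ} (hf : PT f) (hg : PT g) :
    PT fun c => Nat.pair (f c) (g c) := by
  classical
  simp only [Nat.pair]
  have := PT.ite (PTP.lt hf hg) (f := fun c => g c * g c + f c)
    (g := fun c => f c * f c + f c + g c) (by fun_prop) (by fun_prop)
  convert this

end

/-! ### Counting tables -/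

section

open Ctx

/-- The tables with all entries at most `L` and zero from the position `L` on. -/
def Tables (L : ℕ) : Set (ℕ → ℕ) := {t | (∀ i, t i ≤ L) ∧ ∀ i, L ≤ i → t i = 0}

theorem tables_mono {L M : ℕ} (h : L ≤ M) : Tables L ⊆ Tables M :=
  fun _ ht => ⟨fun i => (ht.1 i).trans h, fun i hi => ht.2 i (h.trans hi)⟩

theorem tables_of_forall_lt {L M : ℕ} {t : ℕ → ℕ} (ht : t ∈ Tables M) :
    (∀ i < M, t i ≤ L ∧ (L ≤ i → t i = 0)) ↔ t ∈ Tables L := by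
  constructor
  · intro h
    refine ⟨fun i => ?_, fun i hi => ?_⟩
    · rcases lt_or_ge i M with hM | hM
      · exact (h i hM).1
      · simp [ht.2 i hM]
    · rcases lt_or_ge i M with hM | hM
      · exact (h i hM).2 hi
      · exact ht.2 i hM
  · exact fun h i _ => ⟨h.1 i, h.2 i⟩

variable {γ δ ε : Type} [Ctx γ] [Ctx δ] [Ctx ε]

/-- Polynomially bounded in terms of the size. -/
def PolyBdd (f : γ → ℕ) : Prop := ∃ e : ℕ, ∀ c, f c ≤ (siz c + 2) ^ e

namespace PolyBdd

theorem mono {f g : γ → ℕ} (hg : PolyBdd g) (h : ∀ c, f c ≤ g c) : PolyBdd f := by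
  obtain ⟨e, he⟩ := hg
  exact ⟨e, fun c => (h c).trans (he c)⟩

theorem const (n : ℕ) : PolyBdd fun _ : γ => n := by
  refine ⟨n, fun c => ?_⟩
  calc n ≤ 2 ^ n := Nat.lt_two_pow_self.le
    _ ≤ (siz c + 2) ^ n := Nat.pow_le_pow_left (by omega) _

theorem siz : PolyBdd fun c : γ => siz c := ⟨1, fun c => by simp⟩

theorem mul {f g : γ → ℕ} (hf : PolyBdd f) (hg : PolyBdd g) : PolyBdd fun c => f c * g c := by
  obtain ⟨a, ha⟩ := hf
  obtain ⟨b, hb⟩ := hg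
  exact ⟨a + b, fun c => by rw [pow_add]; exact Nat.mul_le_mul (ha c) (hb c)⟩

theorem add {f g : γ → ℕ} (hf : PolyBdd f) (hg : PolyBdd g) : PolyBdd fun c => f c + g c := by
  obtain ⟨a, ha⟩ := hf
  obtain ⟨b, hb⟩ := hg
  refine ⟨a + b + 1, fun c => ?_⟩
  have h1 : (Ctx.siz c + 2) ^ a ≤ (Ctx.siz c + 2) ^ (a + b) :=
    Nat.pow_le_pow_right (by omega) (by omega)
  have h2 : (Ctx.siz c + 2) ^ b ≤ (Ctx.siz c + 2) ^ (a + b) :=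
    Nat.pow_le_pow_right (by omega) (by omega)
  have := ha c
  have := hb c
  have h3 : (Ctx.siz c + 2) ^ (a + b) * 2 ≤ (Ctx.siz c + 2) ^ (a + b + 1) := by
    rw [pow_succ]
    exact Nat.mul_le_mul_left _ (by omega)
  beta_reduce
  omega

theorem pow {f : γ → ℕ} (hf : PolyBdd f) : ∀ n : ℕ, PolyBdd fun c => f c ^ n
  | 0 => by simpa using const 1
  | n + 1 => by simpa [pow_succ] using (pow hf n).mul hf

end PolyBdd

/-- A family of finite sets of tables of polynomial size with membership given by an expression. -/
def DefSet (D : γ → Finset (ℕ → ℕ)) : Prop :=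
  ∃ (e : ℕ) (Q : γ × (ℕ → ℕ) → Prop), PTP Q ∧
    ∀ c t, t ∈ D c ↔ t ∈ Tables ((siz c + 2) ^ e) ∧ Q (c, t)

/-- A criterion for definability with an explicit size bound `L`. The formula `Q e` may depend on
the exponent `e` of the polynomial that bounds `L`, since statements about all entries of a table
have to be written with quantifiers bounded by this polynomial. -/
theorem DefSet.intro {D : γ → Finset (ℕ → ℕ)} {L : γ → ℕ} (hL : PolyBdd L)
    (hD : ∀ c, ∀ t ∈ D c, t ∈ Tables (L c)) (Q : ℕ → γ × (ℕ → ℕ) → Prop) (hQ : ∀ e, PTP (Q e))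
    (h : ∀ e c t, L c ≤ (siz c + 2) ^ e → t ∈ Tables ((siz c + 2) ^ e) → (t ∈ D c ↔ Q e (c, t))) :
    DefSet D := by
  obtain ⟨e, he⟩ := hL
  refine ⟨e, Q e, hQ e, fun c t => ?_⟩
  constructor
  · intro ht
    have h1 := tables_mono (he c) (hD c t ht)
    exact ⟨h1, (h e c t (he c) h1).1 ht⟩
  · rintro ⟨h1, h2⟩
    exact (h e c t (he c) h1).2 h2

/-- A function in a context belongs to `Sharp` if it counts the elements of a definable family of
sets of tables. This is the analogue of `#P`. -/
def Sharp (F : γ → ℕ) : Prop := ∃ D : γ → Finset (ℕ → ℕ), DefSet D ∧ ∀ c, F c = (D c).card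

theorem Sharp.congr {F G : γ → ℕ} (hF : Sharp F) (h : ∀ c, G c = F c) : Sharp G := by
  rwa [show G = F from funext h]

/-- Substitution; the values outside `P` may have uncontrolled size. -/
theorem DefSet.comp {D : γ → Finset (ℕ → ℕ)} (hD : DefSet D) {φ : δ → γ} (hφ : PT φ)
    {P : δ → Prop} [DecidablePred P] (hP : PTP P) {L : δ → ℕ} (hL : PolyBdd L)
    (h : ∀ d, P d → siz (φ d) ≤ L d) :
    DefSet fun d => if P d then D (φ d) else ∅ := by
  obtain ⟨e, Q, hQ, hD⟩ := hD
  refine DefSet.intro (L := fun d => (L d + 2) ^ e) ((hL.add (.const 2)).pow e) (fun d t ht => ?_)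
    (fun e' p => P p.1 ∧ (∀ i < (siz p.1 + 2) ^ e', ev p.2 i ≤ (siz (φ p.1) + 2) ^ e ∧
      ((siz (φ p.1) + 2) ^ e ≤ i → ev p.2 i = 0)) ∧ Q (φ p.1, p.2))
    (fun e' => by fun_prop) fun e' d t he' ht => ?_
  · split_ifs at ht with hd
    · exact tables_mono (Nat.pow_le_pow_left (by have := h d hd; omega) _) ((hD _ _).1 ht).1
    · simp at ht
  · split_ifs with hd
    · rw [hD]
      simp only [ev, hd, true_and, tables_of_forall_lt ht]
    · simp [hd]

/-- Substitution into a counting function. Where `P` fails, `φ d` may have a size that is not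
polynomially bounded, and the function is set to `0`. -/
theorem Sharp.comp_of {F : γ → ℕ} (hF : Sharp F) {φ : δ → γ} (hφ : PT φ)
    {P : δ → Prop} [DecidablePred P] (hP : PTP P) {L : δ → ℕ} (hL : PolyBdd L)
    (h : ∀ d, P d → siz (φ d) ≤ L d) :
    Sharp fun d => if P d then F (φ d) else 0 := by
  obtain ⟨D, hD, hF⟩ := hF
  refine ⟨_, hD.comp hφ hP hL h, fun d => ?_⟩
  beta_reduce
  split_ifs
  · exact hF _
  · rfl

theorem PTP.trivial : PTP fun _ : γ => True := ⟨fun _ => 1, by fun_prop, by simp⟩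

theorem Sharp.comp {F : γ → ℕ} (hF : Sharp F) {φ : δ → γ} (hφ : PT φ)
    (h : PolyBdd fun d => siz (φ d)) : Sharp fun d => F (φ d) := by
  classical
  have := hF.comp_of hφ PTP.trivial h fun d _ => le_rfl
  simpa using this

theorem Sharp.indicator {P : γ → Prop} (hP : PTP P) [DecidablePred P] :
    Sharp fun c => if P c then 1 else 0 := by
  refine ⟨fun c => if P c then {0} else ∅, ?_, fun c => ?_⟩
  · refine DefSet.intro (L := fun _ => 0) (.const 0) (fun c t ht => ?_)
      (fun e p => P p.1 ∧ ∀ i < (siz p.1 + 2) ^ e, ev p.2 i = 0) (fun e => by fun_prop)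
      fun e c t _ ht => ?_
    · split_ifs at ht
      · rw [Finset.mem_singleton.1 ht]
        exact ⟨fun _ => le_rfl, fun _ _ => rfl⟩
      · simp at ht
    · split_ifs with hc
      · simp only [Finset.mem_singleton, hc, true_and, ev]
        constructor
        · rintro rfl i _
          rfl
        · intro h
          funext i
          rcases lt_or_ge i ((siz c + 2) ^ e) with hi | hi
          · exact h i hi
          · exact ht.2 i hi
      · simp [hc]
  · beta_reduce
    split_ifs <;> rfl

/-! ### Two-dimensional tables -/

/-- A two-dimensional table as a table. -/
def joinTab (s : ℕ → ℕ → ℕ) (k : ℕ) : ℕ := s k.unpair.1 k.unpair.2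

/-- The `i`-th row of a two-dimensional table. -/
def rowTab (r : ℕ → ℕ) (i j : ℕ) : ℕ := r (Nat.pair i j)

@[simp] theorem rowTab_joinTab (s : ℕ → ℕ → ℕ) : rowTab (joinTab s) = s := by
  funext i j
  simp [rowTab, joinTab]

@[simp] theorem joinTab_rowTab (r : ℕ → ℕ) : joinTab (rowTab r) = r := by
  funext k
  simp [rowTab, joinTab]

theorem joinTab_injective : Function.Injective joinTab :=
  Function.LeftInverse.injective rowTab_joinTab

@[fun_prop] theorem PT.rowTab {f : γ → ℕ → ℕ} {g : γ → ℕ} (hf : PT f) (hg : PT g) :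
    PT fun c => rowTab (f c) (g c) := by
  have : PT fun c j => _root_.ev (f c) (Nat.pair (g c) j) := by fun_prop
  exact this

theorem joinTab_mem_tables {s : ℕ → ℕ → ℕ} {L : ℕ} (hs : ∀ i, s i ∈ Tables L)
    (h : ∀ i, L ≤ i → s i = 0) : joinTab s ∈ Tables ((L + 1) ^ 2) := by
  refine ⟨fun k => ((hs _).1 _).trans (by nlinarith), fun k hk => ?_⟩
  have h1 := Nat.pair_lt_max_add_one_sq k.unpair.1 k.unpair.2
  rw [Nat.pair_unpair] at h1
  have h2 : L < max k.unpair.1 k.unpair.2 := by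
    have := lt_of_pow_lt_pow_left₀ 2 (by omega) (hk.trans_lt h1)
    omega
  rcases lt_max_iff.1 h2 with h3 | h3
  · simp [joinTab, h _ h3.le]
  · exact (hs _).2 _ h3.le

theorem rowTab_mem_tables {r : ℕ → ℕ} {L : ℕ} (hr : r ∈ Tables L) (i : ℕ) :
    rowTab r i ∈ Tables L :=
  ⟨fun _ => hr.1 _, fun _ hj => hr.2 _ (hj.trans (Nat.right_le_pair i _))⟩

theorem rowTab_eq_zero {r : ℕ → ℕ} {L : ℕ} (hr : r ∈ Tables L) {i : ℕ} (hi : L ≤ i) :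
    rowTab r i = 0 :=
  funext fun j => hr.2 _ (hi.trans (Nat.left_le_pair i j))

theorem tables_eq_zero_iff {r : ℕ → ℕ} {L : ℕ} (hr : r ∈ Tables L) :
    (∀ j < L, r j = 0) ↔ r = 0 := by
  constructor
  · intro h
    funext j
    rcases lt_or_ge j L with hj | hj
    · exact h j hj
    · exact hr.2 j hj
  · rintro rfl j _
    rfl

/-- A sequence of tables as a table. -/
def seqTab {m : ℕ} (s : Fin m → ℕ → ℕ) : ℕ → ℕ :=
  joinTab fun i => if h : i < m then s ⟨i, h⟩ else 0

theorem rowTab_seqTab {m : ℕ} (s : Fin m → ℕ → ℕ) (i : Fin m) : rowTab (seqTab s) i = s i := by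
  simp [seqTab]

theorem rowTab_seqTab_of_le {m : ℕ} (s : Fin m → ℕ → ℕ) {i : ℕ} (hi : m ≤ i) :
    rowTab (seqTab s) i = 0 := by
  simp [seqTab, not_lt.2 hi]

theorem seqTab_injective (m : ℕ) : Function.Injective (seqTab (m := m)) := by
  intro s t h
  funext i
  rw [← rowTab_seqTab s, h, rowTab_seqTab]

theorem seqTab_rowTab {r : ℕ → ℕ} {m : ℕ} (h : ∀ i, m ≤ i → rowTab r i = 0) :
    seqTab (fun i : Fin m => rowTab r i) = r := by
  rw [← joinTab_rowTab r, seqTab]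
  congr 1
  funext i
  split_ifs with hi
  · simp
  · rw [h i (not_lt.1 hi)]

open Classical in
/-- Sequences of elements of definable sets. -/
theorem DefSet.pi {D : γ × ℕ → Finset (ℕ → ℕ)} (hD : DefSet D) {m : γ → ℕ} (hm : PT m)
    (hb : PolyBdd m) :
    DefSet fun c => (Fintype.piFinset fun i : Fin (m c) => D (c, i.1)).image seqTab := by
  obtain ⟨e, Q, hQ, hD⟩ := hD
  have hbd : PolyBdd fun c => ((m c + (siz c + m c + 2) ^ e) + 1) ^ 2 :=
    ((hb.add (((PolyBdd.siz.add hb).add (.const 2)).pow e)).add (.const 1)).pow 2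
  refine DefSet.intro hbd (fun c t ht => ?_)
    (fun e' p => (∀ i < m p.1, (∀ j < (siz p.1 + 2) ^ e',
        ev (rowTab p.2 i) j ≤ (siz p.1 + i + 2) ^ e ∧
          ((siz p.1 + i + 2) ^ e ≤ j → ev (rowTab p.2 i) j = 0)) ∧ Q ((p.1, i), rowTab p.2 i)) ∧
      ∀ i < (siz p.1 + 2) ^ e', m p.1 ≤ i → ∀ j < (siz p.1 + 2) ^ e', ev (rowTab p.2 i) j = 0)
    (fun e' => by fun_prop) fun e' c t he' ht => ?_
  · obtain ⟨s, hs, rfl⟩ := Finset.mem_image.1 ht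
    refine joinTab_mem_tables (fun i => ?_) fun i hi => ?_
    · split_ifs with h
      · refine tables_mono ?_ ((hD _ _).1 (Fintype.mem_piFinset.1 hs ⟨i, h⟩)).1
        simp only [siz_prod, siz_nat]
        exact (Nat.pow_le_pow_left (by omega) _).trans (Nat.le_add_left _ _)
      · exact ⟨fun _ => Nat.zero_le _, fun _ _ => rfl⟩
    · rw [dif_neg (by omega)]
  · have hrow := rowTab_mem_tables ht
    simp only [ev]
    have h1 : (∀ i < (siz c + 2) ^ e', m c ≤ i → ∀ j < (siz c + 2) ^ e', rowTab t i j = 0) ↔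
        ∀ i, m c ≤ i → rowTab t i = 0 := by
      constructor
      · intro h i hi
        rcases lt_or_ge i ((siz c + 2) ^ e') with h' | h'
        · exact (tables_eq_zero_iff (hrow i)).1 (h i h' hi)
        · exact rowTab_eq_zero ht h'
      · intro h i _ hi j _
        rw [h i hi]
        rfl
    simp only [h1, tables_of_forall_lt (hrow _)]
    constructor
    · intro h
      obtain ⟨s, hs, rfl⟩ := Finset.mem_image.1 h
      refine ⟨fun i hi => ?_, fun i hi => rowTab_seqTab_of_le s hi⟩
      rw [rowTab_seqTab s ⟨i, hi⟩]
      have := (hD _ _).1 (Fintype.mem_piFinset.1 hs ⟨i, hi⟩)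
      simpa using this
    · rintro ⟨h2, h3⟩
      refine Finset.mem_image.2 ⟨fun i => rowTab t i, Fintype.mem_piFinset.2 fun i => ?_,
        seqTab_rowTab h3⟩
      rw [hD]
      simpa using h2 i i.2

/-- Products over an initial segment of `ℕ`: a sequence of witnesses is stored in the rows of one
table. -/
theorem Sharp.prod {F : γ × ℕ → ℕ} (hF : Sharp F) {m : γ → ℕ} (hm : PT m) (hb : PolyBdd m) :
    Sharp fun c => ∏ i ∈ Finset.range (m c), F (c, i) := by
  classical
  obtain ⟨D, hD, hF⟩ := hF
  refine ⟨_, hD.pi hm hb, fun c => ?_⟩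
  rw [Finset.card_image_of_injective _ (seqTab_injective _), Fintype.card_piFinset]
  simp only [hF, Finset.prod_range]

/-- A pair of tables as a table. -/
def pairTab (t s : ℕ → ℕ) : ℕ → ℕ :=
  joinTab fun i => if i = 0 then t else if i = 1 then s else 0

theorem rowTab_pairTab_zero (t s : ℕ → ℕ) : rowTab (pairTab t s) 0 = t := by simp [pairTab]

theorem rowTab_pairTab_one (t s : ℕ → ℕ) : rowTab (pairTab t s) 1 = s := by simp [pairTab]

theorem rowTab_pairTab_of_le (t s : ℕ → ℕ) {i : ℕ} (hi : 2 ≤ i) : rowTab (pairTab t s) i = 0 := by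
  simp [pairTab, show i ≠ 0 by omega, show i ≠ 1 by omega]

theorem pairTab_rowTab {r : ℕ → ℕ} (h : ∀ i, 2 ≤ i → rowTab r i = 0) :
    pairTab (rowTab r 0) (rowTab r 1) = r := by
  rw [← joinTab_rowTab r, pairTab]
  congr 1
  funext i
  rw [joinTab_rowTab]
  split_ifs with h0 h1
  · rw [h0]
  · rw [h1]
  · rw [h i (by omega)]

open Classical in
/-- Pairs of elements of definable sets. -/
theorem DefSet.sigma {D : γ → Finset (ℕ → ℕ)} (hD : DefSet D) {E : γ × (ℕ → ℕ) → Finset (ℕ → ℕ)}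
    (hE : DefSet E) :
    DefSet fun c => ((D c).sigma fun t => E (c, t)).image fun x => pairTab x.1 x.2 := by
  obtain ⟨e₁, Q, hQ, hD⟩ := hD
  obtain ⟨e₂, R, hR, hE⟩ := hE
  have hbd : PolyBdd fun c : γ => (((siz c + 2) ^ e₁ + (siz c + 2) ^ e₂ + 2) + 1) ^ 2 :=
    (((((PolyBdd.siz.add (.const 2)).pow e₁).add ((PolyBdd.siz.add (.const 2)).pow e₂)).add
      (.const 2)).add (.const 1)).pow 2
  refine DefSet.intro hbd (fun c t ht => ?_)
    (fun e' p => ((∀ j < (siz p.1 + 2) ^ e', ev (rowTab p.2 0) j ≤ (siz p.1 + 2) ^ e₁ ∧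
          ((siz p.1 + 2) ^ e₁ ≤ j → ev (rowTab p.2 0) j = 0)) ∧ Q (p.1, rowTab p.2 0)) ∧
      ((∀ j < (siz p.1 + 2) ^ e', ev (rowTab p.2 1) j ≤ (siz p.1 + 2) ^ e₂ ∧
          ((siz p.1 + 2) ^ e₂ ≤ j → ev (rowTab p.2 1) j = 0)) ∧
        R ((p.1, rowTab p.2 0), rowTab p.2 1)) ∧
      ∀ i < (siz p.1 + 2) ^ e', 2 ≤ i → ∀ j < (siz p.1 + 2) ^ e', ev (rowTab p.2 i) j = 0)
    (fun e' => by fun_prop) fun e' c t he' ht => ?_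
  · obtain ⟨⟨t, s⟩, hs, rfl⟩ := Finset.mem_image.1 ht
    obtain ⟨h1, h2⟩ := Finset.mem_sigma.1 hs
    have h1 := ((hD _ _).1 h1).1
    have h2 := ((hE _ _).1 h2).1
    simp only [siz_prod, siz_tab, add_zero] at h2
    refine joinTab_mem_tables (fun i => ?_) fun i hi => ?_
    · split_ifs with h
      · exact tables_mono (by omega) h1
      · exact tables_mono (by omega) h2
      · exact ⟨fun _ => Nat.zero_le _, fun _ _ => rfl⟩
    · rw [if_neg (by omega), if_neg (by omega)]
  · have hrow := rowTab_mem_tables ht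
    simp only [ev]
    have h1 : (∀ i < (siz c + 2) ^ e', 2 ≤ i → ∀ j < (siz c + 2) ^ e', rowTab t i j = 0) ↔
        ∀ i, 2 ≤ i → rowTab t i = 0 := by
      constructor
      · intro h i hi
        rcases lt_or_ge i ((siz c + 2) ^ e') with h' | h'
        · exact (tables_eq_zero_iff (hrow i)).1 (h i h' hi)
        · exact rowTab_eq_zero ht h'
      · intro h i _ hi j _
        rw [h i hi]
        rfl
    have h2 := hD c (rowTab t 0)
    have h3 := hE (c, rowTab t 0) (rowTab t 1)
    simp only [siz_prod, siz_tab, add_zero] at h3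
    simp only [h1, tables_of_forall_lt (hrow _), ← h2, ← h3]
    constructor
    · intro h
      obtain ⟨⟨x, s⟩, hs, rfl⟩ := Finset.mem_image.1 h
      obtain ⟨h4, h5⟩ := Finset.mem_sigma.1 hs
      simp only [rowTab_pairTab_zero, rowTab_pairTab_one]
      exact ⟨h4, h5, fun i hi => rowTab_pairTab_of_le _ _ hi⟩
    · rintro ⟨h4, h5, h6⟩
      exact Finset.mem_image.2 ⟨⟨rowTab t 0, rowTab t 1⟩, Finset.mem_sigma.2 ⟨h4, h5⟩,
        pairTab_rowTab h6⟩

/-- Summation over a definable family of sets. -/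
theorem Sharp.sum {D : γ → Finset (ℕ → ℕ)} (hD : DefSet D) {F : γ × (ℕ → ℕ) → ℕ}
    (hF : Sharp F) : Sharp fun c => ∑ t ∈ D c, F (c, t) := by
  classical
  obtain ⟨E, hE, hF⟩ := hF
  refine ⟨_, hD.sigma hE, fun c => ?_⟩
  rw [Finset.card_image_of_injective, Finset.card_sigma]
  · simp only [hF]
  · rintro ⟨t, s⟩ ⟨t', s'⟩ h
    have h0 := congrArg (fun r => rowTab r 0) h
    have h1 := congrArg (fun r => rowTab r 1) h
    simp only [rowTab_pairTab_zero, rowTab_pairTab_one] at h0 h1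
    rw [h0, h1]

theorem Sharp.mul {F G : γ → ℕ} (hF : Sharp F) (hG : Sharp G) : Sharp fun c => F c * G c := by
  obtain ⟨D, hD, hF⟩ := hF
  have := Sharp.sum hD (F := fun p => G p.1) (hG.comp PT.fst (PolyBdd.siz.mono fun c => by simp))
  refine this.congr fun c => ?_
  simp [hF]

theorem DefSet.filter {D : γ → Finset (ℕ → ℕ)} (hD : DefSet D) {P : γ × (ℕ → ℕ) → Prop}
    (hP : PTP P) [∀ c, DecidablePred fun t => P (c, t)] :
    DefSet fun c => (D c).filter fun t => P (c, t) := by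
  obtain ⟨e, Q, hQ, hD⟩ := hD
  exact ⟨e, fun p => Q p ∧ P p, hQ.and hP, fun c t => by
    rw [Finset.mem_filter, hD, and_assoc]⟩

/-- Summation over an initial segment of `ℕ`. -/
theorem Sharp.sum_range {F : γ × ℕ → ℕ} (hF : Sharp F) {m : γ → ℕ} (hm : PT m)
    (hb : PolyBdd m) : Sharp fun c => ∑ i ∈ Finset.range (m c), F (c, i) := by
  classical
  have hD : DefSet fun c => (Finset.range (m c)).image fun i => (Pi.single 0 i : ℕ → ℕ) := by
    refine DefSet.intro (L := fun c => m c + 1) (hb.add (.const 1)) (fun c t ht => ?_)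
      (fun e p => ev p.2 0 < m p.1 ∧ ∀ j < (siz p.1 + 2) ^ e, 1 ≤ j → ev p.2 j = 0)
      (fun e => by fun_prop) fun e c t he ht => ?_
    · obtain ⟨i, hi, rfl⟩ := Finset.mem_image.1 ht
      have := Finset.mem_range.1 hi
      refine ⟨fun j => ?_, fun j hj => ?_⟩
      · rw [Pi.single_apply]
        split_ifs <;> omega
      · rw [Pi.single_apply, if_neg (by omega)]
    · simp only [ev, Finset.mem_image, Finset.mem_range]
      constructor
      · rintro ⟨i, hi, rfl⟩
        exact ⟨by simpa using hi, fun j _ hj => by rw [Pi.single_apply, if_neg (by omega)]⟩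
      · rintro ⟨h0, h1⟩
        refine ⟨_, h0, ?_⟩
        funext j
        rcases Nat.eq_zero_or_pos j with rfl | hj
        · simp
        · rw [Pi.single_apply, if_neg (by omega)]
          rcases lt_or_ge j ((siz c + 2) ^ e) with h' | h'
          · exact (h1 j h' hj).symm
          · exact (ht.2 j h').symm
  have hF' := hF.comp_of (δ := γ × (ℕ → ℕ)) (φ := fun p => (p.1, ev p.2 0))
    (P := fun p => ev p.2 0 < m p.1) (by fun_prop) (by fun_prop)
    (L := fun p => siz p + m p.1) (PolyBdd.siz.add (by
      obtain ⟨e, he⟩ := hb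
      exact ⟨e, fun p => by simpa using he p.1⟩)) (fun p hp => by
        simp only [siz_prod, siz_nat, siz_tab]
        omega)
  refine (Sharp.sum hD hF').congr fun c => ?_
  rw [Finset.sum_image fun i _ j _ h => Pi.single_injective 0 h]
  refine Finset.sum_congr rfl fun i hi => ?_
  have := Finset.mem_range.1 hi
  simp [ev, this]

end

/-! ### From counting tables to `#P` -/

section

open Ctx CounterProgram

/-- The word `1^{k₁} 0 1^{k₂} 0 ⋯` for a list `k₁, k₂, …`. -/
def unaryWord (l : List ℕ) : List Bool := l.flatMap fun k => List.replicate k true ++ [false]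

theorem unaryWord_cons (k : ℕ) (l : List ℕ) :
    unaryWord (k :: l) = List.replicate k true ++ false :: unaryWord l := by
  simp [unaryWord]

/-- A word as a table of its letters. -/
def bitTab (u : List Bool) (i : ℕ) : ℕ := if u[i]? = some true then 1 else 0

/-- The number of zeros among the first `n` entries of a `0`-`1` table. -/
def zeroCount (b : ℕ → ℕ) (n : ℕ) : ℕ := ∑ k ∈ Finset.range n, (1 - ev b k)

/-- The length of the `i`-th run of ones (the runs are separated by single zeros) in the first `n`
entries of a `0`-`1` table. -/
def runTab (b : ℕ → ℕ) (n i : ℕ) : ℕ :=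
  ∑ k ∈ Finset.range n, if zeroCount b k = i then ev b k else 0

section

variable {γ : Type} [Ctx γ]

@[fun_prop] theorem PT.zeroCount {f : γ → ℕ → ℕ} {g : γ → ℕ} (hf : PT f) (hg : PT g) :
    PT fun c => zeroCount (f c) (g c) := by
  unfold _root_.zeroCount
  fun_prop

@[fun_prop] theorem PT.runTab {f : γ → ℕ → ℕ} {g : γ → ℕ} (hf : PT f) (hg : PT g) :
    PT fun c => runTab (f c) (g c) := by
  have : PT fun c i => ∑ k ∈ Finset.range (g c),
    if _root_.zeroCount (f c) k = i then _root_.ev (f c) k else 0 := by fun_prop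
  exact this

end

theorem bitTab_cons_succ (a : Bool) (u : List Bool) (i : ℕ) :
    bitTab (a :: u) (i + 1) = bitTab u i := by simp [bitTab]

theorem zeroCount_cons (a : Bool) (u : List Bool) (n : ℕ) :
    zeroCount (bitTab (a :: u)) (n + 1) = zeroCount (bitTab u) n + if a then 0 else 1 := by
  rw [zeroCount, Finset.sum_range_succ']
  simp only [ev, bitTab_cons_succ, zeroCount]
  congr 1
  cases a <;> simp [bitTab]

theorem runTab_true_cons (u : List Bool) (n i : ℕ) :
    runTab (bitTab (true :: u)) (n + 1) i
      = runTab (bitTab u) n i + if i = 0 then 1 else 0 := by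
  rw [runTab, Finset.sum_range_succ']
  simp only [ev, bitTab_cons_succ, zeroCount_cons, runTab]
  congr 1
  simp [bitTab, zeroCount, eq_comm]

theorem runTab_false_cons_zero (u : List Bool) (n : ℕ) :
    runTab (bitTab (false :: u)) (n + 1) 0 = 0 := by
  rw [runTab, Finset.sum_range_succ']
  simp [ev, zeroCount_cons, bitTab]

theorem runTab_false_cons_succ (u : List Bool) (n i : ℕ) :
    runTab (bitTab (false :: u)) (n + 1) (i + 1) = runTab (bitTab u) n i := by
  rw [runTab, Finset.sum_range_succ']
  simp only [ev, bitTab_cons_succ, zeroCount_cons, runTab]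
  simp [bitTab, zeroCount]
  congr!

theorem zeroCount_unaryWord : ∀ l : List ℕ,
    zeroCount (bitTab (unaryWord l)) (unaryWord l).length = l.length
  | [] => rfl
  | 0 :: l => by
    have := zeroCount_unaryWord l
    rw [unaryWord_cons]
    simp [zeroCount_cons, this]
  | (k + 1) :: l => by
    have := zeroCount_unaryWord (k :: l)
    rw [unaryWord_cons] at this ⊢
    simpa [zeroCount_cons, List.replicate_succ] using this

theorem runTab_unaryWord : ∀ (l : List ℕ) (i : ℕ),
    runTab (bitTab (unaryWord l)) (unaryWord l).length i = l.getD i 0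
  | [], i => rfl
  | 0 :: l, i => by
    have := runTab_unaryWord l
    rw [unaryWord_cons]
    cases i with
    | zero => simpa using runTab_false_cons_zero (unaryWord l) _
    | succ i => simpa [runTab_false_cons_succ] using this i
  | (k + 1) :: l, i => by
    have := runTab_unaryWord (k :: l) i
    rw [unaryWord_cons] at this ⊢
    simp only [List.replicate_succ, List.cons_append, List.length_cons, runTab_true_cons, this]
    cases i <;> simp

/-- The words `1^{k₁} 0 1^{k₂} 0 ⋯` are those that do not end in a `1`. -/
theorem exists_unaryWord : ∀ u : List Bool,
    (∀ k < u.length, k + 1 = u.length → bitTab u k = 0) → ∃ l, unaryWord l = u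
  | [], _ => ⟨[], rfl⟩
  | a :: u, h => by
    obtain ⟨l, hl⟩ := exists_unaryWord u fun k hk hk' => by
      have := h (k + 1) (by simpa using hk) (by simpa using hk')
      rwa [bitTab_cons_succ] at this
    cases a with
    | false => exact ⟨0 :: l, by simp [unaryWord_cons, hl]⟩
    | true =>
      cases l with
      | nil =>
        subst hl
        have := h 0 (by simp) (by simp [unaryWord])
        simp [bitTab] at this
      | cons k l =>
        refine ⟨(k + 1) :: l, ?_⟩
        rw [unaryWord_cons] at hl ⊢
        simp [← hl, List.replicate_succ]

theorem bitTab_unaryWord_last (l : List ℕ) (k : ℕ) (hk : k + 1 = (unaryWord l).length) :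
    bitTab (unaryWord l) k = 0 := by
  rcases List.eq_nil_or_concat' l with rfl | ⟨l, a, rfl⟩
  · simp [unaryWord] at hk
  · have h : unaryWord (l ++ [a]) = (unaryWord l ++ List.replicate a true) ++ [false] := by
      simp [unaryWord]
    rw [h] at hk ⊢
    have : k = (unaryWord l ++ List.replicate a true).length := by
      simp at hk ⊢
      omega
    subst this
    simp [bitTab]

theorem length_unaryWord_le {L : ℕ} : ∀ l : List ℕ, (∀ k ∈ l, k ≤ L) →
    (unaryWord l).length ≤ l.length * (L + 1)
  | [], _ => by simp [unaryWord]
  | k :: l, h => by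
    have h1 := length_unaryWord_le l fun k hk => h k (by simp [hk])
    have h2 := h k (by simp)
    rw [unaryWord_cons]
    simp only [List.length_append, List.length_replicate, List.length_cons, Nat.succ_mul]
    omega

/-- The word that encodes a table. -/
def tabWord (L : ℕ) (t : ℕ → ℕ) : List Bool := unaryWord ((List.range L).map t)

theorem runTab_tabWord {L : ℕ} {t : ℕ → ℕ} (ht : t ∈ Tables L) :
    runTab (bitTab (tabWord L t)) (tabWord L t).length = t := by
  funext i
  rw [tabWord, runTab_unaryWord]
  rcases lt_or_ge i L with hi | hi
  · simp [hi]
  · rw [List.getD_eq_default _ _ (by simpa using hi), ht.2 i hi]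

/-- A word encodes a table in a given set if and only if it satisfies these conditions. -/
theorem exists_tabWord_iff (L : ℕ) (Q : (ℕ → ℕ) → Prop) (u : List Bool) :
    (∃ t, (t ∈ Tables L ∧ Q t) ∧ tabWord L t = u) ↔
      (∀ k < u.length, k + 1 = u.length → bitTab u k = 0) ∧
      zeroCount (bitTab u) u.length = L ∧ (∀ i < L, runTab (bitTab u) u.length i ≤ L) ∧
      Q (runTab (bitTab u) u.length) := by
  constructor
  · rintro ⟨t, ⟨ht, hQ⟩, rfl⟩
    refine ⟨fun k _ hk => bitTab_unaryWord_last _ k hk, ?_, fun i _ => ?_, ?_⟩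
    · rw [tabWord, zeroCount_unaryWord]
      simp
    · rw [runTab_tabWord ht]
      exact ht.1 i
    · rwa [runTab_tabWord ht]
  · rintro ⟨h1, h2, h3, h4⟩
    obtain ⟨l, rfl⟩ := exists_unaryWord u h1
    rw [zeroCount_unaryWord] at h2
    subst h2
    refine ⟨_, ⟨⟨fun i => ?_, fun i hi => ?_⟩, h4⟩, ?_⟩
    · rcases lt_or_ge i l.length with hi | hi
      · exact h3 i hi
      · rw [runTab_unaryWord, List.getD_eq_default _ _ hi]
        exact Nat.zero_le _
    · rw [runTab_unaryWord, List.getD_eq_default _ _ hi]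
    · rw [tabWord]
      congr 1
      apply List.ext_getElem
      · simp
      · intro i hi hi'
        simp [runTab_unaryWord, hi']

instance : Ctx (Letter → ℕ → ℕ) where
  TabIdx := Letter
  NumIdx := Empty
  tab X := X
  num _ n := n.elim
  siz _ := 0
  expressible_siz := ⟨_, .sub .one .one, fun _ => rfl⟩

theorem PT.letter (a : Letter) : PT fun X : Letter → ℕ → ℕ => X a :=
  ⟨fun n => n.elim, fun _ => ⟨_, .read (Sum.inl a) (.var (Sum.inr ())), fun _ => rfl⟩⟩

/-- A predicate of the letter tables and the length of the input that is given by an expression is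
decidable in polynomial time. -/
theorem PTP.polyTimeDecidable {P : (Letter → ℕ → ℕ) × ℕ → Prop} (hP : PTP P)
    (B : List Bool × List Bool → Bool)
    (hB : ∀ w u, P (letterTable (w.map .inl ++ u.map .inr), w.length + u.length) ↔
      B (w, u) = true) : Complexity.PolyTimeDecidable B := by
  obtain ⟨f, hf, h⟩ := hP
  have hf' : PT fun c => 1 - (1 - f c) := by fun_prop
  obtain ⟨F, hF, hfF⟩ := pt_nat_iff.1 hf'
  refine polyTimeDecidable_of_expressible
    (hF.rename (Sum.elim id Empty.elim) (Sum.elim Empty.elim id)) B fun w u => ?_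
  have h1 := hfF (letterTable (w.map .inl ++ u.map .inr), w.length + u.length)
  have h2 := h (letterTable (w.map .inl ++ u.map .inr), w.length + u.length)
  rw [hB] at h2
  refine Eq.trans ?_ (h1.symm.trans ?_)
  · congr 1
    · funext j
      rcases j with j | j
      · rfl
      · exact j.elim
    · funext j
      rcases j with j | j
      · exact j.elim
      · rfl
  · beta_reduce
    cases hb : B (w, u) with
    | true =>
      have := h2.1 hb
      simp only [Bool.toNat_true]
      omega
    | false =>
      have : f (letterTable (w.map .inl ++ u.map .inr), w.length + u.length) = 0 := by
        by_contra h0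
        simp [h2.2 h0] at hb
      simp [this]

theorem sum_letterTable_inl (w u : List Bool) :
    ∑ i ∈ Finset.range (w.length + u.length),
      (letterTable (w.map .inl ++ u.map .inr) (.inl false) i
        + letterTable (w.map .inl ++ u.map .inr) (.inl true) i) = w.length := by
  rw [Finset.sum_range_add]
  have h1 : ∀ i ∈ Finset.range w.length,
      letterTable (w.map .inl ++ u.map .inr) (.inl false) i
        + letterTable (w.map .inl ++ u.map .inr) (.inl true) i = 1 := by
    intro i hi
    have hi := Finset.mem_range.1 hi
    simp only [letterTable]
    rw [List.getElem?_append_left (by simpa using hi)]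
    cases h : w[i] <;> simp [hi, h]
  have h2 : ∀ i ∈ Finset.range u.length,
      letterTable (w.map .inl ++ u.map .inr) (.inl false) (w.length + i)
        + letterTable (w.map .inl ++ u.map .inr) (.inl true) (w.length + i) = 0 := by
    intro i hi
    simp only [letterTable]
    rw [List.getElem?_append_right (by simp)]
    simp
  rw [Finset.sum_congr rfl h1, Finset.sum_congr rfl h2]
  simp

theorem letterTable_inl_true (w u : List Bool) :
    letterTable (w.map .inl ++ u.map .inr) (.inl true) = bitTab w := by
  funext i
  simp only [letterTable, bitTab]
  congr 1
  rcases lt_or_ge i w.length with hi | hi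
  · rw [List.getElem?_append_left (by simpa using hi)]
    simp
  · rw [List.getElem?_append_right (by simpa using hi), List.getElem?_eq_none hi]
    simp

theorem letterTable_inr_true (w u : List Bool) :
    (fun i => letterTable (w.map .inl ++ u.map .inr) (.inr true) (i + w.length)) = bitTab u := by
  funext i
  simp only [letterTable, bitTab]
  congr 1
  rw [List.getElem?_append_right (by simp)]
  simp

/-- Counting definable tables over the tables of the letters of the input gives functions
in `#P`: the verifier checks that the witness encodes a table of the set. -/
theorem Sharp.mem_sharpP {F : (ℕ → ℕ) × ℕ → ℕ} (hF : Sharp F) :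
    (fun w => F (bitTab w, w.length)) ∈ Complexity.SharpP := by
  classical
  obtain ⟨D, ⟨e, Q, hQ, hD⟩, hF⟩ := hF
  let L : ℕ → ℕ := fun n => (n + 2) ^ e
  refine ⟨fun p => decide (∃ t ∈ D (bitTab p.1, p.1.length), tabWord (L p.1.length) t = p.2),
    (Polynomial.X + 2) ^ e * ((Polynomial.X + 2) ^ e + 1), ?_, fun w => ?_⟩
  · let lenW : (Letter → ℕ → ℕ) × ℕ → ℕ := fun c => ∑ i ∈ Finset.range c.2,
      (ev (c.1 (.inl false)) i + ev (c.1 (.inl true)) i)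
    let wTab : (Letter → ℕ → ℕ) × ℕ → ℕ → ℕ := fun c => c.1 (.inl true)
    let uTab : (Letter → ℕ → ℕ) × ℕ → ℕ → ℕ := fun c i => ev (c.1 (.inr true)) (i + lenW c)
    have hl : ∀ a, PT fun c : (Letter → ℕ → ℕ) × ℕ => c.1 a := fun a =>
      (PT.letter a).comp PT.fst
    have hl' : ∀ a, PT fun c : ((Letter → ℕ → ℕ) × ℕ) × ℕ => c.1.1 a := fun a =>
      (hl a).comp PT.fst
    have hlen : PT lenW := PT.sum PT.snd (((hl' _).ev PT.snd).add ((hl' _).ev PT.snd))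
    have hw : PT wTab := hl _
    have hu : PT uTab := PT.table ((hl' _).ev (PT.snd.add (hlen.comp PT.fst)))
    refine PTP.polyTimeDecidable (P := fun c =>
      (∀ k < c.2 - lenW c, k + 1 = c.2 - lenW c → ev (uTab c) k = 0) ∧
      zeroCount (uTab c) (c.2 - lenW c) = (lenW c + 2) ^ e ∧
      (∀ i < (lenW c + 2) ^ e, ev (runTab (uTab c) (c.2 - lenW c)) i ≤ (lenW c + 2) ^ e) ∧
      Q ((wTab c, lenW c), runTab (uTab c) (c.2 - lenW c))) (by fun_prop) _ fun w u => ?_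
    have e1 : lenW (letterTable (w.map .inl ++ u.map .inr), w.length + u.length) = w.length :=
      sum_letterTable_inl w u
    have e2 : wTab (letterTable (w.map .inl ++ u.map .inr), w.length + u.length) = bitTab w :=
      letterTable_inl_true w u
    have e3 : uTab (letterTable (w.map .inl ++ u.map .inr), w.length + u.length) = bitTab u := by
      simp only [uTab, e1]
      exact letterTable_inr_true w u
    simp only [e1, e2, e3, add_tsub_cancel_left, decide_eq_true_eq, hD, siz_prod, siz_nat,
      siz_tab, zero_add, ev]
    exact (exists_tabWord_iff (L w.length) (fun t => Q ((bitTab w, w.length), t)) u).symm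
  · have hmem : ∀ t ∈ D (bitTab w, w.length), t ∈ Tables (L w.length) := fun t ht => by
      simpa using ((hD _ _).1 ht).1
    have hset : {u : List Bool | u.length ≤ Polynomial.eval w.length
        ((Polynomial.X + 2) ^ e * ((Polynomial.X + 2) ^ e + 1)) ∧
        decide (∃ t ∈ D (bitTab w, w.length), tabWord (L w.length) t = u) = true}
        = ((D (bitTab w, w.length)).image (tabWord (L w.length)) : Finset (List Bool)) := by
      ext u
      simp only [decide_eq_true_eq, Set.mem_ofPred_eq, Finset.coe_image, Set.mem_image,
        Finset.mem_coe, and_iff_right_iff_imp]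
      rintro ⟨t, ht, rfl⟩
      refine (length_unaryWord_le (L := L w.length) _ ?_).trans ?_
      · intro k hk
        obtain ⟨i, _, rfl⟩ := List.mem_map.1 hk
        exact (hmem t ht).1 i
      · simp [L]
    rw [hset, Set.ncard_coe_finset, Finset.card_image_of_injOn]
    · exact hF _
    intro t ht t' ht' h
    rw [← runTab_tabWord (hmem t ht), h, runTab_tabWord (hmem t' ht')]

end

/-! ### Coefficients of symmetric functions -/

section

open MvPolynomial

namespace SymFunc

theorem coeff_dropLast {n : ℕ} (p : MvPolynomial (Fin (n + 1)) ℂ) (β : Fin n →₀ ℕ) :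
    coeff β (dropLast n p) = coeff (β.mapDomain Fin.castSucc) p := by
  induction p using MvPolynomial.induction_on' with
  | add p q hp hq => rw [map_add, coeff_add, coeff_add, hp, hq]
  | monomial s a =>
    have hs : s = β.mapDomain Fin.castSucc ↔
        (∀ i, s (Fin.castSucc i) = β i) ∧ s (Fin.last n) = 0 := by
      rw [Finsupp.ext_iff, Fin.forall_fin_succ']
      refine and_congr (forall_congr' fun i => ?_) ?_
      · rw [Finsupp.mapDomain_apply (Fin.castSucc_injective n)]
      · rw [Finsupp.mapDomain_of_notMem_range]
        rintro ⟨i, hi⟩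
        exact (Fin.castSucc_lt_last i).ne hi
    rw [dropLast, aeval_monomial, Finsupp.prod_fintype _ _ (by simp), Fin.prod_univ_castSucc,
      coeff_monomial]
    simp only [Fin.snoc_castSucc, Fin.snoc_last, algebraMap_eq]
    rcases Nat.eq_zero_or_pos (s (Fin.last n)) with h | h
    · rw [h, pow_zero, mul_one]
      have hm : C a * ∏ i, X i ^ s (Fin.castSucc i)
          = monomial (Finsupp.equivFunOnFinite.symm fun i => s (Fin.castSucc i)) a := by
        rw [monomial_eq, Finsupp.prod_fintype _ _ (by simp)]
        rfl
      rw [hm, coeff_monomial]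
      congr 1
      rw [hs, Finsupp.ext_iff]
      simp [h]
    · rw [zero_pow h.ne', mul_zero, mul_zero, coeff_zero, if_neg]
      rw [hs]
      omega

/-- The coefficients of a symmetric function do not depend on the number of variables nor on their
order. -/
theorem coeff_mapDomain (F : SymFunc) {l M : ℕ} {j : Fin l → Fin M} (hj : Function.Injective j)
    (β : Fin l →₀ ℕ) : coeff (β.mapDomain j) (F.1 M) = coeff β (F.1 l) := by
  have h1 : ∀ d, coeff (β.mapDomain (Fin.castAdd d)) (F.1 (l + d)) = coeff β (F.1 l) := by
    intro d
    induction d with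
    | zero =>
      have : (Fin.castAdd 0 : Fin l → Fin (l + 0)) = id := rfl
      rw [this, Finsupp.mapDomain_id]
      rfl
    | succ d ih =>
      have : (Fin.castAdd (d + 1) : Fin l → Fin (l + (d + 1))) = Fin.castSucc ∘ Fin.castAdd d := rfl
      rw [this, Finsupp.mapDomain_comp, ← ih, ← F.2.2.1 (l + d), coeff_dropLast]
      rfl
  have hle : l ≤ M := by simpa using Fintype.card_le_of_injective j hj
  obtain ⟨d, rfl⟩ := Nat.exists_eq_add_of_le hle
  obtain ⟨σ, hσ⟩ := Equiv.Perm.exists_extending_pair (Fin.castAdd d) j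
    (Fin.castAdd_injective l d) hj
  have : j = σ ∘ Fin.castAdd d := funext fun i => (hσ i).symm
  rw [← h1 d, this, Finsupp.mapDomain_comp]
  conv_lhs => rw [← F.2.1 (l + d) σ]
  rw [coeff_rename_mapDomain _ σ.injective]

end SymFunc

/-- The multiset of nonzero exponents. -/
def expParts {ι : Type} (β : ι →₀ ℕ) : Multiset ℕ := β.support.val.map β

/-- A table as an exponent vector in `n` variables. -/
noncomputable def tabExp (α : ℕ → ℕ) (n : ℕ) : Fin n →₀ ℕ :=
  Finsupp.equivFunOnFinite.symm fun i => α i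

@[simp] theorem tabExp_apply (α : ℕ → ℕ) (n : ℕ) (i : Fin n) : tabExp α n i = α i := rfl

namespace IntPartition

/-- The parts of a partition as a table. -/
def rowTab (lam : IntPartition) (i : ℕ) : ℕ := lam.rows.getD i 0

theorem coe_rows (lam : IntPartition) : (lam.rows : Multiset ℕ) = lam.2.parts :=
  Multiset.sort_eq _ _

theorem length_rows (lam : IntPartition) : lam.rows.length = lam.2.parts.card := by
  rw [← coe_rows, Multiset.coe_card]

theorem length_rows_le (lam : IntPartition) : lam.rows.length ≤ lam.1 := by
  rw [length_rows]
  conv_rhs => rw [← lam.2.parts_sum]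
  simpa using Multiset.card_nsmul_le_sum (a := 1) fun k hk => lam.2.parts_pos hk

theorem rowTab_pos_iff (lam : IntPartition) (i : ℕ) : 0 < lam.rowTab i ↔ i < lam.rows.length := by
  rw [rowTab]
  rcases lt_or_ge i lam.rows.length with h | h
  · rw [List.getD_eq_getElem _ _ h]
    exact ⟨fun _ => h, fun _ => lam.rows_pos _ (List.getElem_mem h)⟩
  · rw [List.getD_eq_default _ _ h]
    omega

theorem rowTab_eq_zero (lam : IntPartition) {i : ℕ} (h : lam.rows.length ≤ i) :
    lam.rowTab i = 0 := List.getD_eq_default _ _ h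

end IntPartition

theorem expParts_eq_filter {n : ℕ} (β : Fin n →₀ ℕ) :
    expParts β = (Finset.univ.val.map β).filter (· ≠ 0) := by
  rw [expParts, Multiset.filter_map]
  congr 1
  rw [show β.support = Finset.univ.filter fun i => β i ≠ 0 by ext; simp]
  rfl

theorem expParts_tabExp (α : ℕ → ℕ) (n : ℕ) :
    expParts (tabExp α n) = ((Multiset.range n).map α).filter (· ≠ 0) := by
  rw [expParts_eq_filter]
  congr 1
  have : (Finset.univ : Finset (Fin n)).val.map (fun i : Fin n => i.val) = Multiset.range n := by
    have := congrArg Finset.val (Fin.map_valEmbedding_univ (n := n))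
    rwa [Nat.Iio_eq_range] at this
  rw [← this, Multiset.map_map]
  rfl

theorem expParts_rowTab (lam : IntPartition) {n : ℕ} (h : lam.rows.length ≤ n) :
    expParts (tabExp lam.rowTab n) = lam.2.parts := by
  have h1 : (List.range n).map lam.rowTab
      = lam.rows ++ List.replicate (n - lam.rows.length) 0 := by
    apply List.ext_getElem
    · simp [h]
    · intro i hi hi'
      rcases lt_or_ge i lam.rows.length with h' | h'
      · simp [List.getElem_append_left h', IntPartition.rowTab, h']
      · simp [List.getElem_append_right h', lam.rowTab_eq_zero h']
  rw [expParts_tabExp]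
  change Multiset.filter _ (((List.range n).map lam.rowTab : List ℕ) : Multiset ℕ) = _
  rw [h1, Multiset.filter_coe, List.filter_append, List.filter_eq_self.2, List.filter_eq_nil_iff.2,
    List.append_nil, lam.coe_rows]
  · simp
  · intro k hk
    simpa using (lam.rows_pos k hk).ne'

/-- An exponent vector whose nonzero exponents are listed by `L` is the vector `L`, moved along an
injection of the variables. -/
theorem exists_mapDomain {ι : Type} (β : ι →₀ ℕ) (L : List ℕ) (h : expParts β = L) :
    ∃ j : Fin L.length → ι, Function.Injective j ∧
      β = (tabExp (fun i => L.getD i 0) L.length).mapDomain j := by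
  classical
  have h1 : L.Perm (β.support.toList.map β) := by
    rw [← Multiset.coe_eq_coe, ← h, expParts, ← Multiset.map_coe]
    simp
  have h2 : List.Forall₂ (fun k x => k = β x) (β.support.toList.map β) β.support.toList := by
    rw [List.forall₂_map_left_iff]
    simp
  obtain ⟨l', hl', hp⟩ := List.perm_comp_forall₂ h1 h2
  have hlen := hl'.length_eq
  have hget : ∀ i (hi : i < L.length), L[i] = β (l'[i]'(hlen ▸ hi)) := fun i hi =>
    hl'.get hi (hlen ▸ hi)
  have hnd : l'.Nodup := hp.nodup_iff.2 β.support.nodup_toList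
  have hinj : Function.Injective fun i : Fin L.length => l'[i.1]'(hlen ▸ i.2) := by
    intro a b hab
    exact Fin.ext ((hnd.getElem_inj_iff).1 hab)
  refine ⟨_, hinj, ?_⟩
  ext x
  by_cases hx : ∃ i : Fin L.length, l'[i.1]'(hlen ▸ i.2) = x
  · obtain ⟨i, rfl⟩ := hx
    rw [Finsupp.mapDomain_apply hinj (a := i)]
    simp [hget i i.2]
  · rw [Finsupp.mapDomain_of_notMem_range _ _ (by rintro ⟨i, hi⟩; exact hx ⟨i, hi⟩)]
    by_contra h0
    have : x ∈ l' := hp.mem_iff.2 (by simpa using h0)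
    obtain ⟨i, hi, rfl⟩ := List.getElem_of_mem this
    exact hx ⟨⟨i, hlen ▸ hi⟩, rfl⟩

namespace SymFunc

/-- The coefficient of `x^lam` in a symmetric function. -/
noncomputable def monoCoeff (F : SymFunc) (lam : IntPartition) : ℂ :=
  coeff (tabExp lam.rowTab lam.rows.length) (F.1 lam.rows.length)

theorem coeff_eq_monoCoeff (F : SymFunc) {n : ℕ} (β : Fin n →₀ ℕ) (lam : IntPartition)
    (h : expParts β = lam.2.parts) : coeff β (F.1 n) = monoCoeff F lam := by
  obtain ⟨j, hj, hβ⟩ := exists_mapDomain β lam.rows (h.trans lam.coe_rows.symm)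
  rw [hβ, coeff_mapDomain F hj]
  rfl

theorem prod_map_X {n : ℕ} (s : Multiset (Fin n)) :
    (s.map X).prod = monomial (Multiset.toFinsupp s) (1 : ℂ) := by
  induction s using Multiset.induction with
  | empty => simp
  | cons a s ih =>
    rw [Multiset.map_cons, Multiset.prod_cons, ih, ← Multiset.singleton_add, map_add,
      Multiset.toFinsupp_singleton, X, monomial_mul, one_mul]

theorem coeff_msymm {m n : ℕ} (mu : m.Partition) (β : Fin n →₀ ℕ) :
    coeff β (msymm (Fin n) ℂ mu) = if expParts β = mu.parts then 1 else 0 := by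
  classical
  have hparts : ∀ s : Sym (Fin n) m, (Nat.Partition.ofSym s).parts
      = expParts (Multiset.toFinsupp s.1) := by
    intro s
    simp only [Nat.Partition.ofSym, expParts, Multiset.toFinsupp_support, Multiset.toFinset_val]
    rfl
  rw [msymm, coeff_sum]
  simp only [Sym.val_eq_coe, prod_map_X, coeff_monomial]
  split_ifs with h
  · have hc : (Finsupp.toMultiset β).card = m := by
      rw [Finsupp.card_toMultiset, ← mu.parts_sum, ← h]
      rfl
    have h0 : Nat.Partition.ofSym (⟨Finsupp.toMultiset β, hc⟩ : Sym (Fin n) m) = mu := by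
      ext1
      refine (hparts _).trans ?_
      simpa using h
    rw [Finset.sum_eq_single ⟨⟨Finsupp.toMultiset β, hc⟩, h0⟩]
    · simp
    · rintro ⟨⟨s, hs⟩, hs'⟩ _ hne
      rw [if_neg]
      rintro rfl
      apply hne
      simp
    · simp
  · refine Finset.sum_eq_zero fun s _ => if_neg ?_
    rintro rfl
    apply h
    exact (hparts s.1).symm.trans (congrArg _ s.2)

theorem coeff_monomialSymm (lam : IntPartition) {n : ℕ} (β : Fin n →₀ ℕ) :
    coeff β ((monomialSymm lam).1 n) = if expParts β = lam.2.parts then 1 else 0 :=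
  coeff_msymm lam.2 β

theorem sum_expParts {ι : Type} [Fintype ι] (β : ι →₀ ℕ) : (expParts β).sum = ∑ i, β i := by
  rw [expParts]
  exact Finset.sum_subset (Finset.subset_univ _) fun i _ hi => Finsupp.notMem_support_iff.1 hi

theorem val_sum {ι : Type} (s : Finset ι) (f : ι → SymFunc) (n : ℕ) :
    (∑ i ∈ s, f i).1 n = ∑ i ∈ s, (f i).1 n := by
  have h1 : (∑ i ∈ s, f i).1 = ∑ i ∈ s, (f i).1 := map_sum SymFunc.subtype f s
  rw [h1, Finset.sum_apply]

/-- Every symmetric function is a combination of monomial symmetric functions. -/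
theorem eq_sum_monomialSymm (F : SymFunc) {D : ℕ} (hD : ∀ n, (F.1 n).totalDegree ≤ D) :
    F = ∑ d ∈ Finset.range (D + 1), ∑ mu : d.Partition,
      monoCoeff F ⟨d, mu⟩ • monomialSymm ⟨d, mu⟩ := by
  ext n β
  let d := (expParts β).sum
  let mu : d.Partition := ⟨expParts β, fun hi => by
    obtain ⟨x, hx, rfl⟩ := Multiset.mem_map.1 hi
    exact Nat.pos_of_ne_zero (Finsupp.mem_support_iff.1 hx), rfl⟩
  have h1 : ∀ (d' : ℕ) (mu' : d'.Partition), coeff β ((monoCoeff F ⟨d', mu'⟩ •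
      monomialSymm ⟨d', mu'⟩ : SymFunc).1 n)
      = if (⟨d', mu'⟩ : IntPartition) = ⟨d, mu⟩ then monoCoeff F ⟨d, mu⟩ else 0 := by
    intro d' mu'
    change coeff β (monoCoeff F ⟨d', mu'⟩ • (monomialSymm ⟨d', mu'⟩).1 n) = _
    rw [coeff_smul, coeff_monomialSymm]
    split_ifs with h h' h'
    · rw [h']; simp
    · exfalso
      apply h'
      have hd : d' = d := by rw [← mu'.parts_sum]; exact congrArg _ h.symm
      subst hd
      congr 1
      exact Nat.Partition.ext h.symm
    · exfalso
      apply h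
      rw [Sigma.mk.injEq] at h'
      obtain ⟨rfl, h'⟩ := h'
      rw [eq_of_heq h']
    · simp
  simp only [val_sum, coeff_sum, h1]
  rw [Finset.sum_sigma', coeff_eq_monoCoeff F β ⟨d, mu⟩ rfl]
  by_cases hd : d < D + 1
  · rw [Finset.sum_eq_single ⟨d, mu⟩]
    · simp
    · rintro x _ hx
      exact if_neg hx
    · intro hx
      simp [hd] at hx
  · rw [Finset.sum_eq_zero]
    · rw [← coeff_eq_monoCoeff F β ⟨d, mu⟩ rfl]
      apply coeff_eq_zero_of_totalDegree_lt
      refine (hD n).trans_lt ?_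
      have : d = ∑ i ∈ β.support, β i := rfl
      omega
    · rintro x hx
      rw [if_neg]
      intro h
      obtain rfl : x = ⟨d, mu⟩ := h
      simp at hx
      omega

end SymFunc

end

/-! ### Power sums generate the symmetric functions -/

section

open MvPolynomial

namespace SymFunc

/-- The augmented monomial symmetric polynomial: the sum of `x_{o 1}^{β 1} ⋯ x_{o l}^{β l}` over all
injections `o`. It is a positive multiple of a monomial symmetric polynomial. -/
noncomputable def augmented (N : ℕ) {l : ℕ} (β : Fin l → ℕ) : MvPolynomial (Fin N) ℂ :=
  ∑ o : Fin l ↪ Fin N, ∏ i, X (o i) ^ β i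

/-- Multiplying an augmented monomial by a power sum adds a new part, or adds to an old part. -/
theorem augmented_succ (N : ℕ) {l : ℕ} (β : Fin (l + 1) → ℕ) :
    augmented N β = psum (Fin N) ℂ (β 0) * augmented N (fun i => β i.succ)
      - ∑ k : Fin l, augmented N (fun i => β i.succ + if i = k then β 0 else 0) := by
  classical
  have h1 : augmented N β = ∑ o : Fin l ↪ Fin N, ∑ x : {x // x ∉ Set.range o},
      X x.1 ^ β 0 * ∏ i, X (o i) ^ β i.succ := by
    rw [augmented, ← Fintype.sum_sigma']
    refine Fintype.sum_equiv (Equiv.embeddingFinSucc l (Fin N)) _ _ fun o => ?_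
    rw [Fin.prod_univ_succ]
    rfl
  have h2 : ∀ o : Fin l ↪ Fin N, ∑ x : {x // x ∉ Set.range o},
      X x.1 ^ β 0 * ∏ i, X (o i) ^ β i.succ
      = psum (Fin N) ℂ (β 0) * ∏ i, X (o i) ^ β i.succ
        - ∑ k : Fin l, ∏ i, X (o i) ^ (β i.succ + if i = k then β 0 else 0) := by
    intro o
    have h3 : ∀ k : Fin l, ∏ i, (X (o i) : MvPolynomial (Fin N) ℂ)
        ^ (β i.succ + if i = k then β 0 else 0)
        = X (o k) ^ β 0 * ∏ i, X (o i) ^ β i.succ := by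
      intro k
      simp only [pow_add, Finset.prod_mul_distrib]
      rw [mul_comm]
      congr 1
      rw [Finset.prod_eq_single k] <;> simp +contextual
    simp only [h3]
    rw [← Finset.sum_mul, ← Finset.sum_mul, ← sub_mul]
    congr 1
    rw [eq_sub_iff_add_eq, psum, ← Fintype.sum_subtype_add_sum_subtype (fun x => x ∈ Set.range o)
      (fun x => (X x : MvPolynomial (Fin N) ℂ) ^ β 0),
      add_comm]
    have h4 : ∑ k, (X (o k) : MvPolynomial (Fin N) ℂ) ^ β 0
        = ∑ x : {x // x ∈ Set.range o}, X x.1 ^ β 0 :=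
      Fintype.sum_equiv (Equiv.ofInjective o o.injective) _ _ fun k => rfl
    rw [h4]
    congr!
  rw [h1, Finset.sum_congr rfl fun o _ => h2 o, Finset.sum_sub_distrib, Finset.sum_comm,
    ← Finset.mul_sum]
  rfl

/-- Augmented monomials are polynomials in the power sums, uniformly in the number of variables. -/
theorem exists_aeval_psum_eq_augmented : ∀ (l : ℕ) (β : Fin l → ℕ), (∀ i, 0 < β i) →
    ∃ P : MvPolynomial ℕ+ ℂ, ∀ N, aeval (fun k : ℕ+ => psum (Fin N) ℂ k) P = augmented N β := by
  intro l
  induction l with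
  | zero => exact fun β _ => ⟨1, fun N => by simp [augmented]⟩
  | succ l ih =>
    intro β hβ
    obtain ⟨P, hP⟩ := ih (fun i => β i.succ) fun i => hβ _
    have h := fun k : Fin l => ih (fun i => β i.succ + if i = k then β 0 else 0)
      fun i => Nat.add_pos_left (hβ _) _
    choose Q hQ using h
    let b : ℕ+ := ⟨β 0, hβ 0⟩
    refine ⟨X b * P - ∑ k, Q k, fun N => ?_⟩
    rw [augmented_succ, map_sub, map_mul, aeval_X, hP, map_sum]
    simp only [hQ]
    rfl

theorem aeval_val (G : ℕ+ → SymFunc) (P : MvPolynomial ℕ+ ℂ) (N : ℕ) :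
    (aeval G P).1 N = aeval (fun k => (G k).1 N) P := by
  have : ((Pi.evalAlgHom ℂ _ N).comp SymFunc.val).comp (aeval G)
      = aeval (fun k => (G k).1 N) := by
    apply MvPolynomial.algHom_ext
    intro k
    simp
  exact DFunLike.congr_fun this P

theorem coeff_augmented (N : ℕ) {l : ℕ} (β : Fin l → ℕ) (γ : Fin N →₀ ℕ) :
    coeff γ (augmented N β) = ((Finset.univ.filter fun o : Fin l ↪ Fin N =>
      (Finsupp.equivFunOnFinite.symm β).mapDomain o = γ).card : ℂ) := by
  classical
  have : ∀ o : Fin l ↪ Fin N, ∏ i, (X (o i) : MvPolynomial (Fin N) ℂ) ^ β i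
      = monomial ((Finsupp.equivFunOnFinite.symm β).mapDomain o) 1 := by
    intro o
    rw [monomial_eq, Finsupp.prod_mapDomain_index (by simp) (by simp [pow_add]),
      Finsupp.prod_fintype _ _ (by simp)]
    simp
  rw [augmented, coeff_sum, Finset.card_filter, Nat.cast_sum]
  refine Finset.sum_congr rfl fun o _ => ?_
  rw [this, coeff_monomial]
  simp

theorem expParts_mapDomain {ι κ : Type} (β : ι →₀ ℕ) {o : ι → κ} (ho : Function.Injective o) :
    expParts (β.mapDomain o) = expParts β := by
  classical
  rw [expParts, Finsupp.mapDomain_support_of_injective ho, Finset.image_val_of_injOn ho.injOn,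
    Multiset.map_map]
  refine Multiset.map_congr rfl fun x _ => ?_
  simp [Finsupp.mapDomain_apply ho]

theorem monomialSymm_mem_range (lam : IntPartition) :
    monomialSymm lam ∈ (aeval (R := ℂ) powerSum).range := by
  obtain ⟨P, hP⟩ := exists_aeval_psum_eq_augmented lam.rows.length (fun i => lam.rowTab i)
    fun i => (lam.rowTab_pos_iff i).2 i.2
  set G := aeval powerSum P with hG
  have hN : ∀ N, G.1 N = augmented N (fun i : Fin lam.rows.length => lam.rowTab i) := fun N => by
    rw [hG, aeval_val, ← hP]
    rfl
  have hc : monoCoeff G lam ≠ 0 := by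
    rw [monoCoeff, hN, coeff_augmented, Nat.cast_ne_zero, ← Nat.pos_iff_ne_zero, Finset.card_pos]
    exact ⟨Function.Embedding.refl _, by
      simp only [Finset.mem_filter_univ]
      exact Finsupp.mapDomain_id⟩
  have h : G = monoCoeff G lam • monomialSymm lam := by
    ext N γ
    change _ = coeff γ (monoCoeff G lam • (monomialSymm lam).1 N)
    rw [coeff_smul, coeff_monomialSymm]
    split_ifs with h
    · rw [coeff_eq_monoCoeff G γ lam h, smul_eq_mul, mul_one]
    · rw [hN, coeff_augmented, smul_zero, Nat.cast_eq_zero, Finset.card_eq_zero,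
        Finset.filter_eq_empty_iff]
      rintro o _ rfl
      apply h
      rw [expParts_mapDomain _ o.injective]
      exact expParts_rowTab lam le_rfl
  have : monomialSymm lam = (monoCoeff G lam)⁻¹ • G := by
    rw [h, smul_smul]
    conv_rhs => rw [← h, inv_mul_cancel₀ hc, one_smul]
  rw [this]
  exact Subalgebra.smul_mem _ ((AlgHom.mem_range _).2 ⟨P, rfl⟩) _

/-- The power sums generate the ring of symmetric functions. -/
theorem exists_aeval_powerSum_eq (F : SymFunc) : ∃ P : MvPolynomial ℕ+ ℂ, aeval powerSum P = F := by
  obtain ⟨D, hD⟩ := F.2.2.2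
  change F ∈ (aeval (R := ℂ) powerSum).range
  rw [eq_sum_monomialSymm F hD]
  exact Subalgebra.sum_mem _ fun d _ => Subalgebra.sum_mem _ fun mu _ =>
    Subalgebra.smul_mem _ (monomialSymm_mem_range _) _

/-! ### Plethysm as substitution of monomials -/

/-- If `g` is a sum of monomials `y₁ + y₂ + ⋯`, then `f[g] = f(y₁, y₂, …)`. -/
theorem plethysm_val (f g : SymFunc) {N M : ℕ} (w : Fin M → Fin N →₀ ℕ)
    (hw : g.1 N = ∑ s, monomial (w s) 1) :
    (plethysm f g).1 N = aeval (fun s => monomial (w s) (1 : ℂ)) (f.1 M) := by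
  have h := exists_aeval_powerSum_eq f
  have hf : f.1 M = aeval (fun k : ℕ+ => psum (Fin M) ℂ k) h.choose := by
    conv_lhs => rw [← h.choose_spec]
    rw [aeval_val]
    rfl
  have hg : ∀ k : ℕ+, (adams k g).1 N
      = aeval (fun s => monomial (w s) (1 : ℂ)) (psum (Fin M) ℂ k) := by
    intro k
    change expand (k : ℕ) (g.1 N) = _
    rw [hw, map_sum, psum, map_sum]
    refine Finset.sum_congr rfl fun s _ => ?_
    rw [expand_monomial, map_pow, aeval_X, monomial_pow, one_pow]
  rw [plethysm, dif_pos h, aeval_val, hf]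
  simp only [hg]
  rw [← AlgHom.comp_apply]
  congr 1
  apply MvPolynomial.algHom_ext
  intro k
  simp

theorem coeff_aeval_monomial {N M : ℕ} (w : Fin M → Fin N →₀ ℕ) (p : MvPolynomial (Fin M) ℂ)
    (γ : Fin N →₀ ℕ) : coeff γ (aeval (fun s => monomial (w s) (1 : ℂ)) p)
      = ∑ β ∈ p.support, if ∑ s, β s • w s = γ then coeff β p else 0 := by
  classical
  conv_lhs => rw [p.as_sum, map_sum, coeff_sum]
  refine Finset.sum_congr rfl fun β _ => ?_
  rw [aeval_monomial, Finsupp.prod_fintype _ _ (by simp)]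
  simp only [monomial_pow, one_pow]
  rw [← monomial_sum_one, algebraMap_eq, coeff_C_mul, coeff_monomial]
  simp

end SymFunc

end

/-! ### Enumerating exponent vectors by their supports -/

section

open MvPolynomial

open Classical in
/-- The tables with `n` entries, all of them at most `d`. -/
noncomputable def tabFinset (n d : ℕ) : Finset (ℕ → ℕ) :=
  (Fintype.piFinset fun _ : Fin n => Finset.range (d + 1)).image
    fun s i => if h : i < n then s ⟨i, h⟩ else 0

theorem mem_tabFinset {n d : ℕ} {t : ℕ → ℕ} :
    t ∈ tabFinset n d ↔ (∀ i, t i ≤ d) ∧ ∀ i, n ≤ i → t i = 0 := by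
  simp only [tabFinset, Finset.mem_image, Fintype.mem_piFinset, Finset.mem_range]
  constructor
  · rintro ⟨s, hs, rfl⟩
    refine ⟨fun i => ?_, fun i hi => by simp [not_lt.2 hi]⟩
    dsimp only
    split_ifs with h
    · exact Nat.lt_succ_iff.1 (hs _)
    · exact Nat.zero_le _
  · rintro ⟨h1, h2⟩
    refine ⟨fun i => t i, fun i => Nat.lt_succ_iff.2 (h1 i), ?_⟩
    funext i
    split_ifs with h
    · rfl
    · exact (h2 i (not_lt.1 h)).symm

/-- The tables with `l` positive entries, all of them at most `d`. -/
noncomputable def posTabFinset (l d : ℕ) : Finset (ℕ → ℕ) :=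
  (tabFinset l d).filter fun t => ∀ i < l, 0 < t i

theorem support_mapDomain_tabExp {l d M : ℕ} {β : ℕ → ℕ} (hβ : β ∈ posTabFinset l d)
    {j : Fin l → Fin M} (hj : StrictMono j) :
    ((tabExp β l).mapDomain j).support = Finset.univ.image j := by
  have hs : (tabExp β l).support = Finset.univ := by
    ext i
    simpa using ((Finset.mem_filter.1 hβ).2 i i.2).ne'
  rw [Finsupp.mapDomain_support_of_injective hj.injective, hs]

/-- An exponent vector `β` in `M` variables is the same as its support, as an increasing sequence
`j` of variables, together with the sequence of its positive exponents. The number `M` of variables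
may be exponentially large, but the length `l` of these sequences is at most the degree. -/
theorem sum_eq_sum_mapDomain {M d : ℕ} {R : Type} [AddCommMonoid R] (S : Finset (Fin M →₀ ℕ))
    (hS : ∀ β ∈ S, ∑ s, β s ≤ d) (φ : (Fin M →₀ ℕ) → R) (hφ : ∀ β, β ∉ S → φ β = 0) :
    ∑ β ∈ S, φ β = ∑ l ∈ Finset.range (d + 1), ∑ β ∈ posTabFinset l d,
      ∑ j : Fin l → Fin M with StrictMono j, φ ((tabExp β l).mapDomain j) := by
  classical
  simp only [Finset.sum_sigma']
  set T := (Finset.range (d + 1)).sigma fun l => (posTabFinset l d).sigma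
    fun _ => Finset.univ.filter fun j : Fin l → Fin M => StrictMono j with hT
  let ψ : (l : ℕ) × (_ : ℕ → ℕ) × (Fin l → Fin M) → (Fin M →₀ ℕ) :=
    fun x => (tabExp x.2.1 x.1).mapDomain x.2.2
  have h1 : ∑ β ∈ S, φ β = ∑ β ∈ S ∪ T.image ψ, φ β :=
    Finset.sum_subset Finset.subset_union_left fun β _ h => hφ β h
  rw [h1]
  symm
  refine Finset.sum_of_injOn ψ ?_ ?_ ?_ fun x _ => rfl
  · rintro ⟨l, β, j⟩ hx ⟨l', β', j'⟩ hx' h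
    simp only [hT, Finset.mem_coe, Finset.mem_sigma, Finset.mem_filter_univ] at hx hx'
    obtain ⟨-, hβ, hj⟩ := hx
    obtain ⟨-, hβ', hj'⟩ := hx'
    change (tabExp β l).mapDomain j = (tabExp β' l').mapDomain j' at h
    have hsup := congrArg Finsupp.support h
    rw [support_mapDomain_tabExp hβ hj, support_mapDomain_tabExp hβ' hj'] at hsup
    have hl : l = l' := by
      have := congrArg Finset.card hsup
      rwa [Finset.card_image_of_injective _ hj.injective,
        Finset.card_image_of_injective _ hj'.injective, Finset.card_fin, Finset.card_fin] at this
    subst hl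
    have hjj : j = j' := by
      rw [← StrictMono.range_inj hj hj']
      simpa using congrArg (fun s : Finset (Fin M) => (s : Set (Fin M))) hsup
    subst hjj
    have hb := Finsupp.mapDomain_injective hj.injective h
    have hββ : β = β' := by
      funext i
      rcases lt_or_ge i l with hi | hi
      · exact DFunLike.congr_fun hb ⟨i, hi⟩
      · rw [(mem_tabFinset.1 (Finset.mem_filter.1 hβ).1).2 i hi,
          (mem_tabFinset.1 (Finset.mem_filter.1 hβ').1).2 i hi]
    rw [hββ]
  · intro x hx
    exact Finset.mem_coe.2 (Finset.mem_union_right _ (Finset.mem_image_of_mem _ hx))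
  · intro β hβ hβ'
    rw [← Finset.coe_image, Finset.mem_coe] at hβ'
    have hβS : β ∈ S := (Finset.mem_union.1 hβ).resolve_right hβ'
    exfalso
    apply hβ'
    have hcard : β.support.card ≤ d := by
      refine le_trans ?_ (hS β hβS)
      rw [← Finset.sum_subset (Finset.subset_univ β.support)
        fun i _ hi => Finsupp.notMem_support_iff.1 hi]
      simpa using Finset.card_nsmul_le_sum β.support β 1
        fun i hi => Nat.pos_of_ne_zero (Finsupp.mem_support_iff.1 hi)
    set l := β.support.card with hl
    let j := β.support.orderEmbOfFin rfl
    refine Finset.mem_image.2 ⟨⟨l, fun i => if h : i < l then β (j ⟨i, h⟩) else 0, j⟩, ?_, ?_⟩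
    · simp only [hT, Finset.mem_sigma, Finset.mem_range, Finset.mem_filter_univ]
      refine ⟨by omega, Finset.mem_filter.2 ⟨mem_tabFinset.2 ⟨fun i => ?_, fun i hi => ?_⟩,
        fun i hi => ?_⟩, j.strictMono⟩
      · split_ifs
        · exact (Finset.single_le_sum (fun _ _ => Nat.zero_le _) (Finset.mem_univ _)).trans
            (hS β hβS)
        · exact Nat.zero_le _
      · simp [not_lt.2 hi]
      · beta_reduce
        rw [dif_pos hi]
        exact Nat.pos_of_ne_zero (Finsupp.mem_support_iff.1 (Finset.orderEmbOfFin_mem _ _ _))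
    · ext x
      by_cases hx : x ∈ β.support
      · obtain ⟨i, rfl⟩ : x ∈ Set.range j := by
          rw [Finset.range_orderEmbOfFin]
          exact hx
        change (Finsupp.mapDomain j _) (j i) = _
        rw [Finsupp.mapDomain_apply j.injective]
        simp
      · change (Finsupp.mapDomain j _) x = _
        rw [Finsupp.mapDomain_of_notMem_range, Finsupp.notMem_support_iff.1 hx]
        rw [Finset.range_orderEmbOfFin]
        exact hx

/-- The enumeration of a finite set in the order of an injective key. -/
theorem exists_strictMono_enum {τ κ : Type} [LinearOrder κ] (key : τ → κ)
    (hk : Function.Injective key) (D : Finset τ) :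
    ∃ e : Fin D.card → τ, StrictMono (key ∘ e) ∧ ∀ t, t ∈ D ↔ ∃ s, e s = t := by
  classical
  have hc : (D.image key).card = D.card := Finset.card_image_of_injective _ hk
  let f := (D.image key).orderEmbOfFin hc
  have h : ∀ s, ∃ t ∈ D, key t = f s := fun s =>
    Finset.mem_image.1 (Finset.orderEmbOfFin_mem _ _ _)
  choose e he hf using h
  refine ⟨e, fun a b hab => by simpa [hf] using hab, fun t => ⟨fun ht => ?_, ?_⟩⟩
  · have : key t ∈ Set.range f := by
      rw [Finset.range_orderEmbOfFin]
      exact Finset.mem_coe.2 (Finset.mem_image_of_mem _ ht)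
    obtain ⟨s, hs⟩ := this
    exact ⟨s, hk ((hf s).trans hs)⟩
  · rintro ⟨s, rfl⟩
    exact he s

namespace SymFunc

/-- The coefficients of `f[g]`, when `g` is a sum of monomials indexed by `D`: a monomial of `f` in
the monomials of `g` is a sequence of positive exponents `β` together with an increasing sequence
`o` in `D`. -/
theorem coeff_plethysm (f g : SymFunc) {d N : ℕ} (hf : ∀ M, (f.1 M).totalDegree ≤ d)
    {τ κ : Type} [DecidableEq τ] [LinearOrder κ] (key : τ → κ) (hk : Function.Injective key)
    (D : Finset τ)
    (w : τ → Fin N →₀ ℕ) (hg : g.1 N = ∑ s ∈ D, monomial (w s) 1) (γ : Fin N →₀ ℕ) :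
    coeff γ ((plethysm f g).1 N) = ∑ l ∈ Finset.range (d + 1), ∑ β ∈ posTabFinset l d,
      coeff (tabExp β l) (f.1 l) *
        (((Fintype.piFinset fun _ : Fin l => D).filter fun o =>
          StrictMono (fun i => key (o i)) ∧ ∑ i : Fin l, β i • w (o i) = γ).card : ℂ) := by
  classical
  obtain ⟨e, he, hD⟩ := exists_strictMono_enum key hk D
  have he' : Function.Injective e := fun a b h => he.injective (congrArg key h)
  have hg' : g.1 N = ∑ s, monomial (w (e s)) 1 := by
    have : D = Finset.univ.image e := by ext t; simp [hD]
    rw [hg, Finset.sum_congr this fun _ _ => rfl, Finset.sum_image he'.injOn]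
  have hsum : ∀ β ∈ (f.1 D.card).support, ∑ s, β s ≤ d := by
    intro β hβ
    refine le_trans ?_ ((le_totalDegree hβ).trans (hf _))
    rw [Finsupp.sum_fintype _ _ fun _ => rfl]
  rw [plethysm_val f g (fun s => w (e s)) hg', coeff_aeval_monomial,
    sum_eq_sum_mapDomain _ hsum (fun β => if ∑ s, β s • w (e s) = γ then coeff β (f.1 D.card) else 0)
      fun β hβ => by simp [notMem_support_iff.1 hβ]]
  refine Finset.sum_congr rfl fun l _ => Finset.sum_congr rfl fun β _ => ?_
  have h1 : ∀ j ∈ (Finset.univ.filter fun j : Fin l → Fin D.card => StrictMono j),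
      (if ∑ s, ((tabExp β l).mapDomain j) s • w (e s) = γ
        then coeff ((tabExp β l).mapDomain j) (f.1 D.card) else 0)
      = if ∑ i : Fin l, β i • w (e (j i)) = γ then coeff (tabExp β l) (f.1 l) else 0 := by
    intro j hj
    rw [coeff_mapDomain f (Finset.mem_filter.1 hj).2.injective]
    congr 2
    have := Finsupp.sum_mapDomain_index (f := j) (s := tabExp β l)
      (h := fun s k => k • w (e s)) (by simp) (by simp [add_smul])
    rwa [Finsupp.sum_fintype _ _ (by simp), Finsupp.sum_fintype _ _ (by simp)] at this
  rw [Finset.sum_congr rfl h1, ← Finset.sum_filter, Finset.sum_const, nsmul_eq_mul, mul_comm]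
  congr 2
  refine Finset.card_bij (fun j _ i => e (j i)) ?_ ?_ ?_
  · intro j hj
    simp only [Finset.mem_filter, Finset.mem_univ, true_and] at hj
    simp only [Finset.mem_filter, Fintype.mem_piFinset]
    exact ⟨fun i => (hD _).2 ⟨_, rfl⟩, he.comp hj.1, hj.2⟩
  · intro j _ j' _ h
    funext i
    exact he' (congrFun h i)
  · intro o ho
    simp only [Finset.mem_filter, Fintype.mem_piFinset] at ho
    choose j hj using fun i => (hD _).1 (ho.1 i)
    refine ⟨j, ?_, funext hj⟩
    simp only [Finset.mem_filter, Finset.mem_univ, true_and, hj, ho.2.2, and_true]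
    intro a b hab
    rw [← he.lt_iff_lt]
    simpa [hj] using ho.2.1 hab

end SymFunc

end

/-! ### The Kostka matrix is unitriangular -/

section

open MvPolynomial

namespace IntPartition

theorem mem_diagram (lam : IntPartition) (c : ℕ × ℕ) :
    c ∈ lam.diagram ↔ c.2 < lam.rowTab c.1 := by
  rw [diagram, YoungDiagram.mem_ofRowLens]
  constructor
  · rintro ⟨h, h'⟩
    rwa [rowTab, List.getD_eq_getElem _ _ h]
  · intro h
    have h1 := (lam.rowTab_pos_iff c.1).1 (by omega)
    refine ⟨h1, ?_⟩
    rwa [rowTab, List.getD_eq_getElem _ _ h1] at h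

theorem rowLen_diagram (lam : IntPartition) (i : ℕ) : lam.diagram.rowLen i = lam.rowTab i := by
  have h : ∀ j, j < lam.diagram.rowLen i ↔ j < lam.rowTab i := fun j => by
    rw [← YoungDiagram.mem_iff_lt_rowLen, mem_diagram]
  have h1 := h (lam.rowTab i)
  have h2 := h (lam.diagram.rowLen i)
  omega

theorem card_row (lam : IntPartition) (i : ℕ) :
    (lam.diagram.cells.filter fun c => c.1 = i).card = lam.rowTab i := by
  rw [← rowLen_diagram, YoungDiagram.rowLen_eq_card]
  rfl

theorem rowTab_injective {lam mu : IntPartition} (h : lam.rowTab = mu.rowTab) : lam = mu := by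
  apply rows_injective
  have h1 : ∀ i, i < lam.rows.length ↔ i < mu.rows.length := fun i => by
    rw [← rowTab_pos_iff, ← rowTab_pos_iff, h]
  have hl : lam.rows.length = mu.rows.length := by
    have := h1 lam.rows.length
    have := h1 mu.rows.length
    omega
  refine List.ext_getElem hl fun i hi hi' => ?_
  have := congrFun h i
  rwa [rowTab, rowTab, List.getD_eq_getElem _ _ hi, List.getD_eq_getElem _ _ hi'] at this

theorem sum_rowTab (lam : IntPartition) {n : ℕ} (h : lam.rows.length ≤ n) :
    ∑ i ∈ Finset.range n, lam.rowTab i = lam.1 := by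
  have := SymFunc.sum_expParts (tabExp lam.rowTab n)
  rw [expParts_rowTab lam h, lam.2.parts_sum] at this
  rw [this, Finset.sum_range]
  rfl

/-- The statistic `n(lam) = ∑ i lam_{i+1}`, the sum of the row indices (from `0`) of the cells. -/
def rank (lam : IntPartition) : ℕ := ∑ c ∈ lam.diagram.cells, c.1

theorem sum_eq_sum_mul_card {ι : Type} (s : Finset ι) (φ : ι → ℕ) {n : ℕ} (h : ∀ c ∈ s, φ c < n) :
    ∑ c ∈ s, φ c = ∑ i ∈ Finset.range n, i * (s.filter fun c => φ c = i).card := by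
  rw [← Finset.sum_fiberwise_of_maps_to (g := φ) (t := Finset.range n)
    fun c hc => Finset.mem_range.2 (h c hc)]
  refine Finset.sum_congr rfl fun i _ => ?_
  rw [Finset.sum_congr rfl fun c hc => (Finset.mem_filter.1 hc).2, Finset.sum_const, smul_eq_mul,
    mul_comm]

theorem fst_lt_length (lam : IntPartition) {c : ℕ × ℕ} (hc : c ∈ lam.diagram.cells) :
    c.1 < lam.rows.length := by
  have := (lam.mem_diagram c).1 ((YoungDiagram.mem_cells _).1 hc)
  exact (lam.rowTab_pos_iff _).1 (by omega)

theorem rank_eq (lam : IntPartition) :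
    lam.rank = ∑ i ∈ Finset.range lam.rows.length, i * lam.rowTab i := by
  rw [rank, sum_eq_sum_mul_card _ _ fun c hc => lam.fst_lt_length hc]
  simp only [card_row]

theorem rank_le (lam : IntPartition) : lam.rank ≤ lam.1 * lam.1 := by
  rw [rank_eq]
  calc _ ≤ ∑ i ∈ Finset.range lam.rows.length, lam.1 * lam.rowTab i :=
        Finset.sum_le_sum fun i hi => Nat.mul_le_mul_right _
          ((Finset.mem_range.1 hi).le.trans lam.length_rows_le)
    _ = _ := by rw [← Finset.mul_sum, sum_rowTab _ le_rfl]

/-- A filling of the diagram of `lam` has content `mu` if the entry `i` occurs `mu_{i+1}` times. -/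
def HasContent {lam : IntPartition} (T : SemistandardYoungTableau lam.diagram)
    (mu : IntPartition) : Prop :=
  ∀ i : ℕ, (lam.diagram.cells.filter fun c => T c.1 c.2 = i).card = mu.rowTab i

theorem kostka_eq (lam mu : IntPartition) : lam.kostka mu =
    Nat.card {T : SemistandardYoungTableau lam.diagram // HasContent T mu} := rfl

theorem HasContent.lt_length {lam mu : IntPartition} {T : SemistandardYoungTableau lam.diagram}
    (h : HasContent T mu) {c : ℕ × ℕ} (hc : c ∈ lam.diagram.cells) :
    T c.1 c.2 < mu.rows.length := by
  rw [← rowTab_pos_iff, ← h, Finset.card_pos]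
  exact ⟨c, Finset.mem_filter.2 ⟨hc, rfl⟩⟩

/-- Entries start at `0` and increase strictly down the columns. -/
theorem le_entry {D : YoungDiagram} (T : SemistandardYoungTableau D) :
    ∀ {i j : ℕ}, (i, j) ∈ D → i ≤ T i j
  | 0, _, _ => Nat.zero_le _
  | i + 1, j, h => by
    have h1 := le_entry T (D.up_left_mem (Nat.le_succ i) le_rfl h)
    have h2 : T i j < T (i + 1) j := T.col_strict (Nat.lt_succ_self i) h
    omega

theorem HasContent.sum_eq {lam mu : IntPartition} {T : SemistandardYoungTableau lam.diagram}
    (h : HasContent T mu) : ∑ c ∈ lam.diagram.cells, T c.1 c.2 = mu.rank := by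
  rw [sum_eq_sum_mul_card _ _ fun c hc => h.lt_length hc, rank_eq]
  exact Finset.sum_congr rfl fun i _ => by rw [h i]

/-- Since the entries of the `i`-th row are at least `i`, the statistic `n` of the content is at
least that of the shape. -/
theorem HasContent.rank_le {lam mu : IntPartition} {T : SemistandardYoungTableau lam.diagram}
    (h : HasContent T mu) : lam.rank ≤ mu.rank := by
  rw [← h.sum_eq]
  exact Finset.sum_le_sum fun c hc => le_entry T ((YoungDiagram.mem_cells _).1 hc)

theorem HasContent.entry_eq {lam mu : IntPartition} {T : SemistandardYoungTableau lam.diagram}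
    (h : HasContent T mu) (hr : lam.rank = mu.rank) {c : ℕ × ℕ} (hc : c ∈ lam.diagram.cells) :
    T c.1 c.2 = c.1 := by
  rw [← h.sum_eq, rank] at hr
  exact ((Finset.sum_eq_sum_iff_of_le fun c hc =>
    le_entry T ((YoungDiagram.mem_cells _).1 hc)).1 hr c hc).symm

theorem HasContent.eq_of_rank_eq {lam mu : IntPartition}
    {T : SemistandardYoungTableau lam.diagram} (h : HasContent T mu) (hr : lam.rank = mu.rank) :
    lam = mu := by
  apply rowTab_injective
  funext i
  rw [← h, ← card_row]
  refine congrArg _ (Finset.filter_congr fun c hc => ?_)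
  rw [h.entry_eq hr hc]

theorem kostka_self (lam : IntPartition) : lam.kostka lam = 1 := by
  rw [kostka_eq, Nat.card_eq_one_iff_unique]
  refine ⟨⟨fun S T => ?_⟩, ⟨SemistandardYoungTableau.highestWeight _, fun i => ?_⟩⟩
  · refine Subtype.ext (SemistandardYoungTableau.ext fun i j => ?_)
    by_cases h : (i, j) ∈ lam.diagram
    · exact (S.2.entry_eq rfl (c := (i, j)) h).trans (T.2.entry_eq rfl (c := (i, j)) h).symm
    · rw [S.1.zeros h, T.1.zeros h]
  · rw [← card_row]
    refine congrArg _ (Finset.filter_congr fun c hc => ?_)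
    rw [SemistandardYoungTableau.highestWeight_apply, if_pos ((YoungDiagram.mem_cells _).1 hc)]

theorem rank_lt_of_kostka_ne_zero {lam mu : IntPartition} (hne : lam ≠ mu)
    (h : lam.kostka mu ≠ 0) : lam.rank < mu.rank := by
  obtain ⟨T⟩ : Nonempty {T : SemistandardYoungTableau lam.diagram // HasContent T mu} := by
    by_contra hempty
    rw [not_nonempty_iff] at hempty
    exact h (Nat.card_of_isEmpty (α := {T : SemistandardYoungTableau lam.diagram // HasContent T mu}))
  exact lt_of_le_of_ne T.2.rank_le fun hr => hne (T.2.eq_of_rank_eq hr)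

open Classical in
/-- The off-diagonal part of the Kostka matrix. -/
noncomputable def offKostka (m : ℕ) : Matrix m.Partition m.Partition ℕ :=
  fun lam mu => if lam = mu then 0 else kostka ⟨m, lam⟩ ⟨m, mu⟩

/-- Each step along the off-diagonal part of the Kostka matrix strictly increases the statistic
`n`. -/
theorem offKostka_pow_ne_zero {m j : ℕ} {lam mu : m.Partition} (h : (offKostka m ^ j) lam mu ≠ 0) :
    rank ⟨m, lam⟩ + j ≤ rank ⟨m, mu⟩ := by
  induction j generalizing mu with
  | zero =>
    rw [pow_zero, Matrix.one_apply] at h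
    split_ifs at h with h'
    · rw [h', add_zero]
    · exact absurd rfl h
  | succ j ih =>
    rw [pow_succ, Matrix.mul_apply] at h
    obtain ⟨k, -, hk⟩ := Finset.exists_ne_zero_of_sum_ne_zero h
    have h1 := ih (left_ne_zero_of_mul hk)
    have h2 := right_ne_zero_of_mul hk
    rw [offKostka] at h2
    split_ifs at h2 with h3
    · exact absurd rfl h2
    · have := rank_lt_of_kostka_ne_zero (fun e => h3 (by simpa using e)) h2
      omega

theorem offKostka_pow_eq_zero (m : ℕ) : offKostka m ^ (m * m + 1) = 0 := by
  ext lam mu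
  by_contra h
  have h1 := offKostka_pow_ne_zero h
  have h2 := rank_le ⟨m, mu⟩
  dsimp only at h2
  omega

/-- The Kostka matrix. -/
noncomputable def kostkaMatrix (m : ℕ) : Matrix m.Partition m.Partition ℤ :=
  fun lam mu => kostka ⟨m, lam⟩ ⟨m, mu⟩

/-- The inverse of the Kostka matrix, as a finite Neumann series. -/
noncomputable def invKostka (m : ℕ) : Matrix m.Partition m.Partition ℤ :=
  ∑ j ∈ Finset.range (m * m + 1), (-(offKostka m).map Nat.cast) ^ j

theorem kostkaMatrix_eq (m : ℕ) : kostkaMatrix m = 1 - -((offKostka m).map Nat.cast) := by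
  ext lam mu
  rw [sub_neg_eq_add, Matrix.add_apply, Matrix.one_apply, Matrix.map_apply, offKostka, kostkaMatrix]
  split_ifs with h
  · rw [h, kostka_self]
    simp
  · simp

theorem map_offKostka_pow (m j : ℕ) : (offKostka m).map (Nat.cast : ℕ → ℤ) ^ j
    = (offKostka m ^ j).map Nat.cast :=
  (map_pow (Nat.castRingHom ℤ).mapMatrix (offKostka m) j).symm

theorem neg_map_offKostka_pow (m : ℕ) :
    (-((offKostka m).map (Nat.cast : ℕ → ℤ))) ^ (m * m + 1) = 0 := by
  rw [neg_pow, map_offKostka_pow, offKostka_pow_eq_zero]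
  simp

theorem kostkaMatrix_mul_invKostka (m : ℕ) : kostkaMatrix m * invKostka m = 1 := by
  rw [kostkaMatrix_eq, invKostka, mul_neg_geom_sum, neg_map_offKostka_pow, sub_zero]

theorem invKostka_mul_kostkaMatrix (m : ℕ) : invKostka m * kostkaMatrix m = 1 := by
  rw [kostkaMatrix_eq, invKostka, geom_sum_mul_neg, neg_map_offKostka_pow, sub_zero]

theorem invKostka_apply (m : ℕ) (lam mu : m.Partition) : invKostka m lam mu =
    ∑ j ∈ Finset.range (m * m + 1), (-1) ^ j * ((offKostka m ^ j) lam mu : ℤ) := by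
  rw [invKostka, Matrix.sum_apply]
  refine Finset.sum_congr rfl fun j _ => ?_
  rw [← neg_one_smul ℤ ((offKostka m).map Nat.cast), smul_pow, map_offKostka_pow]
  simp

end IntPartition

/-! ### Expansion in Schur functions -/

namespace SymFunc

theorem ext_monoCoeff {F G : SymFunc} (h : ∀ mu, monoCoeff F mu = monoCoeff G mu) : F = G := by
  ext n β
  let lam : IntPartition := ⟨_, ⟨expParts β, fun hi => by
    obtain ⟨x, hx, rfl⟩ := Multiset.mem_map.1 hi
    exact Nat.pos_of_ne_zero (Finsupp.mem_support_iff.1 hx), rfl⟩⟩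
  rw [coeff_eq_monoCoeff F β lam rfl, coeff_eq_monoCoeff G β lam rfl, h]

/-- `monoCoeff` as an additive map in the symmetric function. -/
noncomputable def monoCoeffHom (mu : IntPartition) : SymFunc →+ ℂ where
  toFun F := monoCoeff F mu
  map_zero' := by simp [monoCoeff]
  map_add' F G := by simp [monoCoeff]

theorem monoCoeffHom_smul (mu : IntPartition) (c : ℂ) (F : SymFunc) :
    monoCoeffHom mu (c • F) = c * monoCoeff F mu := coeff_smul _ _ _

theorem monoCoeff_monomialSymm (lam mu : IntPartition) :
    monoCoeff (monomialSymm lam) mu = if mu.2.parts = lam.2.parts then 1 else 0 := by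
  rw [monoCoeff, coeff_monomialSymm, expParts_rowTab _ le_rfl]

theorem monoCoeff_schur {m : ℕ} (nu mu : m.Partition) :
    monoCoeff (schur ⟨m, nu⟩) ⟨m, mu⟩ = (IntPartition.kostka ⟨m, nu⟩ ⟨m, mu⟩ : ℂ) := by
  classical
  have h := map_sum (monoCoeffHom ⟨m, mu⟩)
    (fun k : m.Partition => (IntPartition.kostka ⟨m, nu⟩ ⟨m, k⟩ : ℂ) • monomialSymm ⟨m, k⟩)
    Finset.univ
  refine h.trans ?_
  rw [Finset.sum_eq_single mu]
  · rw [monoCoeffHom_smul, monoCoeff_monomialSymm, if_pos rfl, mul_one]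
  · intro k _ hk
    rw [monoCoeffHom_smul, monoCoeff_monomialSymm, if_neg, mul_zero]
    exact fun e => hk (Nat.Partition.ext e.symm)
  · simp

theorem monoCoeff_schur_of_ne {nu mu : IntPartition} (h : nu.1 ≠ mu.1) :
    monoCoeff (schur nu) mu = 0 := by
  refine (map_sum (monoCoeffHom mu)
    (fun k : nu.1.Partition => (IntPartition.kostka nu ⟨nu.1, k⟩ : ℂ) • monomialSymm ⟨nu.1, k⟩)
    Finset.univ).trans (Finset.sum_eq_zero fun k _ => ?_)
  rw [monoCoeffHom_smul, monoCoeff_monomialSymm, if_neg, mul_zero]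
  intro e
  apply h
  rw [← mu.2.parts_sum, e]
  exact k.parts_sum.symm

theorem monoCoeff_sum_schur (a : IntPartition →₀ ℤ) {m : ℕ} (mu : m.Partition) :
    monoCoeff (a.sum fun nu c => c • schur nu) ⟨m, mu⟩
      = ∑ nu : m.Partition, (a ⟨m, nu⟩ : ℂ) * IntPartition.kostka ⟨m, nu⟩ ⟨m, mu⟩ := by
  classical
  have h1 := map_sum (monoCoeffHom ⟨m, mu⟩) (fun nu => a nu • schur nu) a.support
  refine h1.trans ?_
  have h2 : ∀ nu, monoCoeffHom ⟨m, mu⟩ (a nu • schur nu) = a nu * monoCoeff (schur nu) ⟨m, mu⟩ := by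
    intro nu
    rw [map_zsmul, zsmul_eq_mul]
    rfl
  simp only [h2]
  have h3 : ∑ nu : m.Partition, (a ⟨m, nu⟩ : ℂ) * IntPartition.kostka ⟨m, nu⟩ ⟨m, mu⟩
      = ∑ nu ∈ Finset.univ.map (Function.Embedding.sigmaMk (β := fun n : ℕ => n.Partition) m),
        (a nu : ℂ) * monoCoeff (schur nu) ⟨m, mu⟩ := by
    rw [Finset.sum_map]
    exact Finset.sum_congr rfl fun nu _ => by rw [← monoCoeff_schur]; rfl
  rw [h3]
  refine Finset.sum_congr_of_eq_on_inter ?_ ?_ fun _ _ _ => rfl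
  · rintro ⟨m', nu⟩ _ h
    rw [monoCoeff_schur_of_ne, mul_zero]
    rintro rfl
    exact h (Finset.mem_map.2 ⟨nu, Finset.mem_univ _, rfl⟩)
  · intro nu _ h
    rw [Finsupp.notMem_support_iff.1 h, Int.cast_zero, zero_mul]

/-- The coefficients of the expansion in Schur functions of a symmetric function with integral
coefficients are given by the inverse Kostka matrix. -/
theorem exists_schur_expansion (F : SymFunc) (M : IntPartition → ℕ)
    (hM : ∀ mu, monoCoeff F mu = M mu) : ∃ a : IntPartition →₀ ℤ,
      (∀ nu, a nu = ∑ mu : nu.1.Partition, (M ⟨nu.1, mu⟩ : ℤ) * IntPartition.invKostka nu.1 mu nu.2) ∧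
      F = a.sum (fun nu c => c • schur nu) ∧
      ∀ b : IntPartition →₀ ℤ, F = b.sum (fun nu c => c • schur nu) → b = a := by
  classical
  have key : ∀ b : IntPartition →₀ ℤ, F = b.sum (fun nu c => c • schur nu) ↔
      ∀ m : ℕ, Matrix.vecMul (fun nu => b ⟨m, nu⟩) (IntPartition.kostkaMatrix m)
        = fun mu => (M ⟨m, mu⟩ : ℤ) := by
    intro b
    have h1 : ∀ (m : ℕ) (mu : m.Partition), (monoCoeff F ⟨m, mu⟩
        = monoCoeff (b.sum fun nu c => c • schur nu) ⟨m, mu⟩) ↔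
        Matrix.vecMul (fun nu => b ⟨m, nu⟩) (IntPartition.kostkaMatrix m) mu
          = (M ⟨m, mu⟩ : ℤ) := by
      intro m mu
      rw [hM, monoCoeff_sum_schur, eq_comm, ← Int.cast_inj (α := ℂ)]
      simp [Matrix.vecMul, dotProduct, IntPartition.kostkaMatrix]
    constructor
    · intro h m
      funext mu
      rw [← h1, ← h]
    · intro h
      refine ext_monoCoeff ?_
      rintro ⟨m, mu⟩
      rw [h1, h]
  -- The degree of `F` is bounded, so only finitely many partitions contribute.
  obtain ⟨D, hD⟩ := F.2.2.2
  let S : Finset IntPartition := (Finset.range (D + 1)).sigma fun m => Finset.univ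
  have hsupp : ∀ mu : IntPartition, D < mu.1 → M mu = 0 := by
    intro mu hmu
    rw [← Nat.cast_eq_zero (R := ℂ), ← hM, monoCoeff]
    apply coeff_eq_zero_of_totalDegree_lt
    refine (hD _).trans_lt (hmu.trans_eq ?_)
    have h1 := sum_expParts (tabExp mu.rowTab mu.rows.length)
    rw [expParts_rowTab _ le_rfl, mu.2.parts_sum] at h1
    rw [h1]
    symm
    exact Finset.sum_subset (Finset.subset_univ _) fun i _ hi => Finsupp.notMem_support_iff.1 hi
  let a : IntPartition →₀ ℤ := Finsupp.onFinset S (fun nu => ∑ mu : nu.1.Partition,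
    (M ⟨nu.1, mu⟩ : ℤ) * IntPartition.invKostka nu.1 mu nu.2) fun nu h => by
      by_contra hS
      apply h
      refine Finset.sum_eq_zero fun mu _ => ?_
      rw [hsupp]
      · simp
      · simpa [S] using hS
  have ha : ∀ m : ℕ, (fun nu => a ⟨m, nu⟩)
      = Matrix.vecMul (fun mu => (M ⟨m, mu⟩ : ℤ)) (IntPartition.invKostka m) := fun m => rfl
  refine ⟨a, fun nu => rfl, (key a).2 fun m => ?_, fun b hb => ?_⟩
  · rw [ha, Matrix.vecMul_vecMul, IntPartition.invKostka_mul_kostkaMatrix, Matrix.vecMul_one]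
  · ext ⟨m, nu⟩
    have h1 := congrFun (ha m) nu
    rw [← (key b).1 hb m, Matrix.vecMul_vecMul, IntPartition.kostkaMatrix_mul_invKostka,
      Matrix.vecMul_one] at h1
    exact h1.symm

end SymFunc

end

/-! ### Partitions and Kostka numbers as counting functions -/

section

variable {γ : Type} [Ctx γ]

open Ctx

theorem DefSet.tabFinset {n d : γ → ℕ} (hn : PT n) (hd : PT d) (hbn : PolyBdd n)
    (hbd : PolyBdd d) : DefSet fun c => tabFinset (n c) (d c) := by
  refine DefSet.intro (hbn.add hbd) (fun c t ht => ?_) (fun e p =>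
    (∀ i < (siz p.1 + 2) ^ e, ev p.2 i ≤ d p.1) ∧
      ∀ i < (siz p.1 + 2) ^ e, n p.1 ≤ i → ev p.2 i = 0) (fun e => by fun_prop)
    fun e c t he ht => ?_
  · rw [mem_tabFinset] at ht
    exact ⟨fun i => (ht.1 i).trans (Nat.le_add_left _ _), fun i hi => ht.2 i (by omega)⟩
  · rw [mem_tabFinset]
    simp only [ev]
    refine ⟨fun h => ⟨fun i _ => h.1 i, fun i _ => h.2 i⟩, fun h => ⟨fun i => ?_, fun i hi => ?_⟩⟩
    · rcases lt_or_ge i ((siz c + 2) ^ e) with h' | h'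
      · exact h.1 i h'
      · rw [ht.2 i h']
        exact Nat.zero_le _
    · rcases lt_or_ge i ((siz c + 2) ^ e) with h' | h'
      · exact h.2 i h' hi
      · exact ht.2 i h'

end

open Classical in
/-- The row tables of the partitions of `m`. -/
noncomputable def partTabs (m : ℕ) : Finset (ℕ → ℕ) :=
  Finset.univ.image fun mu : m.Partition => IntPartition.rowTab ⟨m, mu⟩

namespace IntPartition

theorem rowTab_antitone (lam : IntPartition) : Antitone lam.rowTab := by
  intro i j hij
  rcases lt_or_ge j lam.rows.length with h | h
  · rw [rowTab, rowTab, List.getD_eq_getElem _ _ h, List.getD_eq_getElem _ _ (hij.trans_lt h)]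
    rcases hij.eq_or_lt with rfl | h'
    · exact le_rfl
    · exact List.pairwise_iff_getElem.1 (Multiset.pairwise_sort lam.2.parts (· ≥ ·)) _ _ _ _ h'
  · rw [rowTab_eq_zero lam h]
    exact Nat.zero_le _

theorem rowTab_mem_tabFinset (lam : IntPartition) : lam.rowTab ∈ tabFinset lam.1 lam.1 := by
  refine mem_tabFinset.2 ⟨fun i => ?_, fun i hi => lam.rowTab_eq_zero (lam.length_rows_le.trans hi)⟩
  rcases lt_or_ge i lam.rows.length with h | h
  · rw [← sum_rowTab lam le_rfl]
    exact Finset.single_le_sum (fun _ _ => Nat.zero_le _) (Finset.mem_range.2 h)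
  · rw [rowTab_eq_zero lam h]
    exact Nat.zero_le _

end IntPartition

/-- A weakly decreasing table is determined by its multiset of values. -/
theorem eq_of_expParts_eq {s t : ℕ → ℕ} {n : ℕ} (hs : ∀ i, n ≤ i → s i = 0)
    (ht : ∀ i, n ≤ i → t i = 0) (hs' : ∀ i < n, ∀ j < i, s i ≤ s j)
    (ht' : ∀ i < n, ∀ j < i, t i ≤ t j) (h : expParts (tabExp s n) = expParts (tabExp t n)) :
    s = t := by
  rw [expParts_tabExp, expParts_tabExp] at h
  have h1 : (Multiset.range n).map s = (Multiset.range n).map t := by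
    have h0 : ∀ M : Multiset ℕ, M = M.filter (· ≠ 0)
        + Multiset.replicate (M.card - (M.filter (· ≠ 0)).card) 0 := by
      intro M
      have h2 := Multiset.filter_add_not (· ≠ 0) M
      have h3 : M.filter (fun a => ¬ a ≠ 0) = Multiset.replicate
          (M.card - (M.filter (· ≠ 0)).card) 0 := by
        rw [Multiset.eq_replicate]
        refine ⟨?_, fun b hb => by simpa using Multiset.of_mem_filter hb⟩
        conv_rhs => rw [← h2]
        rw [Multiset.card_add]
        simp
      rw [← h3, h2]
    rw [h0 ((Multiset.range n).map s), h0 ((Multiset.range n).map t), h]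
    simp
  have h2 : ((List.range n).map s).Perm ((List.range n).map t) := Multiset.coe_eq_coe.1 h1
  have h3 : ∀ u : ℕ → ℕ, (∀ i < n, ∀ j < i, u i ≤ u j) →
      ((List.range n).map u).Pairwise (· ≥ ·) := by
    intro u hu
    rw [List.pairwise_map, List.pairwise_iff_getElem]
    intro i j hi hj hij
    simp only [List.getElem_range]
    exact hu _ (by simpa using hj) _ hij
  have h4 := h2.eq_of_pairwise (fun a b _ _ h h' => le_antisymm h' h) (h3 s hs') (h3 t ht')
  funext i
  rcases lt_or_ge i n with hi | hi
  · simpa using List.map_inj_left.1 h4 i (List.mem_range.2 hi)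
  · rw [hs i hi, ht i hi]

theorem mem_partTabs {m : ℕ} {t : ℕ → ℕ} : t ∈ partTabs m ↔
    t ∈ tabFinset m m ∧ (∀ i < m, ∀ j < i, t i ≤ t j) ∧ ∑ i ∈ Finset.range m, t i = m := by
  simp only [partTabs, Finset.mem_image, Finset.mem_univ, true_and]
  constructor
  · rintro ⟨mu, rfl⟩
    exact ⟨IntPartition.rowTab_mem_tabFinset _, fun i _ j hj => IntPartition.rowTab_antitone _ hj.le,
      IntPartition.sum_rowTab _ (IntPartition.length_rows_le _)⟩
  · rintro ⟨h1, h2, h3⟩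
    let mu : m.Partition := ⟨expParts (tabExp t m), fun hi => by
      obtain ⟨x, hx, rfl⟩ := Multiset.mem_map.1 hi
      exact Nat.pos_of_ne_zero (Finsupp.mem_support_iff.1 hx), by
        rw [SymFunc.sum_expParts]
        exact (Finset.sum_range t).symm.trans h3⟩
    have h4 := mem_tabFinset.1 (IntPartition.rowTab_mem_tabFinset ⟨m, mu⟩)
    exact ⟨mu, eq_of_expParts_eq h4.2 (mem_tabFinset.1 h1).2
      (fun i _ j hj => IntPartition.rowTab_antitone _ hj.le) h2
      (expParts_rowTab _ (IntPartition.length_rows_le _))⟩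

theorem sum_partTabs {R : Type} [AddCommMonoid R] (m : ℕ) (f : (ℕ → ℕ) → R) :
    ∑ t ∈ partTabs m, f t = ∑ mu : m.Partition, f (IntPartition.rowTab ⟨m, mu⟩) := by
  classical
  rw [partTabs, Finset.sum_image]
  intro mu _ nu _ h
  simpa using IntPartition.rowTab_injective h

theorem DefSet.partTabs {γ : Type} [Ctx γ] {m : γ → ℕ} (hm : PT m) (hb : PolyBdd m) :
    DefSet fun c => partTabs (m c) := by
  classical
  have h := (DefSet.tabFinset hm hm hb hb).filter
    (P := fun p => (∀ i < m p.1, ∀ j < i, ev p.2 i ≤ ev p.2 j) ∧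
      ∑ i ∈ Finset.range (m p.1), ev p.2 i = m p.1) (by fun_prop)
  convert h using 2 with c
  ext t
  rw [mem_partTabs, Finset.mem_filter]
  rfl

/-- The number of semistandard tableaux with row lengths `r i`, for `i < m`, and content `t`. -/
noncomputable def kostkaCount (c : (ℕ → ℕ) × (ℕ → ℕ) × ℕ) : ℕ := by
  classical
  exact (((Fintype.piFinset fun _ : Fin c.2.2 => tabFinset c.2.2 c.2.2).image seqTab).filter fun x =>
    (∀ i < c.2.2, ∀ j < c.2.2, ev c.1 i ≤ j → ev (rowTab x i) j = 0) ∧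
    (∀ i < c.2.2, ∀ j < ev c.1 i, ∀ k < j, ev (rowTab x i) k ≤ ev (rowTab x i) j) ∧
    (∀ i < c.2.2, ∀ k < i, ∀ j < ev c.1 i, ev (rowTab x k) j < ev (rowTab x i) j) ∧
    ∀ k < c.2.2 + 1, (∑ i ∈ Finset.range c.2.2, ∑ j ∈ Finset.range (ev c.1 i),
      if ev (rowTab x i) j = k then 1 else 0) = ev c.2.1 k).card

theorem sharp_kostkaCount : Sharp kostkaCount := by
  classical
  have hbd : PolyBdd fun c : (ℕ → ℕ) × (ℕ → ℕ) × ℕ => c.2.2 :=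
    PolyBdd.siz.mono fun c => by simp
  have hbd' : PolyBdd fun c : ((ℕ → ℕ) × (ℕ → ℕ) × ℕ) × ℕ => c.1.2.2 :=
    PolyBdd.siz.mono fun c => by simp
  have h1 : DefSet fun c : ((ℕ → ℕ) × (ℕ → ℕ) × ℕ) × ℕ => tabFinset c.1.2.2 c.1.2.2 :=
    DefSet.tabFinset (by fun_prop) (by fun_prop) hbd' hbd'
  have h2 := (h1.pi (m := fun c : (ℕ → ℕ) × (ℕ → ℕ) × ℕ => c.2.2) (by fun_prop) hbd).filter
    (P := fun p => (∀ i < p.1.2.2, ∀ j < p.1.2.2, ev p.1.1 i ≤ j → ev (rowTab p.2 i) j = 0) ∧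
    (∀ i < p.1.2.2, ∀ j < ev p.1.1 i, ∀ k < j, ev (rowTab p.2 i) k ≤ ev (rowTab p.2 i) j) ∧
    (∀ i < p.1.2.2, ∀ k < i, ∀ j < ev p.1.1 i, ev (rowTab p.2 k) j < ev (rowTab p.2 i) j) ∧
    ∀ k < p.1.2.2 + 1, (∑ i ∈ Finset.range p.1.2.2, ∑ j ∈ Finset.range (ev p.1.1 i),
      if ev (rowTab p.2 i) j = k then 1 else 0) = ev p.1.2.1 k) (by fun_prop)
  exact ⟨_, h2, fun c => rfl⟩

namespace IntPartition

theorem card_filter_cells (lam : IntPartition) (p : ℕ × ℕ → Prop) [DecidablePred p] :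
    (lam.diagram.cells.filter p).card = ∑ i ∈ Finset.range lam.1,
      ∑ j ∈ Finset.range (lam.rowTab i), if p (i, j) then 1 else 0 := by
  rw [Finset.card_filter]
  apply Finset.sum_finset_product
  intro c
  rw [YoungDiagram.mem_cells, mem_diagram, Finset.mem_range, Finset.mem_range]
  refine ⟨fun h => ⟨?_, h⟩, fun h => h.2⟩
  exact ((lam.rowTab_pos_iff _).1 (by omega)).trans_le lam.length_rows_le

/-- A semistandard tableau is stored as the table of its rows. -/
theorem kostka_eq_kostkaCount {lam mu : IntPartition} (h : lam.1 = mu.1) :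
    lam.kostka mu = kostkaCount (lam.rowTab, mu.rowTab, lam.1) := by
  classical
  let φ : {T : SemistandardYoungTableau lam.diagram // HasContent T mu} → ℕ → ℕ :=
    fun T => joinTab fun i j => T.1 i j
  have hφ : Function.Injective φ := fun S T hST =>
    Subtype.ext (SemistandardYoungTableau.ext fun i j =>
      congrFun (congrFun (joinTab_injective hST) i) j)
  rw [kostka_eq, ← Nat.card_range_of_injective hφ, kostkaCount, Nat.card_coe_set_eq,
    ← Set.ncard_coe_finset]
  congr 1
  have hlen : ∀ i j, (i, j) ∈ lam.diagram → i < lam.1 ∧ j < lam.1 := by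
    intro i j hij
    have h1 := (lam.mem_diagram _).1 hij
    have h2 := (mem_tabFinset.1 lam.rowTab_mem_tabFinset).1 i
    dsimp only at h1
    exact ⟨((lam.rowTab_pos_iff _).1 (by omega)).trans_le lam.length_rows_le, by omega⟩
  ext x
  rw [Finset.mem_coe, Finset.mem_filter]
  simp only [Set.mem_range, Finset.mem_image, Fintype.mem_piFinset, ev]
  constructor
  · rintro ⟨⟨T, hT⟩, rfl⟩
    simp only [φ, rowTab_joinTab]
    have hz : ∀ i j, lam.rowTab i ≤ j → T i j = 0 := fun i j hij =>
      T.zeros fun hc => absurd ((lam.mem_diagram _).1 hc) (not_lt.2 hij)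
    refine ⟨⟨fun i j => T i j, fun i => mem_tabFinset.2 ⟨fun j => ?_, fun j hj => ?_⟩, ?_⟩, ?_, ?_, ?_, ?_⟩
    · by_cases hc : ((i : ℕ), j) ∈ lam.diagram
      · have := hT.lt_length (c := (i, j)) hc
        have := mu.length_rows_le
        dsimp only at *
        omega
      · exact (T.zeros hc).trans_le (Nat.zero_le _)
    · exact T.zeros fun hc => absurd (hlen _ _ hc).2 (not_lt.2 hj)
    · rw [seqTab]
      congr 1
      funext i
      split_ifs with hi
      · rfl
      · funext j
        exact (T.zeros fun hc => absurd (hlen _ _ hc).1 hi).symm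
    · exact fun i _ j _ hij => hz i j hij
    · exact fun i _ j hj k hk => T.row_weak hk ((lam.mem_diagram _).2 hj)
    · exact fun i _ k hk j hj => T.col_strict hk ((lam.mem_diagram _).2 hj)
    · intro k _
      rw [← hT k, card_filter_cells]
  · rintro ⟨⟨s, hs, rfl⟩, h1, h2, h3, h4⟩
    let T : SemistandardYoungTableau lam.diagram :=
      { entry := fun i j => _root_.rowTab (seqTab s) i j
        row_weak' := fun {i j k} hjk hc =>
          h2 i (hlen _ _ hc).1 k ((lam.mem_diagram _).1 hc) j hjk
        col_strict' := fun {i k j} hik hc =>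
          h3 k (hlen _ _ hc).1 i hik j ((lam.mem_diagram _).1 hc)
        zeros' := fun {i j} hc => by
          rcases lt_or_ge i lam.1 with hi | hi
          · rcases lt_or_ge j lam.1 with hj | hj
            · exact h1 i hi j hj (not_lt.1 fun hlt => hc ((lam.mem_diagram _).2 hlt))
            · rw [rowTab_seqTab s ⟨i, hi⟩]
              exact (mem_tabFinset.1 (hs _)).2 j hj
          · rw [rowTab_seqTab_of_le s hi]
            rfl }
    refine ⟨⟨T, fun k => ?_⟩, ?_⟩
    · rw [card_filter_cells]
      rcases lt_or_ge k (lam.1 + 1) with hk | hk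
      · exact h4 k hk
      · rw [mu.rowTab_eq_zero (mu.length_rows_le.trans (by omega))]
        refine Finset.sum_eq_zero fun i hi => Finset.sum_eq_zero fun j _ => if_neg ?_
        change _root_.rowTab (seqTab s) i j ≠ k
        rw [rowTab_seqTab s ⟨i, Finset.mem_range.1 hi⟩]
        have := (mem_tabFinset.1 (hs ⟨i, Finset.mem_range.1 hi⟩)).1 j
        omega
    · exact joinTab_rowTab (seqTab s)

end IntPartition

/-! ### The coefficients of the classical bases as counting functions -/

section

open MvPolynomial

/-- The data on which a coefficient of a member of a classical basis depends: the row lengths and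
the size of the partition, the exponents, and the number of variables. -/
abbrev CoeffCtx : Type := (ℕ → ℕ) × ℕ × (ℕ → ℕ) × ℕ

/-- The function `c` computes the coefficients of the family `F` of symmetric functions. The second
condition says that a member of the family is homogeneous of the size of the partition. -/
def IsCoeff (F : IntPartition → SymFunc) (c : CoeffCtx → ℕ) : Prop :=
  ∀ lam α N, coeff (tabExp α N) ((F lam).1 N) = c (lam.rowTab, lam.1, α, N) ∧
    (c (lam.rowTab, lam.1, α, N) ≠ 0 → ∑ j ∈ Finset.range N, α j = lam.1)

theorem sum_tabExp (α : ℕ → ℕ) (N : ℕ) : ∑ j, tabExp α N j = ∑ j ∈ Finset.range N, α j :=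
  (Finset.sum_range α).symm

/-! #### Monomial and Schur functions -/

/-- The multiplicity of `k` among the first `n` entries. -/
def tabCount (t : ℕ → ℕ) (n k : ℕ) : ℕ := ∑ j ∈ Finset.range n, if ev t j = k then 1 else 0

@[fun_prop] theorem PT.tabCount {γ : Type} [Ctx γ] {t : γ → ℕ → ℕ} {n k : γ → ℕ} (ht : PT t)
    (hn : PT n) (hk : PT k) : PT fun c => tabCount (t c) (n c) (k c) := by
  unfold _root_.tabCount
  fun_prop

theorem count_expParts_tabExp (t : ℕ → ℕ) (n : ℕ) {k : ℕ} (hk : k ≠ 0) :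
    (expParts (tabExp t n)).count k = tabCount t n k := by
  rw [expParts_tabExp, Multiset.count_filter_of_pos (by simpa using hk), Multiset.count_map,
    tabCount, ← Finset.card_filter]
  simp only [ev, eq_comm (a := k)]
  rfl

/-- Equality of the multisets of nonzero entries. -/
def SameParts (s : ℕ → ℕ) (m : ℕ) (t : ℕ → ℕ) (n : ℕ) : Prop :=
  (∀ i < m, 0 < ev s i → tabCount s m (ev s i) = tabCount t n (ev s i)) ∧
    ∀ j < n, 0 < ev t j → tabCount s m (ev t j) = tabCount t n (ev t j)

theorem sameParts_iff (s : ℕ → ℕ) (m : ℕ) (t : ℕ → ℕ) (n : ℕ) :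
    SameParts s m t n ↔ expParts (tabExp s m) = expParts (tabExp t n) := by
  constructor
  · rintro ⟨h1, h2⟩
    have hz : ∀ (u : ℕ → ℕ) (l k : ℕ), (∀ i < l, ev u i ≠ k) → tabCount u l k = 0 := by
      intro u l k h
      exact Finset.sum_eq_zero fun i hi => if_neg (h i (Finset.mem_range.1 hi))
    ext k
    rcases Nat.eq_zero_or_pos k with rfl | hk
    · rw [Multiset.count_eq_zero_of_notMem, Multiset.count_eq_zero_of_notMem] <;>
      · rw [expParts_tabExp]
        simp
    · rw [count_expParts_tabExp _ _ hk.ne', count_expParts_tabExp _ _ hk.ne']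
      by_cases hs : ∃ i < m, ev s i = k
      · obtain ⟨i, hi, rfl⟩ := hs
        exact h1 i hi hk
      · by_cases ht : ∃ j < n, ev t j = k
        · obtain ⟨j, hj, rfl⟩ := ht
          exact h2 j hj hk
        · push Not at hs ht
          rw [hz s m k hs, hz t n k ht]
  · intro h
    constructor <;>
    · intro i _ hi
      rw [← count_expParts_tabExp _ _ hi.ne', ← count_expParts_tabExp _ _ hi.ne', h]

@[fun_prop] theorem PTP.sameParts {γ : Type} [Ctx γ] {s t : γ → ℕ → ℕ} {m n : γ → ℕ} (hs : PT s)
    (hm : PT m) (ht : PT t) (hn : PT n) : PTP fun c => SameParts (s c) (m c) (t c) (n c) := by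
  unfold SameParts
  fun_prop

theorem sameParts_rowTab_iff (lam : IntPartition) (α : ℕ → ℕ) (N : ℕ) :
    SameParts lam.rowTab lam.1 α N ↔ expParts (tabExp α N) = lam.2.parts := by
  rw [sameParts_iff, expParts_rowTab _ lam.length_rows_le, eq_comm]

theorem SameParts.sum_eq {lam : IntPartition} {α : ℕ → ℕ} {N : ℕ}
    (h : SameParts lam.rowTab lam.1 α N) : ∑ j ∈ Finset.range N, α j = lam.1 := by
  rw [sameParts_rowTab_iff] at h
  rw [← sum_tabExp, ← SymFunc.sum_expParts, h, lam.2.parts_sum]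

open Classical in
theorem isCoeff_monomialSymm :
    IsCoeff SymFunc.monomialSymm fun c => if SameParts c.1 c.2.1 c.2.2.1 c.2.2.2 then 1 else 0 := by
  intro lam α N
  refine ⟨?_, fun h => ?_⟩
  · simp only [SymFunc.coeff_monomialSymm, sameParts_rowTab_iff]
    split_ifs <;> simp
  · by_contra h'
    exact h (if_neg fun hs => h' hs.sum_eq)

open Classical in
theorem isCoeff_schur : IsCoeff SymFunc.schur fun c => ∑ t ∈ partTabs c.2.1,
    kostkaCount (c.1, t, c.2.1) * if SameParts t c.2.1 c.2.2.1 c.2.2.2 then 1 else 0 := by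
  intro lam α N
  simp only [sum_partTabs]
  have hs : ∀ mu : lam.1.Partition,
      SameParts (IntPartition.rowTab ⟨lam.1, mu⟩) lam.1 α N ↔ expParts (tabExp α N) = mu.parts :=
    fun mu => sameParts_rowTab_iff ⟨lam.1, mu⟩ α N
  refine ⟨?_, fun h => ?_⟩
  · rw [SymFunc.schur, SymFunc.val_sum, coeff_sum, Nat.cast_sum]
    refine Finset.sum_congr rfl fun mu _ => ?_
    change coeff _ ((lam.kostka ⟨lam.1, mu⟩ : ℂ) • (SymFunc.monomialSymm ⟨lam.1, mu⟩).1 N) = _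
    rw [coeff_smul, SymFunc.coeff_monomialSymm, smul_eq_mul, Nat.cast_mul,
      IntPartition.kostka_eq_kostkaCount (lam := lam) (mu := ⟨lam.1, mu⟩) rfl]
    simp only [hs]
    split_ifs <;> simp
  · obtain ⟨mu, -, hmu⟩ := Finset.exists_ne_zero_of_sum_ne_zero h
    by_contra h'
    refine right_ne_zero_of_mul hmu (if_neg fun hsp => h' ?_)
    exact SameParts.sum_eq (lam := ⟨lam.1, mu⟩) hsp

/-! #### Products of elementary, complete and power sum symmetric functions -/

theorem coeff_sum_monomial {ι σ : Type} (S : Finset ι) (v : ι → σ →₀ ℕ) (hv : Set.InjOn v S)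
    (β : σ →₀ ℕ) [Decidable (∃ s ∈ S, v s = β)] :
    coeff β (∑ s ∈ S, monomial (v s) (1 : ℂ)) = if ∃ s ∈ S, v s = β then 1 else 0 := by
  classical
  rw [coeff_sum]
  simp only [coeff_monomial]
  split_ifs with h
  · obtain ⟨s, hs, rfl⟩ := h
    rw [Finset.sum_eq_single s]
    · simp
    · exact fun t ht hts => if_neg fun e => hts (hv ht hs e)
    · exact fun h => absurd hs h
  · exact Finset.sum_eq_zero fun s hs => if_neg fun e => h ⟨s, hs, e⟩

theorem tabExp_injOn (N d : ℕ) : Set.InjOn (fun t => tabExp t N) (tabFinset N d) := by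
  intro s hs t ht h
  funext i
  rcases lt_or_ge i N with hi | hi
  · exact DFunLike.congr_fun h ⟨i, hi⟩
  · rw [(mem_tabFinset.1 (Finset.mem_coe.1 hs)).2 i hi,
      (mem_tabFinset.1 (Finset.mem_coe.1 ht)).2 i hi]

/-- The table of an exponent vector. -/
def expTab {N : ℕ} (β : Fin N →₀ ℕ) (i : ℕ) : ℕ := if h : i < N then β ⟨i, h⟩ else 0

theorem tabExp_expTab {N : ℕ} (β : Fin N →₀ ℕ) : tabExp (expTab β) N = β := by
  ext i
  simp [expTab]

theorem expTab_mem {N d : ℕ} (β : Fin N →₀ ℕ) (h : ∀ i, β i ≤ d) : expTab β ∈ tabFinset N d := by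
  refine mem_tabFinset.2 ⟨fun i => ?_, fun i hi => by simp [expTab, not_lt.2 hi]⟩
  rw [expTab]
  split_ifs
  · exact h _
  · exact Nat.zero_le _

/-- A multiplicity-free description of the symmetric functions `φ k`: the coefficient of a
monomial of degree `k` with exponents `t` is `1` if `R (k, t, N)` holds, and all other coefficients
vanish. -/
def IsIndicator (φ : ℕ → SymFunc) (R : ℕ × (ℕ → ℕ) × ℕ → Prop) : Prop :=
  ∀ k t N, (∑ j ∈ Finset.range N, t j = k ∧ R (k, t, N) → coeff (tabExp t N) ((φ k).1 N) = 1) ∧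
    (¬ (∑ j ∈ Finset.range N, t j = k ∧ R (k, t, N)) → coeff (tabExp t N) ((φ k).1 N) = 0)

open Classical in
/-- The possible rows, with sum `k` and at most `m`, of the matrices of `prodCount`. -/
noncomputable def rowFinset (R : ℕ × (ℕ → ℕ) × ℕ → Prop) (k m N : ℕ) : Finset (ℕ → ℕ) :=
  (tabFinset N m).filter fun t => ∑ j ∈ Finset.range N, ev t j = k ∧ R (k, t, N)

open Classical in
/-- The number of matrices whose rows are as in `rowFinset`, with given row and column sums. -/
noncomputable def prodCount (R : ℕ × (ℕ → ℕ) × ℕ → Prop) (c : CoeffCtx) : ℕ :=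
  (((Fintype.piFinset fun i : Fin c.2.1 => rowFinset R (ev c.1 i) c.2.1 c.2.2.2).image
    seqTab).filter fun x => ∀ j < c.2.2.2, ∑ i ∈ Finset.range c.2.1, ev (rowTab x i) j
      = ev c.2.2.1 j).card

theorem sharp_prodCount {R : ℕ × (ℕ → ℕ) × ℕ → Prop} (hR : PTP R) : Sharp (prodCount R) := by
  classical
  have h1 : DefSet fun c : CoeffCtx × ℕ => tabFinset c.1.2.2.2 c.1.2.1 :=
    DefSet.tabFinset (by fun_prop) (by fun_prop)
      (PolyBdd.siz.mono fun c => by simp only [siz_prod, siz_nat]; omega)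
      (PolyBdd.siz.mono fun c => by simp only [siz_prod, siz_nat]; omega)
  have h2 := h1.filter (P := fun p => ∑ j ∈ Finset.range p.1.1.2.2.2, ev p.2 j = ev p.1.1.1 p.1.2 ∧
    R (ev p.1.1.1 p.1.2, p.2, p.1.1.2.2.2)) (by fun_prop)
  have h3 := (h2.pi (m := fun c : CoeffCtx => c.2.1) (by fun_prop)
    (PolyBdd.siz.mono fun c => by simp only [siz_prod, siz_nat]; omega)).filter
    (P := fun p => ∀ j < p.1.2.2.2, ∑ i ∈ Finset.range p.1.2.1, ev (rowTab p.2 i) j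
      = ev p.1.2.2.1 j) (by fun_prop)
  exact ⟨_, h3, fun c => rfl⟩

theorem IsIndicator.val_eq {φ : ℕ → SymFunc} {R : ℕ × (ℕ → ℕ) × ℕ → Prop} (h : IsIndicator φ R)
    {k m : ℕ} (hk : k ≤ m) (N : ℕ) :
    (φ k).1 N = ∑ t ∈ rowFinset R k m N, monomial (tabExp t N) 1 := by
  classical
  ext β
  rw [coeff_sum_monomial _ _ ((tabExp_injOn N m).mono (by
    rw [rowFinset, Finset.coe_filter]
    exact fun t ht => ht.1))]
  split_ifs with hβ
  · obtain ⟨t, ht, rfl⟩ := hβ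
    exact (h k t N).1 (Finset.mem_filter.1 ht).2
  · rw [← tabExp_expTab β]
    refine (h k (expTab β) N).2 fun hR => hβ ⟨expTab β, ?_, tabExp_expTab β⟩
    refine Finset.mem_filter.2 ⟨expTab_mem β fun i => ?_, hR⟩
    refine le_trans ?_ hk
    rw [← hR.1, ← sum_tabExp, tabExp_expTab]
    exact Finset.single_le_sum (fun _ _ => Nat.zero_le _) (Finset.mem_univ i)

theorem SymFunc.val_prod {ι : Type} (s : Finset ι) (f : ι → SymFunc) (n : ℕ) :
    (∏ i ∈ s, f i).1 n = ∏ i ∈ s, (f i).1 n := by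
  have h1 : (∏ i ∈ s, f i).1 = ∏ i ∈ s, (f i).1 := map_prod SymFunc.subtype f s
  rw [h1, Finset.prod_apply]

theorem prod_map_parts {A : Type} [CommMonoid A] (φ : ℕ → A) (h0 : φ 0 = 1) (lam : IntPartition) :
    (lam.2.parts.map φ).prod = ∏ i ∈ Finset.range lam.1, φ (lam.rowTab i) := by
  rw [← expParts_rowTab lam lam.length_rows_le, expParts_tabExp]
  have h1 := Multiset.filter_add_not (· ≠ 0) ((Multiset.range lam.1).map lam.rowTab)
  have h2 : ∏ i ∈ Finset.range lam.1, φ (lam.rowTab i)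
      = (((Multiset.range lam.1).map lam.rowTab).map φ).prod := by
    rw [Multiset.map_map]
    rfl
  rw [h2]
  conv_rhs => rw [← h1]
  rw [Multiset.map_add, Multiset.prod_add]
  symm
  convert mul_one _
  refine Multiset.prod_eq_one fun x hx => ?_
  obtain ⟨k, hk, rfl⟩ := Multiset.mem_map.1 hx
  have : k = 0 := by simpa using Multiset.of_mem_filter hk
  rw [this, h0]

/-- The coefficients of the products of the `φ k` over the parts of a partition count matrices with
prescribed row and column sums: the rows are the exponents of the factors. -/
theorem IsIndicator.isCoeff {φ : ℕ → SymFunc} {R : ℕ × (ℕ → ℕ) × ℕ → Prop} (h : IsIndicator φ R)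
    (h0 : φ 0 = 1) : IsCoeff (fun lam => (lam.2.parts.map φ).prod) (prodCount R) := by
  classical
  intro lam α N
  have hle : ∀ i, lam.rowTab i ≤ lam.1 := (mem_tabFinset.1 lam.rowTab_mem_tabFinset).1
  have hsum : ∀ s : Fin lam.1 → ℕ → ℕ, (∀ j < N, ∑ i ∈ Finset.range lam.1,
      ev (rowTab (seqTab s) i) j = ev α j) ↔ ∑ i, tabExp (s i) N = tabExp α N := by
    intro s
    rw [Finsupp.ext_iff, Fin.forall_iff]
    refine forall₂_congr fun j hj => ?_
    rw [Finset.sum_range, Finsupp.finsetSum_apply]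
    simp only [rowTab_seqTab, ev, tabExp_apply]
  rw [prodCount, Finset.filter_image, Finset.card_image_of_injective _ (seqTab_injective _)]
  simp only [hsum]
  refine ⟨?_, fun hne => ?_⟩
  · rw [prod_map_parts φ h0, SymFunc.val_prod, Finset.prod_range]
    simp only [h.val_eq (hle _)]
    rw [Finset.prod_univ_sum, coeff_sum, Finset.card_filter, Nat.cast_sum]
    refine Finset.sum_congr rfl fun s _ => ?_
    rw [← monomial_sum_one, coeff_monomial]
    simp
  · obtain ⟨s, hs⟩ := Finset.card_pos.1 (Nat.pos_of_ne_zero hne)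
    rw [Finset.mem_filter, Fintype.mem_piFinset] at hs
    rw [← sum_tabExp, ← hs.2]
    simp only [Finsupp.finsetSum_apply]
    rw [Finset.sum_comm]
    refine Eq.trans ?_ (lam.sum_rowTab lam.length_rows_le)
    rw [Finset.sum_range lam.rowTab]
    refine Finset.sum_congr rfl fun i _ => ?_
    rw [sum_tabExp]
    exact (Finset.mem_filter.1 (hs.1 i)).2.1

theorem coeff_eq_of_sum_monomial {N : ℕ} {F : MvPolynomial (Fin N) ℂ} {β : Fin N →₀ ℕ} {R : Prop}
    {ι : Type} (S : Finset ι) (v : ι → Fin N →₀ ℕ) (hv : Set.InjOn v S)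
    (hF : F = ∑ s ∈ S, monomial (v s) 1) (hR : (∃ s ∈ S, v s = β) ↔ R) :
    (R → coeff β F = 1) ∧ (¬ R → coeff β F = 0) := by
  classical
  rw [hF, coeff_sum_monomial S v hv]
  exact ⟨fun h => if_pos (hR.2 h), fun h => if_neg fun h' => h (hR.1 h')⟩

theorem isIndicator_hsymm :
    IsIndicator (fun k => ⟨_, SymFunc.hsymm_mem k⟩) fun _ => True := by
  classical
  intro k t N
  rw [← sum_tabExp]
  refine coeff_eq_of_sum_monomial (ι := Sym (Fin N) k) Finset.univ
    (fun s => Multiset.toFinsupp s.1) ?_ ?_ ?_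
  · exact fun s _ s' _ h => Subtype.ext (Multiset.toFinsupp.injective h)
  · exact Finset.sum_congr rfl fun s _ => SymFunc.prod_map_X s.1
  · simp only [Finset.mem_univ, true_and, and_true]
    constructor
    · rintro ⟨s, hs⟩
      rw [← hs]
      refine Eq.trans ?_ s.2
      conv_rhs => rw [← Multiset.toFinsupp_toMultiset s.1, Finsupp.card_toMultiset]
      rw [Finsupp.sum_fintype _ _ fun _ => rfl]
      rfl
    · intro h
      refine ⟨⟨Finsupp.toMultiset (tabExp t N), ?_⟩, by simp⟩
      rw [Finsupp.card_toMultiset, Finsupp.sum_fintype _ _ fun _ => rfl]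
      exact h

theorem isIndicator_esymm :
    IsIndicator (fun k => ⟨_, SymFunc.esymm_mem k⟩) fun p => ∀ j < p.2.2, ev p.2.1 j ≤ 1 := by
  classical
  intro k t N
  have hval : ∀ (s : Finset (Fin N)) (x : Fin N),
      (∑ i ∈ s, Finsupp.single i 1 : Fin N →₀ ℕ) x = if x ∈ s then 1 else 0 := by
    intro s x
    rw [Finsupp.finsetSum_apply]
    simp [Finsupp.single_apply]
  rw [← sum_tabExp]
  refine coeff_eq_of_sum_monomial (Finset.powersetCard k Finset.univ)
    (fun s => ∑ i ∈ s, Finsupp.single i 1) ?_ (esymm_eq_sum_monomial (Fin N) ℂ k) ?_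
  · intro s _ s' _ h
    ext x
    have := DFunLike.congr_fun h x
    simp only [hval] at this
    split_ifs at this <;> simp_all
  · constructor
    · rintro ⟨s, hs, h⟩
      rw [← h]
      refine ⟨?_, fun j hj => ?_⟩
      · simp only [hval]
        simpa using (Finset.mem_powersetCard.1 hs).2
      · have := DFunLike.congr_fun h ⟨j, hj⟩
        rw [hval, tabExp_apply] at this
        dsimp only [ev] at *
        split_ifs at this <;> omega
    · rintro ⟨h1, h2⟩
      have h3 : ∀ x, tabExp t N x = if tabExp t N x ≠ 0 then 1 else 0 := by
        intro x
        have := h2 x x.2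
        simp only [ev] at this
        rw [tabExp_apply]
        split_ifs <;> omega
      refine ⟨(tabExp t N).support, Finset.mem_powersetCard.2 ⟨Finset.subset_univ _, ?_⟩, ?_⟩
      · rw [← h1, Finset.card_eq_sum_ones, ← Finset.sum_subset (Finset.subset_univ
          (tabExp t N).support) fun x _ hx => Finsupp.notMem_support_iff.1 hx]
        exact Finset.sum_congr rfl fun x hx => by
          rw [h3 x, if_pos (Finsupp.mem_support_iff.1 hx)]
      · ext x
        rw [hval, h3 x]
        by_cases hx : t x = 0 <;> simp [hx]

/-- The power sums, with the convention that `p_0` is `1`. -/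
noncomputable def powerSumOrOne (k : ℕ) : SymFunc :=
  if h : 0 < k then SymFunc.powerSum ⟨k, h⟩ else 1

theorem isIndicator_powerSumOrOne :
    IsIndicator powerSumOrOne fun p => p.1 = 0 ∨ ∃ j < p.2.2, ev p.2.1 j = p.1 := by
  classical
  intro k t N
  rw [← sum_tabExp, powerSumOrOne]
  rcases Nat.eq_zero_or_pos k with rfl | hk
  · rw [dif_neg (lt_irrefl 0)]
    refine coeff_eq_of_sum_monomial {()} (fun _ => 0) (by simp) (Finset.sum_singleton _ _).symm ?_
    rw [Finset.sum_eq_zero_iff]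
    constructor
    · rintro ⟨_, _, h⟩
      exact ⟨fun i _ => DFunLike.congr_fun h.symm i, Or.inl rfl⟩
    · rintro ⟨h, -⟩
      exact ⟨(), Finset.mem_singleton_self _, Finsupp.ext fun i => (h i (Finset.mem_univ i)).symm⟩
  · rw [dif_pos hk]
    refine coeff_eq_of_sum_monomial Finset.univ (fun i => Finsupp.single i k)
      (Finsupp.single_left_injective hk.ne').injOn
      ?_ ?_
    · change psum (Fin N) ℂ k = _
      exact Finset.sum_congr rfl fun i _ => X_pow_eq_monomial
    simp only [Finset.mem_univ, true_and, hk.ne', false_or]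
    constructor
    · rintro ⟨i, h⟩
      rw [← h]
      refine ⟨by simp [Finsupp.single_apply], i, i.2, ?_⟩
      have := DFunLike.congr_fun h i
      simpa [ev] using this.symm
    · rintro ⟨h1, j, hj, h2⟩
      refine ⟨⟨j, hj⟩, ?_⟩
      ext x
      have h3 : tabExp t N ⟨j, hj⟩ = k := h2
      by_cases hx : ⟨j, hj⟩ = x
      · rw [← hx, h3, Finsupp.single_eq_same]
      · rw [Finsupp.single_apply, if_neg hx]
        have h4 := Finset.sum_le_sum_of_subset (f := tabExp t N)
          (Finset.subset_univ ({⟨j, hj⟩, x} : Finset (Fin N)))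
        rw [Finset.sum_pair hx, h1, h3] at h4
        omega

/-- The coefficients of the classical bases are nonnegative integers, and they are counting
functions. -/
theorem ClassicalBasis.exists_isCoeff (b : ClassicalBasis) :
    ∃ c : CoeffCtx → ℕ, Sharp c ∧ IsCoeff b.elem c := by
  classical
  cases b with
  | schur =>
    refine ⟨_, ?_, isCoeff_schur⟩
    have hD : DefSet fun c : CoeffCtx => partTabs c.2.1 := by
      have hb : PolyBdd fun c : CoeffCtx => c.2.1 :=
        PolyBdd.siz.mono fun c => by simp only [siz_prod, siz_nat]; omega
      exact DefSet.partTabs (by fun_prop) hb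
    have h1 : Sharp fun p : CoeffCtx × (ℕ → ℕ) => kostkaCount (p.1.1, p.2, p.1.2.1) :=
      sharp_kostkaCount.comp (by fun_prop)
        (PolyBdd.siz.mono fun p => by simp only [siz_prod, siz_nat, siz_tab]; omega)
    have h2 : Sharp fun p : CoeffCtx × (ℕ → ℕ) =>
        if SameParts p.2 p.1.2.1 p.1.2.2.1 p.1.2.2.2 then 1 else 0 :=
      Sharp.indicator (by fun_prop)
    exact Sharp.sum hD (h1.mul h2)
  | monomial => exact ⟨_, Sharp.indicator (by fun_prop), isCoeff_monomialSymm⟩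
  | powerSum =>
    refine ⟨_, sharp_prodCount (R := fun p => p.1 = 0 ∨ ∃ j < p.2.2, ev p.2.1 j = p.1)
      (by fun_prop), ?_⟩
    convert isIndicator_powerSumOrOne.isCoeff (dif_neg (lt_irrefl 0)) with lam
    change SymFunc.powerSumSymm lam = _
    rw [SymFunc.powerSumSymm]
    conv_rhs => rw [← Multiset.attach_map_val lam.2.parts, Multiset.map_map]
    congr 1
    refine Multiset.map_congr rfl fun k _ => ?_
    rw [Function.comp_apply, powerSumOrOne, dif_pos (lam.2.parts_pos k.2)]
  | elementary =>
    refine ⟨_, sharp_prodCount (by fun_prop), isIndicator_esymm.isCoeff ?_⟩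
    exact Subtype.ext (funext fun n => esymm_zero (Fin n) ℂ)
  | complete =>
    refine ⟨_, sharp_prodCount PTP.trivial, isIndicator_hsymm.isCoeff ?_⟩
    exact Subtype.ext (funext fun n => hsymm_zero (Fin n) ℂ)

end

/-! ### The coefficients of a plethysm as a counting function -/

section

open MvPolynomial

section

variable {γ δ : Type} [Ctx γ] [Ctx δ]

open Ctx

theorem DefSet.comp_of_siz_le {D : γ → Finset (ℕ → ℕ)} (hD : DefSet D) {φ : δ → γ} (hφ : PT φ)
    (h : ∀ d, siz (φ d) ≤ siz d) : DefSet fun d => D (φ d) := by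
  classical
  have := hD.comp hφ PTP.trivial PolyBdd.siz fun d _ => h d
  simpa using this

theorem Sharp.comp_of_siz_le {F : γ → ℕ} (hF : Sharp F) {φ : δ → γ} (hφ : PT φ)
    (h : ∀ d, siz (φ d) ≤ siz d) : Sharp fun d => F (φ d) :=
  hF.comp hφ (PolyBdd.siz.mono h)

end

/-- The data that stand for a partition in a counting function: the row table and the size. -/
abbrev PartData : Type := (ℕ → ℕ) × ℕ

/-- The row table and the size of a partition. -/
def IntPartition.data (lam : IntPartition) : PartData := (lam.rowTab, lam.1)

/-- The lexicographic order on tables, decided on the first `L` entries. -/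
def LexLt (L : ℕ) (s t : ℕ → ℕ) : Prop := ∃ j < L, ev s j < ev t j ∧ ∀ i < j, ev s i = ev t i

@[fun_prop] theorem PTP.lexLt {γ : Type} [Ctx γ] {L : γ → ℕ} {s t : γ → ℕ → ℕ} (hL : PT L)
    (hs : PT s) (ht : PT t) : PTP fun c => LexLt (L c) (s c) (t c) := by
  unfold LexLt
  fun_prop

theorem lexLt_iff {L : ℕ} {s t : ℕ → ℕ} (hs : ∀ i, L ≤ i → s i = 0) (ht : ∀ i, L ≤ i → t i = 0) :
    LexLt L s t ↔ toLex s < toLex t := by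
  constructor
  · rintro ⟨j, -, h1, h2⟩
    exact ⟨j, fun i hi => h2 i hi, h1⟩
  · rintro ⟨j, h1, h2⟩
    refine ⟨j, ?_, h2, fun i hi => h1 i hi⟩
    by_contra hj
    have h3 : s j < t j := h2
    rw [hs j (not_lt.1 hj), ht j (not_lt.1 hj)] at h3
    exact lt_irrefl _ h3

theorem DefSet.posTabFinset {γ : Type} [Ctx γ] {l d : γ → ℕ} (hl : PT l) (hd : PT d)
    (hbl : PolyBdd l) (hbd : PolyBdd d) : DefSet fun c => posTabFinset (l c) (d c) := by
  classical
  have h := (DefSet.tabFinset hl hd hbl hbd).filter (P := fun p => ∀ i < l p.1, 0 < ev p.2 i)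
    (by fun_prop)
  convert h using 2 with c
  ext t
  rw [_root_.posTabFinset, Finset.mem_filter, Finset.mem_filter]
  rfl

open Classical in
/-- Given witnesses `E` for the coefficients of a family of symmetric functions, the monomials, with
multiplicity, of a member of this family in `N` variables: an element codes a pair of an exponent
table and a witness. -/
noncomputable def monomialSet (E : CoeffCtx → Finset (ℕ → ℕ)) (p : PartData) (N : ℕ) :
    Finset (ℕ → ℕ) :=
  ((tabFinset N p.2).sigma fun α => E (p.1, p.2, α, N)).image fun x => pairTab x.1 x.2

theorem DefSet.monomialSet {E : CoeffCtx → Finset (ℕ → ℕ)} (hE : DefSet E) :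
    DefSet fun c : PartData × ℕ => monomialSet E c.1 c.2 := by
  classical
  have h1 : DefSet fun c : PartData × ℕ => _root_.tabFinset c.2 c.1.2 :=
    DefSet.tabFinset (by fun_prop) (by fun_prop)
      (PolyBdd.siz.mono fun c => by simp only [siz_prod, siz_nat]; omega)
      (PolyBdd.siz.mono fun c => by simp only [siz_prod, siz_nat]; omega)
  have h2 : DefSet fun p : (PartData × ℕ) × (ℕ → ℕ) => E (p.1.1.1, p.1.1.2, p.2, p.1.2) :=
    hE.comp_of_siz_le (by fun_prop) fun p => by simp only [siz_prod, siz_nat, siz_tab]; omega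
  have h3 := h1.sigma (E := fun p => E (p.1.1.1, p.1.1.2, p.2, p.1.2)) h2
  simpa only [_root_.monomialSet] using h3

theorem pairTab_injective : Function.Injective fun x : (_ : ℕ → ℕ) × (ℕ → ℕ) =>
    pairTab x.1 x.2 := by
  rintro ⟨a, b⟩ ⟨a', b'⟩ h
  have h1 := congrArg (fun r => rowTab r 0) h
  have h2 := congrArg (fun r => rowTab r 1) h
  simp only [rowTab_pairTab_zero, rowTab_pairTab_one] at h1 h2
  rw [h1, h2]

/-- A symmetric function with nonnegative integral coefficients is a sum of monomials. -/
theorem IsCoeff.val_eq {F : IntPartition → SymFunc} {c : CoeffCtx → ℕ} (h : IsCoeff F c)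
    {E : CoeffCtx → Finset (ℕ → ℕ)} (hE : ∀ p, c p = (E p).card) (lam : IntPartition) (N : ℕ) :
    (F lam).1 N = ∑ x ∈ monomialSet E lam.data N, monomial (tabExp (rowTab x 0) N) 1 := by
  classical
  rw [monomialSet, Finset.sum_image pairTab_injective.injOn, Finset.sum_sigma]
  simp only [rowTab_pairTab_zero, Finset.sum_const, ← hE]
  ext β
  rw [coeff_sum]
  simp only [coeff_smul, coeff_monomial]
  dsimp only [IntPartition.data]
  obtain ⟨h1, h2⟩ := h lam (expTab β) N
  rw [tabExp_expTab] at h1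
  by_cases hβ : expTab β ∈ tabFinset N lam.1
  · rw [Finset.sum_eq_single_of_mem (expTab β) hβ, if_pos (tabExp_expTab β), h1]
    · simp
    · intro α hα hne
      rw [if_neg, smul_zero]
      intro e
      exact hne (tabExp_injOn N lam.1 hα hβ (e.trans (tabExp_expTab β).symm))
  · rw [Finset.sum_eq_zero, h1, Nat.cast_eq_zero]
    · by_contra hne
      apply hβ
      refine expTab_mem β fun i => ?_
      rw [← h2 hne, ← sum_tabExp, tabExp_expTab]
      exact Finset.single_le_sum (fun _ _ => Nat.zero_le _) (Finset.mem_univ i)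
    · intro α hα
      rw [if_neg, smul_zero]
      rintro rfl
      apply hβ
      have : expTab (tabExp α N) = α := by
        funext i
        rw [expTab]
        split_ifs with hi
        · rfl
        · exact ((mem_tabFinset.1 hα).2 i (not_lt.1 hi)).symm
      rwa [this]

theorem IsCoeff.totalDegree_le {F : IntPartition → SymFunc} {c : CoeffCtx → ℕ} (h : IsCoeff F c)
    (lam : IntPartition) (N : ℕ) : ((F lam).1 N).totalDegree ≤ lam.1 := by
  refine Finset.sup_le fun β hβ => ?_
  obtain ⟨h1, h2⟩ := h lam (expTab β) N
  rw [tabExp_expTab] at h1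
  rw [Finsupp.sum_fintype _ _ fun _ => rfl, ← h2, ← sum_tabExp, tabExp_expTab]
  intro e
  rw [e, Nat.cast_zero] at h1
  exact mem_support_iff.1 hβ h1

/-- Three partitions, a number of variables, and their exponents. -/
abbrev SubstCtx : Type := (((PartData × PartData) × PartData) × ℕ) × (ℕ → ℕ)

/-- The coefficients of a plethysm of members of two classical bases are a counting function. -/
theorem exists_sharp_plethysm (f g : ClassicalBasis) :
    ∃ M : (PartData × PartData) × PartData → ℕ, Sharp M ∧ ∀ lam mu ka : IntPartition,
      SymFunc.monoCoeff (SymFunc.plethysm (f.elem lam) (g.elem mu)) ka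
        = M ((lam.data, mu.data), ka.data) := by
  classical
  obtain ⟨cf, hcf, hf⟩ := f.exists_isCoeff
  obtain ⟨cg, ⟨E, hE, hcE⟩, hg⟩ := g.exists_isCoeff
  have hD := hE.monomialSet
  obtain ⟨e, _, -, he⟩ := id hD
  -- All tables in the sets of monomials vanish from the position `L` on, so that the lexicographic
  -- order on them can be decided on the first `L` entries.
  let L : SubstCtx → ℕ := fun c => (c.1.1.1.2.2 + c.1.1.2.2 + 2) ^ e
  let D : SubstCtx × ℕ → Finset (ℕ → ℕ) := fun c => monomialSet E c.1.1.1.1.2 c.1.1.1.2.2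
  have hD1 : DefSet D := hD.comp_of_siz_le
    (φ := fun c : SubstCtx × ℕ => (c.1.1.1.1.2, c.1.1.1.2.2)) (by fun_prop)
    fun c => by simp only [siz_prod, siz_nat, siz_tab]; omega
  have hD2 := (hD1.pi (m := fun c : SubstCtx => c.1.2) (by fun_prop)
    (PolyBdd.siz.mono fun c => by simp only [siz_prod, siz_nat, siz_tab]; omega)).filter
    (P := fun p => (∀ i < p.1.1.2, ∀ j < i, LexLt (L p.1) (rowTab p.2 j) (rowTab p.2 i)) ∧
      ∀ k < p.1.1.1.2.2, ∑ i ∈ Finset.range p.1.1.2,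
        ev p.1.2 i * ev (rowTab (rowTab p.2 i) 0) k = ev p.1.1.1.2.1 k) (by fun_prop)
  have hF1 : Sharp fun c : SubstCtx => cf (c.1.1.1.1.1, c.1.1.1.1.2, c.2, c.1.2) :=
    hcf.comp_of_siz_le (by fun_prop) fun c => by simp only [siz_prod, siz_nat, siz_tab]; omega
  have hF2 : Sharp fun c : SubstCtx => _ := ⟨_, hD2, fun c => rfl⟩
  have hpos : DefSet fun c : ((PartData × PartData) × PartData) × ℕ =>
      posTabFinset c.2 c.1.1.1.2 := DefSet.posTabFinset (by fun_prop) (by fun_prop)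
    (PolyBdd.siz.mono fun c => by simp only [siz_prod, siz_nat, siz_tab]; omega)
    (PolyBdd.siz.mono fun c => by simp only [siz_prod, siz_nat, siz_tab]; omega)
  have hF3 := (Sharp.sum hpos (hF1.mul hF2)).sum_range
    (m := fun c : (PartData × PartData) × PartData => c.1.1.2 + 1) (by fun_prop)
    ((PolyBdd.siz.mono fun c => by simp only [siz_prod, siz_nat, siz_tab]; omega).add (.const 1))
  refine ⟨_, hF3, fun lam mu ka => ?_⟩
  rw [← SymFunc.coeff_eq_monoCoeff _ (tabExp ka.rowTab ka.1) ka (expParts_rowTab _ ka.length_rows_le),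
    SymFunc.coeff_plethysm _ _ (d := lam.1) (fun M => hf.totalDegree_le lam M) toLex
      toLex.injective (monomialSet E mu.data ka.1) (fun x => tabExp (rowTab x 0) ka.1)
      (hg.val_eq hcE mu ka.1), Nat.cast_sum]
  refine Finset.sum_congr rfl fun l _ => ?_
  rw [Nat.cast_sum]
  refine Finset.sum_congr rfl fun β _ => ?_
  rw [(hf lam β l).1, Nat.cast_mul, Finset.filter_image,
    Finset.card_image_of_injective _ (seqTab_injective _)]
  congr 3
  refine Finset.filter_congr fun o ho => ?_
  rw [Fintype.mem_piFinset] at ho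
  have hz : ∀ i, ∀ k, (mu.1 + ka.1 + 2) ^ e ≤ k → o i k = 0 := fun i => by
    have := ((he (mu.data, ka.1) _).1 (ho i)).1.2
    simpa [IntPartition.data] using this
  refine and_congr ⟨fun h i hi j hj => ?_, fun h j i hij => ?_⟩ ?_
  · have h1 := h (show (⟨j, hj.trans hi⟩ : Fin l) < ⟨i, hi⟩ from hj)
    have h2 := (lexLt_iff (hz _) (hz _)).2 h1
    rwa [← rowTab_seqTab o, ← rowTab_seqTab o] at h2
  · have h1 := h i i.2 j hij
    rw [rowTab_seqTab o, rowTab_seqTab o] at h1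
    exact (lexLt_iff (hz _) (hz _)).1 h1
  · rw [Finsupp.ext_iff, Fin.forall_iff]
    refine forall₂_congr fun k hk => ?_
    rw [Finset.sum_range, Finsupp.finsetSum_apply]
    simp only [rowTab_seqTab, ev, Finsupp.smul_apply, tabExp_apply, smul_eq_mul]
    rfl

end

/-! ### Multiplication by powers of the Kostka matrix -/

/-- The entries of a vector times a power of a matrix as sums over paths. -/
theorem Matrix.vecMul_pow_eq_sum {P : Type} [Fintype P] [DecidableEq P] (A : Matrix P P ℕ) :
    ∀ (j : ℕ) (M : P → ℕ) (y : P), Matrix.vecMul M (A ^ j) y = ∑ c : Fin (j + 1) → P,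
      (if c (Fin.last j) = y then 1 else 0) *
        (M (c 0) * ∏ i : Fin j, A (c i.castSucc) (c i.succ)) := by
  intro j
  induction j with
  | zero =>
    intro M y
    rw [pow_zero, Matrix.vecMul_one, ← (Equiv.funUnique (Fin 1) P).symm.sum_comp]
    simp
  | succ j ih =>
    intro M y
    rw [pow_succ', ← Matrix.vecMul_vecMul, ih]
    conv_rhs => rw [← (Fin.consEquiv fun _ => P).sum_comp, Fintype.sum_prod_type, Finset.sum_comm]
    refine Finset.sum_congr rfl fun c _ => ?_
    simp only [Matrix.vecMul, dotProduct, Finset.sum_mul, Finset.mul_sum]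
    refine Finset.sum_congr rfl fun x _ => ?_
    rw [Fin.prod_univ_succ]
    simp only [Fin.consEquiv_apply, Fin.cons_zero, Fin.castSucc_zero, Fin.cons_succ,
      ← Fin.succ_castSucc, ← Fin.succ_last]
    ring

/-- The off-diagonal entries of the Kostka matrix, on tables. -/
noncomputable def offCount (c : (ℕ → ℕ) × (ℕ → ℕ) × ℕ) : ℕ := by
  classical
  exact (if ¬ ∀ i < c.2.2, ev c.1 i = ev c.2.1 i then 1 else 0) * kostkaCount c

theorem sharp_offCount : Sharp offCount := by
  classical
  exact (Sharp.indicator (P := fun c : (ℕ → ℕ) × (ℕ → ℕ) × ℕ =>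
    ¬ ∀ i < c.2.2, ev c.1 i = ev c.2.1 i) (by fun_prop)).mul sharp_kostkaCount

namespace IntPartition

theorem forall_rowTab_eq_iff {m : ℕ} (lam mu : m.Partition) :
    (∀ i < m, ev (rowTab ⟨m, lam⟩) i = ev (rowTab ⟨m, mu⟩) i) ↔ lam = mu := by
  constructor
  · intro h
    have : (⟨m, lam⟩ : IntPartition) = ⟨m, mu⟩ := by
      apply rowTab_injective
      funext i
      rcases lt_or_ge i m with hi | hi
      · exact h i hi
      · rw [rowTab_eq_zero _ ((length_rows_le _).trans hi),
          rowTab_eq_zero _ ((length_rows_le _).trans hi)]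
    simpa using this
  · rintro rfl i _
    rfl

theorem offKostka_eq_offCount {m : ℕ} (lam mu : m.Partition) :
    offKostka m lam mu = offCount (rowTab ⟨m, lam⟩, rowTab ⟨m, mu⟩, m) := by
  simp only [offKostka, offCount, forall_rowTab_eq_iff,
    kostka_eq_kostkaCount (lam := ⟨m, lam⟩) (mu := ⟨m, mu⟩) rfl]
  split_ifs <;> simp_all

/-- Multiplication of a counting function, as a vector indexed by partitions, by powers of the
off-diagonal part of the Kostka matrix gives a counting function. -/
theorem exists_sharp_vecMul_pow {γ : Type} [Ctx γ] {M : γ × PartData → ℕ} (hM : Sharp M) :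
    ∃ W : (γ × PartData) × ℕ → ℕ, Sharp W ∧ ∀ (c : γ) (m : ℕ) (nu : m.Partition) (j : ℕ),
      W ((c, data ⟨m, nu⟩), j)
        = Matrix.vecMul (fun ka : m.Partition => M (c, data ⟨m, ka⟩)) (offKostka m ^ j) nu := by
  classical
  have hD := (DefSet.partTabs (γ := ((γ × PartData) × ℕ) × ℕ) (m := fun c => c.1.1.2.2) (by fun_prop)
    (PolyBdd.siz.mono fun c => by simp only [siz_prod, siz_nat, siz_tab]; omega)).pi
    (m := fun c : (γ × PartData) × ℕ => c.2 + 1) (by fun_prop)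
    ((PolyBdd.siz.mono fun c => by simp only [siz_prod, siz_nat, siz_tab]; omega).add (.const 1))
  have h1 : Sharp fun p : ((γ × PartData) × ℕ) × (ℕ → ℕ) =>
      if ∀ i < p.1.1.2.2, ev (_root_.rowTab p.2 p.1.2) i = ev p.1.1.2.1 i then 1 else 0 :=
    Sharp.indicator (by fun_prop)
  have h2 : Sharp fun p : ((γ × PartData) × ℕ) × (ℕ → ℕ) =>
      M (p.1.1.1, (_root_.rowTab p.2 0, p.1.1.2.2)) :=
    hM.comp_of_siz_le (by fun_prop) fun p => by simp only [siz_prod, siz_nat, siz_tab]; omega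
  have h3 : Sharp fun p : (((γ × PartData) × ℕ) × (ℕ → ℕ)) × ℕ =>
      offCount (_root_.rowTab p.1.2 p.2, _root_.rowTab p.1.2 (p.2 + 1), p.1.1.1.2.2) :=
    sharp_offCount.comp_of_siz_le (by fun_prop) fun p => by
      simp only [siz_prod, siz_nat, siz_tab]; omega
  have h4 := h3.prod (m := fun p : ((γ × PartData) × ℕ) × (ℕ → ℕ) => p.1.2) (by fun_prop)
    (PolyBdd.siz.mono fun c => by simp only [siz_prod, siz_nat, siz_tab]; omega)
  refine ⟨_, Sharp.sum hD (h1.mul (h2.mul h4)), fun c m nu j => ?_⟩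
  rw [Matrix.vecMul_pow_eq_sum, Finset.sum_image (seqTab_injective _).injOn]
  dsimp only [data]
  symm
  refine Finset.sum_bij (fun s _ i => rowTab ⟨m, s i⟩) ?_ ?_ ?_ ?_
  · intro s _
    exact Fintype.mem_piFinset.2 fun i => Finset.mem_image_of_mem _ (Finset.mem_univ _)
  · intro s _ s' _ h
    funext i
    simpa using rowTab_injective (congrFun h i)
  · intro t ht
    choose s _ hs using fun i => Finset.mem_image.1 (Fintype.mem_piFinset.1 ht i)
    exact ⟨s, Finset.mem_univ _, funext hs⟩
  · intro s _
    have hr : ∀ i (hi : i < j + 1), _root_.rowTab (seqTab fun k => rowTab ⟨m, s k⟩) i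
        = rowTab ⟨m, s ⟨i, hi⟩⟩ := fun i hi => rowTab_seqTab (fun k => rowTab ⟨m, s k⟩) ⟨i, hi⟩
    rw [hr j (by omega), hr 0 (by omega), Finset.prod_range]
    simp only [forall_rowTab_eq_iff]
    congr 2
    refine Finset.prod_congr rfl fun i _ => ?_
    rw [hr i (by omega), hr (i + 1) (by omega), offKostka_eq_offCount]
    rfl

end IntPartition

/-! ### Decoding triples of partitions -/

namespace IntPartition

/-- The concatenation of the row lengths of three partitions, each closed by a `0`. -/
def tripleList (t : IntPartition × IntPartition × IntPartition) : List ℕ :=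
  t.1.rows ++ 0 :: (t.2.1.rows ++ 0 :: (t.2.2.rows ++ 0 :: []))

theorem unaryWord_tripleList (t : IntPartition × IntPartition × IntPartition) :
    unaryWord (tripleList t) = encodeTriple t := by
  simp [unaryWord, tripleList, encodeTriple, encode, encodeList]

end IntPartition

theorem length_unaryWord (l : List ℕ) : (unaryWord l).length = l.sum + l.length := by
  induction l with
  | nil => rfl
  | cons k l ih =>
    rw [unaryWord_cons, List.length_append, List.length_cons, ih, List.length_replicate,
      List.sum_cons, List.length_cons]
    omega

namespace PartData

/-- The number of rows. -/
def len (p : PartData) : ℕ := ∑ i ∈ Finset.range p.2, if 0 < ev p.1 i then 1 else 0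

/-- The table of the list that consists of the rows of `p`, a zero, and the entries of `t`. -/
def append (p : PartData) (t : ℕ → ℕ) (i : ℕ) : ℕ :=
  if i ≤ len p then ev p.1 i else ev t (i - (len p + 1))

end PartData

@[fun_prop] theorem PT.len {γ : Type} [Ctx γ] {p : γ → PartData} (hp : PT p) :
    PT fun c => PartData.len (p c) := by
  unfold PartData.len
  fun_prop

@[fun_prop] theorem PT.append {γ : Type} [Ctx γ] {p : γ → PartData} {t : γ → ℕ → ℕ} (hp : PT p)
    (ht : PT t) : PT fun c => PartData.append (p c) (t c) := by
  have : PT fun c i => if i ≤ PartData.len (p c) then _root_.ev (p c).1 i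
    else _root_.ev (t c) (i - (PartData.len (p c) + 1)) := by fun_prop
  exact this

namespace IntPartition

theorem len_data (lam : IntPartition) : PartData.len lam.data = lam.rows.length := by
  rw [PartData.len, ← Finset.card_filter]
  have : (Finset.range lam.data.2).filter (fun i => 0 < ev lam.data.1 i)
      = Finset.range lam.rows.length := by
    ext i
    have h1 := lam.rowTab_pos_iff i
    have h2 := lam.length_rows_le
    rw [Finset.mem_filter, Finset.mem_range, Finset.mem_range]
    dsimp only [data, ev]
    omega
  rw [this, Finset.card_range]

theorem append_data (lam : IntPartition) (l : List ℕ) (i : ℕ) :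
    PartData.append lam.data (fun i => l.getD i 0) i = (lam.rows ++ 0 :: l).getD i 0 := by
  rw [PartData.append, len_data]
  dsimp only [ev, data]
  rcases lt_trichotomy i lam.rows.length with h | rfl | h
  · rw [if_pos h.le, rowTab, List.getD_append _ _ _ _ h]
  · rw [if_pos le_rfl, rowTab_eq_zero _ le_rfl, List.getD_append_right _ _ _ _ le_rfl]
    simp
  · rw [if_neg (by omega), List.getD_append_right _ _ _ _ h.le]
    obtain ⟨d, rfl⟩ := Nat.exists_eq_add_of_lt h
    rw [show lam.rows.length + d + 1 - lam.rows.length = d + 1 by omega,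
      show lam.rows.length + d + 1 - (lam.rows.length + 1) = d by omega, List.getD_cons_succ]

end IntPartition

/-- The word with letter table `c.1` and length `c.2` encodes the three given partitions. -/
def Encodes (c : (ℕ → ℕ) × ℕ) (p q r : PartData) : Prop :=
  (∀ k < c.2, k + 1 = c.2 → ev c.1 k = 0) ∧
  zeroCount c.1 c.2 = PartData.len p + PartData.len q + PartData.len r + 3 ∧
  ∀ i < zeroCount c.1 c.2, ev (runTab c.1 c.2) i
    = ev (PartData.append p (PartData.append q (PartData.append r fun _ => 0))) i

@[fun_prop] theorem PTP.encodes {γ : Type} [Ctx γ] {c : γ → (ℕ → ℕ) × ℕ} {p q r : γ → PartData}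
    (hc : PT c) (hp : PT p) (hq : PT q) (hr : PT r) :
    PTP fun x => Encodes (c x) (p x) (q x) (r x) := by
  unfold Encodes
  fun_prop

/-- `Encodes` compares the runs of ones of the word with the row lengths, so that it says that the
word is the encoding. -/
theorem encodes_iff (w : List Bool) (t : IntPartition × IntPartition × IntPartition) :
    Encodes (bitTab w, w.length) t.1.data t.2.1.data t.2.2.data
      ↔ IntPartition.encodeTriple t = w := by
  have hlen : (IntPartition.tripleList t).length
      = t.1.rows.length + t.2.1.rows.length + t.2.2.rows.length + 3 := by
    simp only [IntPartition.tripleList, List.length_append, List.length_cons, List.length_nil]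
    omega
  have hget : ∀ i, PartData.append t.1.data (PartData.append t.2.1.data
      (PartData.append t.2.2.data fun _ => 0)) i = (IntPartition.tripleList t).getD i 0 := by
    intro i
    have h0 : (fun _ : ℕ => 0) = fun i => ([] : List ℕ).getD i 0 := by
      funext i
      simp
    have h1 : PartData.append t.2.2.data (fun _ => 0)
        = fun i => (t.2.2.rows ++ 0 :: []).getD i 0 := by
      funext i
      rw [h0, IntPartition.append_data]
    have h2 : PartData.append t.2.1.data (PartData.append t.2.2.data fun _ => 0)
        = fun i => (t.2.1.rows ++ 0 :: (t.2.2.rows ++ 0 :: [])).getD i 0 := by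
      funext i
      rw [h1, IntPartition.append_data]
    rw [h2, IntPartition.append_data]
    rfl
  rw [← IntPartition.unaryWord_tripleList]
  simp only [Encodes, ev, hget, IntPartition.len_data, ← hlen]
  constructor
  · rintro ⟨h1, h2, h3⟩
    obtain ⟨l, rfl⟩ := exists_unaryWord w h1
    rw [zeroCount_unaryWord] at h2 h3
    simp only [runTab_unaryWord] at h3
    congr 1
    refine List.ext_getElem h2.symm fun i hi hi' => ?_
    have := h3 i hi'
    rw [List.getD_eq_getElem _ _ hi, List.getD_eq_getElem _ _ hi'] at this
    exact this.symm
  · rintro rfl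
    exact ⟨fun k _ hk => bitTab_unaryWord_last _ k hk, zeroCount_unaryWord _,
      fun i _ => runTab_unaryWord _ i⟩

theorem size_le_length_encodeTriple (t : IntPartition × IntPartition × IntPartition) :
    t.1.1 ≤ (IntPartition.encodeTriple t).length ∧ t.2.1.1 ≤ (IntPartition.encodeTriple t).length ∧
      t.2.2.1 ≤ (IntPartition.encodeTriple t).length := by
  have h : ∀ lam : IntPartition, lam.rows.sum = lam.1 := fun lam => by
    rw [← Multiset.sum_coe, lam.coe_rows, lam.2.parts_sum]
  rw [← IntPartition.unaryWord_tripleList, length_unaryWord]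
  simp only [IntPartition.tripleList, List.sum_append, List.sum_cons, h]
  omega

/-- The partitions of the numbers up to `L`. -/
def partFinset (L : ℕ) : Finset IntPartition := (Finset.range (L + 1)).sigma fun _ => Finset.univ

theorem mem_partFinset {L : ℕ} {lam : IntPartition} : lam ∈ partFinset L ↔ lam.1 ≤ L := by
  simp [partFinset]

/-- Sums over all partitions of size at most `L`. -/
theorem Sharp.sum_partFinset {γ : Type} [Ctx γ] {F : γ × PartData → ℕ} (hF : Sharp F) {L : γ → ℕ}
    (hL : PT L) (hb : PolyBdd L) : Sharp fun c => ∑ x ∈ partFinset (L c), F (c, x.data) := by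
  have h1 : DefSet fun p : γ × ℕ => partTabs p.2 :=
    DefSet.partTabs (by fun_prop)
      (PolyBdd.siz.mono fun c => by simp only [siz_prod, siz_nat]; omega)
  have h2 : Sharp fun p : (γ × ℕ) × (ℕ → ℕ) => F (p.1.1, (p.2, p.1.2)) :=
    hF.comp_of_siz_le (by fun_prop) fun p => by simp only [siz_prod, siz_nat, siz_tab]; omega
  refine ((Sharp.sum h1 h2).sum_range (m := fun c => L c + 1) (by fun_prop)
    (hb.add (.const 1))).congr fun c => ?_
  rw [partFinset, Finset.sum_sigma]
  exact Finset.sum_congr rfl fun m _ => (sum_partTabs m fun t => F (c, (t, m))).symm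

/-- A counting function of three partitions gives a function in `#P` of their encodings. -/
theorem exists_sharpP_of_sharp {G : (PartData × PartData) × PartData → ℕ} (hG : Sharp G) :
    ∃ g ∈ Complexity.SharpP,
      (∀ t, g (IntPartition.encodeTriple t) = G ((t.1.data, t.2.1.data), t.2.2.data)) ∧
      ∀ w, (¬ ∃ t, IntPartition.encodeTriple t = w) → g w = 0 := by
  classical
  have h1 : Sharp fun c : ((((ℕ → ℕ) × ℕ) × PartData) × PartData) × PartData =>
      if Encodes c.1.1.1 c.1.1.2 c.1.2 c.2 then 1 else 0 := Sharp.indicator (by fun_prop)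
  have h2 : Sharp fun c : ((((ℕ → ℕ) × ℕ) × PartData) × PartData) × PartData =>
      G ((c.1.1.2, c.1.2), c.2) :=
    hG.comp_of_siz_le (by fun_prop) fun p => by simp only [siz_prod, siz_nat, siz_tab]; omega
  have h3 := (h1.mul h2).sum_partFinset (L := fun c => c.1.1.2) (by fun_prop)
    (PolyBdd.siz.mono fun c => by simp only [siz_prod, siz_nat]; omega)
  have h4 := h3.sum_partFinset (L := fun c => c.1.2) (by fun_prop)
    (PolyBdd.siz.mono fun c => by simp only [siz_prod, siz_nat]; omega)
  have h5 := h4.sum_partFinset (L := fun c => c.2) (by fun_prop)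
    (PolyBdd.siz.mono fun c => by simp only [siz_prod, siz_nat]; omega)
  refine ⟨_, h5.mem_sharpP, fun t => ?_, fun w hw => ?_⟩
  · obtain ⟨hs1, hs2, hs3⟩ := size_le_length_encodeTriple t
    have e := fun a b c => encodes_iff (IntPartition.encodeTriple t) (a, b, c)
    simp only [e]
    rw [Finset.sum_eq_single_of_mem t.1 (mem_partFinset.2 hs1),
      Finset.sum_eq_single_of_mem t.2.1 (mem_partFinset.2 hs2),
      Finset.sum_eq_single_of_mem t.2.2 (mem_partFinset.2 hs3), if_pos rfl, one_mul]
    · intro c _ hc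
      rw [if_neg, zero_mul]
      intro h
      exact hc (congrArg (fun t => t.2.2) (IntPartition.encodeTriple_injective h))
    · intro b _ hb
      refine Finset.sum_eq_zero fun c _ => ?_
      rw [if_neg, zero_mul]
      intro h
      exact hb (congrArg (fun t => t.2.1) (IntPartition.encodeTriple_injective h))
    · intro a _ ha
      refine Finset.sum_eq_zero fun b _ => Finset.sum_eq_zero fun c _ => ?_
      rw [if_neg, zero_mul]
      intro h
      exact ha (congrArg (fun t => t.1) (IntPartition.encodeTriple_injective h))
  · refine Finset.sum_eq_zero fun a _ => Finset.sum_eq_zero fun b _ =>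
      Finset.sum_eq_zero fun c _ => ?_
    rw [if_neg, zero_mul]
    intro h
    exact hw ⟨(a, b, c), (encodes_iff w (a, b, c)).1 h⟩

/-! ### The Schur coefficients of a plethysm -/

theorem PTP.even : PTP fun j : ℕ => Even j := by
  have h : PTP fun j : ℕ => ∃ i < j + 1, j = i + i := by fun_prop
  convert h using 2 with j
  exact ⟨fun ⟨i, hi⟩ => ⟨i, by omega, hi⟩, fun ⟨i, _, hi⟩ => ⟨i, hi⟩⟩

theorem neg_one_pow_mul_eq (j x : ℕ) : (-1 : ℤ) ^ j * x
    = ((if Even j then 1 else 0) * x : ℕ) - ((if ¬ Even j then 1 else 0) * x : ℕ) := by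
  by_cases hj : Even j
  · rw [hj.neg_one_pow]
    simp [hj]
  · rw [(Nat.not_even_iff_odd.1 hj).neg_one_pow]
    simp [hj]

/-- Sums over part of the terms of the Neumann series of the inverse Kostka matrix. -/
theorem Sharp.sum_neumann {γ : Type} [Ctx γ] {W : (γ × PartData) × ℕ → ℕ} (hW : Sharp W)
    {s : ℕ → Prop} [DecidablePred s] (hs : PTP s) :
    Sharp fun c : γ × PartData =>
      ∑ j ∈ Finset.range (c.2.2 * c.2.2 + 1), (if s j then 1 else 0) * W (c, j) := by
  have h1 : Sharp fun c : (γ × PartData) × ℕ => if s c.2 then 1 else 0 :=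
    Sharp.indicator (hs.comp PT.snd)
  have h2 : PolyBdd fun c : γ × PartData => c.2.2 :=
    PolyBdd.siz.mono fun c => by simp only [siz_prod, siz_nat, siz_tab]; omega
  exact (h1.mul hW).sum_range (m := fun c : γ × PartData => c.2.2 * c.2.2 + 1) (by fun_prop)
    ((h2.mul h2).add (.const 1))

/-- If the coefficients of the plethysms in monomial symmetric functions are a counting function,
then the coefficients in Schur functions are an alternating sum of counting functions. -/
theorem exists_isPlethysmCoeff {f g : ClassicalBasis}
    {M : (PartData × PartData) × PartData → ℕ} (hM : Sharp M)
    (hMc : ∀ lam mu ka : IntPartition,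
      SymFunc.monoCoeff (SymFunc.plethysm (f.elem lam) (g.elem mu)) ka
        = M ((lam.data, mu.data), ka.data)) :
    ∃ (a : IntPartition → IntPartition → IntPartition →₀ ℤ)
      (W : ((PartData × PartData) × PartData) × ℕ → ℕ), Sharp W ∧ IsPlethysmCoeff f g a ∧
      (∀ b, IsPlethysmCoeff f g b → b = a) ∧ ∀ lam mu nu : IntPartition, a lam mu nu
        = ∑ j ∈ Finset.range (nu.1 * nu.1 + 1),
          (-1) ^ j * (W (((lam.data, mu.data), nu.data), j) : ℤ) := by
  obtain ⟨W, hW, hWc⟩ := IntPartition.exists_sharp_vecMul_pow hM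
  choose a ha1 ha2 ha3 using fun lam mu => SymFunc.exists_schur_expansion _ _ (hMc lam mu)
  refine ⟨a, W, hW, ha2, fun b hb => funext fun lam => funext fun mu => ha3 lam mu _ (hb lam mu), ?_⟩
  rintro lam mu ⟨n, nu⟩
  rw [ha1]
  simp only [IntPartition.invKostka_apply, hWc, Finset.mul_sum]
  rw [Finset.sum_comm]
  refine Finset.sum_congr rfl fun j _ => ?_
  rw [Matrix.vecMul, dotProduct, Nat.cast_sum, Finset.mul_sum]
  refine Finset.sum_congr rfl fun ka _ => ?_
  push_cast
  ring

theorem theorem1p5 (f g : ClassicalBasis) :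
    ∃ a : IntPartition → IntPartition → IntPartition →₀ ℤ,
      IsPlethysmCoeff f g a ∧
      (∀ b, IsPlethysmCoeff f g b → b = a) ∧
      Function.extend IntPartition.encodeTriple (fun t => a t.1 t.2.1 t.2.2) 0
        ∈ Complexity.GapP := by
  obtain ⟨M, hM, hMc⟩ := exists_sharp_plethysm f g
  obtain ⟨a, W, hW, ha1, ha2, ha⟩ := exists_isPlethysmCoeff hM hMc
  refine ⟨a, ha1, ha2, ?_⟩
  -- The even terms of the Neumann series are counted by `G`, the odd terms by `H`.
  obtain ⟨G, hG, hG1, hG2⟩ := exists_sharpP_of_sharp (hW.sum_neumann PTP.even)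
  obtain ⟨H, hH, hH1, hH2⟩ := exists_sharpP_of_sharp (hW.sum_neumann PTP.even.not)
  refine ⟨G, hG, H, hH, fun w => ?_⟩
  by_cases hw : ∃ t, IntPartition.encodeTriple t = w
  · obtain ⟨t, rfl⟩ := hw
    rw [IntPartition.encodeTriple_injective.extend_apply, hG1, hH1, ha, Nat.cast_sum, Nat.cast_sum,
      ← Finset.sum_sub_distrib]
    exact Finset.sum_congr rfl fun j _ => neg_one_pow_mul_eq j _
  · rw [Function.extend_apply' _ _ _ hw, hG2 w hw, hH2 w hw]
    simp
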